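/- Let $n\ge 1$ and let $Q=(Q_{xy})_{1\le x,y\le n}$ be a real bistochastic matrix: its entries are nonnegative and all its row sums and column sums are equal to $1$. Let $d=\max_x|\{y:(Q^{\intercal}Q)_{xy}\neq 0\}|$ and assume $d\ge 2$. For $0<\delta\le 1$ let $$\rho=\max\Big(\sqrt{\tfrac1n\sum_{x,y}|Q_{xy}|^2}\,,\ \min_{E\subset\{1,\dots,n\},\ |E|<n^{1-\delta}}\ \max_{x\notin E,\ y}|Q_{yx}|\Big).$$ Let $\sigma$ be a uniformly distributed random permutation of $\{1,\dots,n\}$, let $M$ be its permutation matrix, $M_{xy}=1$ if $\sigma(x)=y$ and $M_{xy}=0$ otherwise, and let $P=MQ$, with complex eigenvalues (repeated according to algebraic multiplicity) ordered so that $1=\lambda_1\ge|\lambda_2|\ge\dots\ge|\lambda_n|$. For all $0<c_0<\delta\le 1$ and all $K>0$ there is a constant $c_1>0$, depending only on $c_0$, $\delta$ and $K$, such that, for every such $n$ and $Q$ with $d\le \exp\big(K\sqrt{\log n}\big)$, $$\mathbb P\big(|\lambda_2|\ge(1+\varepsilon)\rho\big)\le n^{-c_0},\qquad \varepsilon=c_1\frac{\log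 d}{\sqrt{\log n}}.$$ -/

import Mathlib

namespace RandomBistochastic

open Finset

/-- The uniform probability on the symmetric group on `Fin n`: `|E| / n!`. -/
noncomputable def unifProb {n : ℕ} (E : Set (Equiv.Perm (Fin n))) : ℝ :=
  (E.ncard : ℝ) / (Fintype.card (Equiv.Perm (Fin n)) : ℝ)

/-- The random matrix `P = M Q`, where `M x y = 1` if `σ x = y` and `M x y = 0` otherwise. -/
def permMul {n : ℕ} (σ : Equiv.Perm (Fin n)) (Q : Matrix (Fin n) (Fin n) ℝ) :
    Matrix (Fin n) (Fin n) ℝ :=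
  Matrix.of (fun x y => if σ x = y then (1 : ℝ) else 0) * Q

/-- The moduli of the complex eigenvalues of a real matrix, repeated according to algebraic
multiplicity, in non-increasing order: `|λ₁|, |λ₂|, …, |λₙ|`. -/
noncomputable def eigenvalueModuli {n : ℕ} (A : Matrix (Fin n) (Fin n) ℝ) : List ℝ :=
  ((A.map (fun r : ℝ => (r : ℂ))).charpoly.roots.map (fun z : ℂ => ‖z‖)).sort (· ≥ ·)

/-- `|λ₂|`, the second largest modulus of an eigenvalue (for matrices of size at least two; the
value for smaller matrices is `0`). -/
noncomputable def absLambdaTwo {n : ℕ} (A : Matrix (Fin n) (Fin n) ℝ) : ℝ :=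
  (eigenvalueModuli A).getD 1 0

/-- The normalized Hilbert-Schmidt norm. -/
noncomputable def normHS {n : ℕ} (A : Matrix (Fin n) (Fin n) ℝ) : ℝ :=
  Real.sqrt ((1 / (n : ℝ)) * ∑ x, ∑ y, |A x y| ^ 2)

/-- The relaxed `ℓ¹ → ℓ^∞` norm: the infimum, over sets `E` of fewer than `n ^ (1 - δ)` columns, of
the largest modulus of an entry of `A` outside the columns in `E`. -/
noncomputable def normOneInfty {n : ℕ} (δ : ℝ) (A : Matrix (Fin n) (Fin n) ℝ) : ℝ :=
  ⨅ E : {E : Finset (Fin n) // (E.card : ℝ) < (n : ℝ) ^ (1 - δ)},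
    ⨆ p : {x : Fin n // x ∉ E.1} × Fin n, |A p.2 p.1|

/-- The sparsity parameter `‖A‖_{1 → 0}`: the largest number of nonzero entries in a row. -/
noncomputable def normOneZero {n : ℕ} (A : Matrix (Fin n) (Fin n) ℝ) : ℕ :=
  univ.sup (fun x : Fin n => {y : Fin n | A x y ≠ 0}.ncard)

/-- The parameter `d = ‖Qᵀ Q‖_{1 → 0}`. -/
noncomputable def dParam {n : ℕ} (Q : Matrix (Fin n) (Fin n) ℝ) : ℕ :=
  normOneZero (Q.transpose * Q)

/-- The parameter `ρ`, the maximum of `‖Q‖_HS` and of the relaxed `ℓ¹ → ℓ^∞` norm. -/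
noncomputable def rhoParam {n : ℕ} (δ : ℝ) (Q : Matrix (Fin n) (Fin n) ℝ) : ℝ :=
  max (normHS Q) (normOneInfty δ Q)

end RandomBistochastic

namespace RandomBistochastic

open Finset

set_option linter.unusedSectionVars false
set_option linter.unusedSimpArgs false
set_option linter.unusedVariables false

/-! Let `A` be `Q` minus the projection onto constants and `P = MA`. Rows of `A` sum to zero, so the
spectrum of `MQ` is that of `P` with one eigenvalue 0 replaced by 1. It is enough that `D(z) = det(1
- zP)` has no zero with `|z| ≤ 1 / ((1 + ε)ρ)`.

The coefficients of `D` are signed sums of principal minors. Minors are antisymmetric in the rows,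
which are uniformly permuted, so two minors are uncorrelated unless their index sets differ by at
most one exchange; the Gram determinants of `A` then give second moments at most `poly(n) ρ^(2k)`
for every `k ≤ n` (`permMean_minorSum_sq_le`).

Such bounds alone do not exclude zeros, so `D` is multiplied by a truncated approximate inverse `H`.
Its coefficients (`flowSum`) sum the weights of flows, that is, disjoint cycles with multiplicities,
avoiding the exceptional set `E` of columns with large entries. In `D·H` a pair (set of disjoint
cycles, flow) cancels against others whenever the two follow the same cycles and avoid `E`
(`sum_compatible_pairTerm_eq_zero`). Only pairs with a genuine crossing or a visit to `E` survive,
and their second moment carries an extra factor close to `n^(-δ)`. Thus `D·H` is near 1 up to degree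
`K`. Beyond `K`, the crude bounds on both factors are beaten by `(1 + ε)^(-K) ≤ n^(-10)`, and `D`
cannot vanish (`sum_ne_zero_of_product_close`).

The second moments of flows involve families of four flows, read on the slots formed by their joint
support. Injectivity of the images of the slots under the random permutation is written as a signed
sum over permutations `τ` of the slots preserving the images; centring forces a slot fixed by `τ` to
have multiplicity at least two (`abs_permMean_prod_le`). What remains is summed along a spanning
forest of a graph on positions and images. A slot that is just a loop contributes `n ρ^m`, by the
Hilbert-Schmidt norm; every other (active) slot loses a power of `n` (`IsReduced.slotSum_le`,
`exponent_le`). Positions may be relabelled freely, so the multiplicities need counting only up to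
permutation of the slots: at most `exp(aN + 16/a²)` choices in total degree `N`
(`card_image_multFamilies_le`).

Optimising `a` makes this entropy of order `N^(2/3)`. It stays a small multiple of `log n` for `N`
of order `(log n)^(3/2)`; then `(1 + ε)^K ≥ n^10` asks for `ε` of order `1/√(log n)`. Powers of
`1/ρ` are powers of `d`, hence subpolynomial by the hypothesis on `d`. -/

section

/-! ### Principal minors, flows, and the cancellation of compatible pairs -/

section Flows

variable {α : Type*} [Fintype α] [DecidableEq α]

/-- Multiplicities on the vertices together with a permutation. -/
abbrev FlowData (α : Type*) := (α → ℕ) × Equiv.Perm α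

/-- The multiplicities are constant on the cycles of the permutation, which fixes every vertex of
multiplicity zero: a family of disjoint cycles with multiplicities. -/
def IsFlow {α : Type*} (f : FlowData α) : Prop :=
  (∀ x, f.1 (f.2 x) = f.1 x) ∧ ∀ x, f.1 x = 0 → f.2 x = x

/-- The degree of a flow. -/
def flowDeg (f : FlowData α) : ℕ := ∑ x, f.1 x

/-- The weight of a flow on a matrix. -/
def flowWeight {R : Type*} [CommRing R] (P : Matrix α α R) (f : FlowData α) : R :=
  ∏ x, P x (f.2 x) ^ f.1 x

open Classical in
/-- The finite set of flows all of whose multiplicities are at most `k`. -/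
noncomputable def flowsLE (α : Type*) [Fintype α] [DecidableEq α] (k : ℕ) :
    Finset (FlowData α) :=
  ((Fintype.piFinset fun _ : α => range (k + 1)) ×ˢ univ).filter IsFlow

lemma mem_flowsLE {k : ℕ} {f : FlowData α} :
    f ∈ flowsLE α k ↔ (∀ x, f.1 x ≤ k) ∧ IsFlow f := by
  simp [flowsLE]

lemma le_flowDeg (f : FlowData α) (x : α) : f.1 x ≤ flowDeg f :=
  single_le_sum (f := f.1) (fun _ _ => Nat.zero_le _) (mem_univ x)

/-- The signed sum over the permutations supported in `S`: the principal minor of index `S`. -/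
noncomputable def principalMinor {R : Type*} [CommRing R] (P : Matrix α α R) (S : Finset α) : R :=
  ∑ π : Equiv.Perm α with ∀ x, x ∉ S → π x = x, (Equiv.Perm.sign π : ℤ) * ∏ x ∈ S, P x (π x)

/-- The sum of the principal minors of size `k`. -/
noncomputable def minorSum {R : Type*} [CommRing R] (P : Matrix α α R) (k : ℕ) : R :=
  ∑ S ∈ powersetCard k univ, principalMinor P S

/-- In the Leibniz expansion each index picks either the identity or the entry of `z • P`; picking
the identity off `S` forces the permutation to fix the complement of `S`. -/
lemma det_one_add_smul_eq_sum_principalMinor {R : Type*} [CommRing R] (P : Matrix α α R) (z : R) :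
    (1 + z • P).det = ∑ S : Finset α, z ^ S.card * principalMinor P S := by
  rw [← Matrix.det_transpose, Matrix.det_apply']
  have h : ∀ π : Equiv.Perm α, ∏ x, (1 + z • P).transpose (π x) x =
      ∑ S : Finset α, (if ∀ x, x ∉ S → π x = x then z ^ S.card * ∏ x ∈ S, P x (π x) else 0) := by
    intro π
    have : ∀ x, (1 + z • P).transpose (π x) x = z * P x (π x) + (if π x = x then 1 else 0) := by
      intro x
      simp [Matrix.transpose_apply, Matrix.add_apply, Matrix.one_apply, add_comm, eq_comm]
    simp_rw [this]
    rw [prod_add, powerset_univ]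
    refine sum_congr rfl fun S _ => ?_
    rw [prod_mul_distrib, prod_const]
    split_ifs with hS
    · rw [prod_eq_one (s := univ \ S), mul_one]
      intro x hx
      simp only [mem_sdiff, mem_univ, true_and] at hx
      simp [hS x hx]
    · push Not at hS
      obtain ⟨x, hx, hne⟩ := hS
      rw [prod_eq_zero (s := univ \ S) (i := x) (by simp [hx]) (by simp [hne]), mul_zero]
  simp_rw [h, mul_sum]
  rw [sum_comm]
  refine sum_congr rfl fun S _ => ?_
  rw [principalMinor, mul_sum, sum_filter]
  refine sum_congr rfl fun π _ => ?_
  split_ifs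
  · ring
  · simp

lemma det_one_add_smul_eq_sum_minorSum {R : Type*} [CommRing R] (P : Matrix α α R) (z : R) :
    (1 + z • P).det = ∑ k ∈ range (Fintype.card α + 1), z ^ k * minorSum P k := by
  rw [det_one_add_smul_eq_sum_principalMinor, ← powerset_univ, sum_powerset]
  refine sum_congr rfl fun k _ => ?_
  rw [minorSum, mul_sum]
  refine sum_congr rfl fun S hS => ?_
  rw [(mem_powersetCard.1 hS).2]

lemma minorSum_map {R S : Type*} [CommRing R] [CommRing S] (φ : R →+* S) (P : Matrix α α R)
    (k : ℕ) : minorSum (P.map φ) k = φ (minorSum P k) := by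
  simp [minorSum, principalMinor, map_sum, map_prod]

/-- The permutation given by a bijective function. -/
noncomputable def permOf (f : α → α) : Equiv.Perm α :=
  open Classical in if h : Function.Bijective f then Equiv.ofBijective f h else 1

lemma permOf_apply {f : α → α} (h : Function.Injective f) (x : α) : permOf f x = f x := by
  rw [permOf, dif_pos (Finite.injective_iff_bijective.1 h)]
  rfl

open Classical in
/-- The flows of degree `k` with multiplicities at most one. -/
noncomputable def unitFlows (α : Type*) [Fintype α] [DecidableEq α] (k : ℕ) :
    Finset (FlowData α) :=
  (flowsLE α k).filter fun f => flowDeg f = k ∧ ∀ x, f.1 x ≤ 1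

open Classical in
/-- The flows of degree `k` which avoid the set `E`. -/
noncomputable def avoidingFlows (E : Finset α) (k : ℕ) : Finset (FlowData α) :=
  (flowsLE α k).filter fun f => flowDeg f = k ∧ ∀ x ∈ E, f.1 x = 0

/-- The generating coefficients of the flows which avoid `E`. -/
noncomputable def flowSum {R : Type*} [CommRing R] (P : Matrix α α R) (E : Finset α) (k : ℕ) : R :=
  ∑ f ∈ avoidingFlows E k, flowWeight P f

lemma mem_unitFlows {k : ℕ} {f : FlowData α} :
    f ∈ unitFlows α k ↔ IsFlow f ∧ flowDeg f = k ∧ ∀ x, f.1 x ≤ 1 := by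
  simp only [unitFlows, mem_filter, mem_flowsLE]
  constructor
  · rintro ⟨⟨-, h⟩, h'⟩
    exact ⟨h, h'⟩
  · rintro ⟨h, h1, h2⟩
    exact ⟨⟨fun x => h1 ▸ le_flowDeg f x, h⟩, h1, h2⟩

lemma mem_avoidingFlows {E : Finset α} {k : ℕ} {f : FlowData α} :
    f ∈ avoidingFlows E k ↔ IsFlow f ∧ flowDeg f = k ∧ ∀ x ∈ E, f.1 x = 0 := by
  simp only [avoidingFlows, mem_filter, mem_flowsLE]
  constructor
  · rintro ⟨⟨-, h⟩, h'⟩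
    exact ⟨h, h'⟩
  · rintro ⟨h, h1, h2⟩
    exact ⟨⟨fun x => h1 ▸ le_flowDeg f x, h⟩, h1, h2⟩

/-- The multiplicity function of a set of vertices. -/
def indic (S : Finset α) (x : α) : ℕ := if x ∈ S then 1 else 0

lemma sum_indic (S : Finset α) : ∑ x, indic S x = S.card := by
  simp [indic]

lemma filter_indic_pos (S : Finset α) : (univ.filter fun x => 0 < indic S x) = S := by
  ext x
  rw [mem_filter]
  by_cases h : x ∈ S <;> simp [indic, h]

lemma flowWeight_indic {R : Type*} [CommRing R] (P : Matrix α α R) (S : Finset α)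
    (π : Equiv.Perm α) : flowWeight P (indic S, π) = ∏ x ∈ S, P x (π x) := by
  simp [flowWeight, indic, prod_ite_mem, apply_ite, pow_ite]

lemma eq_indic_of_le_one {m : α → ℕ} (h : ∀ x, m x ≤ 1) :
    m = indic (univ.filter fun x => 0 < m x) := by
  funext x
  have := h x
  simp only [indic, mem_filter, mem_univ, true_and]
  split_ifs <;> omega

lemma maps_mem_of_fixes_compl {S : Finset α} {π : Equiv.Perm α} (h : ∀ x, x ∉ S → π x = x) (x : α) :
    π x ∈ S ↔ x ∈ S := by
  constructor
  · intro hx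
    by_contra hn
    rw [h x hn] at hx
    exact hn hx
  · intro hx
    by_contra hn
    have := π.injective (h _ hn)
    rw [this] at hn
    exact hn hx

lemma minorSum_eq_sum_unitFlows {R : Type*} [CommRing R] (P : Matrix α α R) (k : ℕ) :
    minorSum P k =
      ∑ f ∈ unitFlows α k, ((Equiv.Perm.sign f.2 : ℤ) : R) * flowWeight P f := by
  unfold minorSum principalMinor
  rw [sum_sigma']
  refine sum_bij' (fun p _ => (indic p.1, p.2))
    (fun f _ => ⟨univ.filter fun x => 0 < f.1 x, f.2⟩) ?_ ?_ ?_ ?_ ?_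
  · rintro ⟨S, π⟩ h
    simp only [mem_sigma, mem_powersetCard, subset_univ, true_and, mem_filter, mem_univ] at h
    rw [mem_unitFlows]
    refine ⟨⟨fun x => ?_, fun x hx => h.2 x ?_⟩, ?_, fun x => ?_⟩
    · simp [indic, maps_mem_of_fixes_compl h.2]
    · simpa [indic] using hx
    · rw [flowDeg, sum_indic, h.1]
    · simp only [indic]; split_ifs <;> simp
  · intro f h
    rw [mem_unitFlows] at h
    simp only [mem_sigma, mem_powersetCard, subset_univ, true_and, mem_filter, mem_univ, not_lt,
      nonpos_iff_eq_zero]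
    refine ⟨?_, h.1.2⟩
    rw [← sum_indic, ← eq_indic_of_le_one h.2.2]
    exact h.2.1
  · rintro ⟨S, π⟩ h
    simp only [Sigma.mk.injEq, heq_eq_eq, and_true]
    exact filter_indic_pos S
  · intro f h
    rw [mem_unitFlows] at h
    exact Prod.ext (eq_indic_of_le_one h.2.2).symm rfl
  · rintro ⟨S, π⟩ h
    rw [flowWeight_indic]

open Classical in
/-- The pairs formed by a flow with multiplicities at most one and a flow which avoids `E`, of
total degree `k`. -/
noncomputable def flowPairs (E : Finset α) (k : ℕ) : Finset (FlowData α × FlowData α) :=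
  (flowsLE α k ×ˢ flowsLE α k).filter fun p =>
    flowDeg p.1 + flowDeg p.2 = k ∧ (∀ x, p.1.1 x ≤ 1) ∧ ∀ x ∈ E, p.2.1 x = 0

lemma mem_flowPairs {E : Finset α} {k : ℕ} {p : FlowData α × FlowData α} :
    p ∈ flowPairs E k ↔ IsFlow p.1 ∧ IsFlow p.2 ∧ flowDeg p.1 + flowDeg p.2 = k ∧
      (∀ x, p.1.1 x ≤ 1) ∧ ∀ x ∈ E, p.2.1 x = 0 := by
  simp only [flowPairs, mem_filter, mem_product, mem_flowsLE]
  constructor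
  · rintro ⟨⟨⟨-, h1⟩, -, h2⟩, h⟩
    exact ⟨h1, h2, h⟩
  · rintro ⟨h1, h2, h⟩
    refine ⟨⟨⟨fun x => ?_, h1⟩, fun x => ?_, h2⟩, h⟩
    · have := le_flowDeg p.1 x; omega
    · have := le_flowDeg p.2 x; omega

/-- The two flows of a pair follow the same cycles, and these avoid `E`. -/
def IsCompatible (E : Finset α) (p : FlowData α × FlowData α) : Prop :=
  (∀ x ∈ E, p.1.1 x = 0) ∧ ∀ x, 0 < p.1.1 x → 0 < p.2.1 x → p.1.2 x = p.2.2 x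

/-- The signed weight of a pair of flows. -/
noncomputable def pairTerm {R : Type*} [CommRing R] (P : Matrix α α R)
    (p : FlowData α × FlowData α) : R :=
  (-1) ^ flowDeg p.1 * ((Equiv.Perm.sign p.1.2 : ℤ) : R) * (flowWeight P p.1 * flowWeight P p.2)

lemma sum_antidiagonal_minorSum_mul_flowSum {R : Type*} [CommRing R] (P : Matrix α α R)
    (E : Finset α) (k : ℕ) :
    ∑ ij ∈ antidiagonal k, ((-1) ^ ij.1 * minorSum P ij.1) * flowSum P E ij.2 =
      ∑ p ∈ flowPairs E k, pairTerm P p := by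
  have h : ∀ ij : ℕ × ℕ, ((-1) ^ ij.1 * minorSum P ij.1) * flowSum P E ij.2 =
      ∑ p ∈ unitFlows α ij.1 ×ˢ avoidingFlows E ij.2,
        ((-1) ^ ij.1 * (((Equiv.Perm.sign p.1.2 : ℤ) : R) * flowWeight P p.1)) *
          flowWeight P p.2 := by
    intro ij
    rw [minorSum_eq_sum_unitFlows, flowSum, mul_sum (unitFlows α ij.1), sum_mul_sum, sum_product]
  simp_rw [h, sum_sigma']
  refine sum_bij' (fun q _ => (q.2.1, q.2.2))
    (fun p _ => ⟨(flowDeg p.1, flowDeg p.2), p.1, p.2⟩) ?_ ?_ ?_ ?_ ?_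
  · rintro ⟨⟨i, j⟩, f, g⟩ h
    simp only [mem_sigma, HasAntidiagonal.mem_antidiagonal, mem_product, mem_unitFlows, mem_avoidingFlows] at h
    rw [mem_flowPairs]
    obtain ⟨h1, ⟨h2, h3, h4⟩, h5, h6, h7⟩ := h
    exact ⟨h2, h5, by simp only; omega, h4, h7⟩
  · rintro ⟨f, g⟩ h
    rw [mem_flowPairs] at h
    simp only [mem_sigma, HasAntidiagonal.mem_antidiagonal, mem_product, mem_unitFlows, mem_avoidingFlows]
    exact ⟨h.2.2.1, ⟨h.1, trivial, h.2.2.2.1⟩, h.2.1, trivial, h.2.2.2.2⟩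
  · rintro ⟨⟨i, j⟩, f, g⟩ h
    simp only [mem_sigma, HasAntidiagonal.mem_antidiagonal, mem_product, mem_unitFlows, mem_avoidingFlows] at h
    obtain ⟨h1, ⟨h2, rfl, h4⟩, h5, rfl, h7⟩ := h
    rfl
  · rintro ⟨f, g⟩ h
    rfl
  · rintro ⟨⟨i, j⟩, f, g⟩ h
    simp only [mem_sigma, HasAntidiagonal.mem_antidiagonal, mem_product, mem_unitFlows, mem_avoidingFlows] at h
    obtain ⟨h1, ⟨h2, rfl, h4⟩, h5, rfl, h7⟩ := h
    simp only [pairTerm]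
    ring

/-- The signed number of sets of cycles of a nontrivial flow vanishes. -/
lemma sum_sign_subflows_eq_zero {g : FlowData α} (hg : IsFlow g) (hne : ∃ x, 0 < g.1 x) :
    ∑ h : Finset α × Equiv.Perm α with (∀ x, x ∉ h.1 → h.2 x = x) ∧
        ∀ x ∈ h.1, 0 < g.1 x ∧ h.2 x = g.2 x,
      (-1 : ℝ) ^ h.1.card * ((Equiv.Perm.sign h.2 : ℤ) : ℝ) = 0 := by
  set B : Matrix α α ℝ := Matrix.of fun x y => if 0 < g.1 x ∧ y = g.2 x then 1 else 0 with hB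
  -- `B` is the permutation matrix of `g.2` cut to the support of `g`. The indicator of that support
  -- is a kernel vector of `1 - B`, because multiplicities are constant along cycles; expanding the
  -- zero determinant into minors gives the signed count.
  have hdet : (1 + (-1 : ℝ) • B).det = 0 := by
    rw [← Matrix.exists_mulVec_eq_zero_iff]
    obtain ⟨x₀, hx₀⟩ := hne
    refine ⟨fun x => if 0 < g.1 x then 1 else 0, ?_, ?_⟩
    · intro h
      have := congrFun h x₀
      simp [hx₀] at this
    · funext x
      rw [Matrix.add_mulVec, Matrix.one_mulVec, Matrix.smul_mulVec]
      simp only [Pi.add_apply, Pi.smul_apply, Matrix.mulVec, dotProduct, hB, Matrix.of_apply,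
        smul_eq_mul, Pi.zero_apply]
      rw [sum_eq_single (g.2 x)]
      · rw [hg.1 x]
        by_cases hx : 0 < g.1 x <;> simp [hx]
      · intro y _ hy
        simp [hy]
      · simp
  rw [det_one_add_smul_eq_sum_principalMinor] at hdet
  rw [← hdet]
  simp_rw [principalMinor, mul_sum, sum_sigma']
  symm
  rw [sum_filter]
  have key : ∀ S : Finset α, ∀ π : Equiv.Perm α,
      ∏ x ∈ S, B x (π x) = if ∀ x ∈ S, 0 < g.1 x ∧ π x = g.2 x then 1 else 0 := by
    intro S π
    simp only [hB, Matrix.of_apply]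
    split_ifs with h
    · exact prod_eq_one fun x hx => by simp [(h x hx).1, (h x hx).2]
    · push Not at h
      obtain ⟨x, hx, hx'⟩ := h
      refine prod_eq_zero hx ?_
      rw [if_neg]
      rintro ⟨h1, h2⟩
      exact hx' h1 h2
  simp_rw [key]
  rw [sum_sigma, Fintype.sum_prod_type]
  refine sum_congr rfl fun S _ => ?_
  rw [sum_filter]
  refine sum_congr rfl fun π _ => ?_
  by_cases h1 : ∀ x, x ∉ S → π x = x
  · by_cases h2 : ∀ x ∈ S, 0 < g.1 x ∧ π x = g.2 x
    · rw [if_pos h1, if_pos h2, if_pos ⟨h1, h2⟩, mul_one]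
    · rw [if_pos h1, if_neg h2, if_neg fun h => h2 h.2, mul_zero, mul_zero]
  · rw [if_neg h1, if_neg fun h => h1 h.1]

/-- Two permutations which agree where both multiplicities are positive: the second multiplicity
is positive along the backward cycle of the first permutation. -/
lemma pos_of_pos_apply {m m' : α → ℕ} {π π' : Equiv.Perm α} (h1 : ∀ x, m (π x) = m x)
    (h3 : ∀ x, m' (π' x) = m' x) (h5 : ∀ x, 0 < m x → 0 < m' x → π x = π' x) {x : α}
    (hx : 0 < m x) (h : 0 < m' (π x)) : 0 < m' x := by
  -- From `π x` onwards the two permutations agree as long as both multiplicities are positive, so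
  -- positivity propagates along the cycle of `π`, which finally returns to `x`.
  have c : ∀ i : ℕ, 0 < m ((π ^ i) (π x)) ∧ 0 < m' ((π ^ i) (π x)) := by
    intro i
    induction i with
    | zero => exact ⟨by simpa [h1] using hx, h⟩
    | succ i ih =>
      rw [pow_succ', Equiv.Perm.mul_apply]
      refine ⟨by rw [h1]; exact ih.1, ?_⟩
      rw [h5 _ ih.1 ih.2, h3]
      exact ih.2
  have := (c (orderOf π - 1)).2
  rwa [← Equiv.Perm.mul_apply, ← pow_succ, Nat.sub_add_cancel (orderOf_pos π),
    pow_orderOf_eq_one] at this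

open Classical in
lemma mem_filter_compatible {E : Finset α} {k : ℕ} {m m' : α → ℕ} {π π' : Equiv.Perm α} :
    ((m, π), (m', π')) ∈ (flowPairs E k).filter (IsCompatible E) ↔
      ((((∀ x, m (π x) = m x) ∧ ∀ x, m x = 0 → π x = x) ∧
        ((∀ x, m' (π' x) = m' x) ∧ ∀ x, m' x = 0 → π' x = x) ∧
        ∑ x, m x + ∑ x, m' x = k ∧ (∀ x, m x ≤ 1) ∧ ∀ x ∈ E, m' x = 0) ∧
        (∀ x ∈ E, m x = 0) ∧ ∀ x, 0 < m x → 0 < m' x → π x = π' x) := by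
  rw [mem_filter, mem_flowPairs]
  rfl

-- A compatible pair amounts to its superposition, a flow avoiding `E`, together with a selected set
-- of cycles of it. The product of the weights depends on the superposition only, so the signs sum
-- to zero by `sum_sign_subflows_eq_zero` once the degree is positive.
open Classical in
lemma sum_compatible_pairTerm_eq_zero (P : Matrix α α ℝ) (E : Finset α) {k : ℕ} (hk : 0 < k) :
    ∑ p ∈ flowPairs E k with IsCompatible E p, pairTerm P p = 0 := by
  have key : ∑ p ∈ flowPairs E k with IsCompatible E p, pairTerm P p =
      ∑ q ∈ (avoidingFlows E k).sigma fun g => univ.filter fun h : Finset α × Equiv.Perm α =>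
        (∀ x, x ∉ h.1 → h.2 x = x) ∧ ∀ x ∈ h.1, 0 < g.1 x ∧ h.2 x = g.2 x,
        flowWeight P q.1 * ((-1 : ℝ) ^ q.2.1.card * ((Equiv.Perm.sign q.2.2 : ℤ) : ℝ)) := by
    -- The superposition follows the first flow on its support and the second flow elsewhere. If the
    -- two parts collided at a point where the second flow is positive, `pos_of_pos_apply` would
    -- make it positive before that point too, where both permutations agree.
    have inj1 : ∀ p ∈ (flowPairs E k).filter (IsCompatible E), Function.Injective
        fun x => if 0 < p.1.1 x then p.1.2 x else p.2.2 x := by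
      rintro ⟨⟨m, π⟩, m', π'⟩ h x y hxy
      rw [mem_filter_compatible] at h
      obtain ⟨⟨⟨h1, h2⟩, ⟨h3, h4⟩, -⟩, -, h5⟩ := h
      have aux : ∀ x y, 0 < m x → ¬ 0 < m y → π x = π' y → x = y := by
        intro x y hx hy hxy
        by_cases hy' : 0 < m' y
        · have h6 : 0 < m' x := by
            have a : 0 < m' (π x) := by rw [hxy, h3]; exact hy'
            obtain ⟨z, hz⟩ := π'.surjective (π x)
            have hzy : z = y := π'.injective (hz.trans hxy)
            subst hzy
            exact pos_of_pos_apply h1 h3 h5 hx a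
          have := h5 x hx h6
          exact π'.injective (this.symm.trans hxy)
        · rw [h4 y (by omega)] at hxy
          exfalso
          have := h1 x
          rw [hxy] at this
          omega
      simp only at hxy
      split_ifs at hxy with a b b
      · exact π.injective hxy
      · exact aux x y a b hxy
      · exact (aux y x b a hxy.symm).symm
      · exact π'.injective hxy
    -- The inverse map: removing the selected cycles once leaves multiplicities that are still
    -- constant along the cycles of `g`.
    have inj2 : ∀ (g : FlowData α) (S : Finset α) (π : Equiv.Perm α), IsFlow g →
        (∀ x, x ∉ S → π x = x) → (∀ x ∈ S, 0 < g.1 x ∧ π x = g.2 x) → Function.Injective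
        fun x => if 0 < g.1 x - indic S x then g.2 x else x := by
      rintro ⟨m, ψ⟩ S π ⟨hg1, hg2⟩ h1 h2 x y hxy
      have hS : ∀ x, ψ x ∈ S ↔ x ∈ S := by
        intro x
        constructor
        · intro hx
          obtain ⟨z, hz⟩ := π.surjective (ψ x)
          have hzS : z ∈ S := by
            rw [← maps_mem_of_fixes_compl h1, hz]; exact hx
          have := (h2 z hzS).2
          rw [hz] at this
          rw [ψ.injective this]
          exact hzS
        · intro hx
          rw [← (h2 x hx).2, maps_mem_of_fixes_compl h1]
          exact hx
      have hinv : ∀ x, m (ψ x) - indic S (ψ x) = m x - indic S x := by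
        intro x
        have : indic S (ψ x) = indic S x := by simp [indic, hS]
        rw [this]
        simp only at hg1
        rw [hg1]
      simp only at hxy
      split_ifs at hxy with a b b
      · exact ψ.injective hxy
      · exfalso; rw [← hxy, hinv] at b; exact b a
      · exfalso; rw [hxy, hinv] at a; exact a b
      · exact hxy
    refine sum_bij'
      (fun p _ => ⟨(fun x => p.1.1 x + p.2.1 x,
          permOf fun x => if 0 < p.1.1 x then p.1.2 x else p.2.2 x),
        (univ.filter fun x => 0 < p.1.1 x, p.1.2)⟩)
      (fun q _ => ((indic q.2.1, q.2.2), (fun x => q.1.1 x - indic q.2.1 x,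
        permOf fun x => if 0 < q.1.1 x - indic q.2.1 x then q.1.2 x else x))) ?_ ?_ ?_ ?_ ?_
    · intro p hp
      have hi := inj1 p hp
      obtain ⟨⟨m, π⟩, m', π'⟩ := p
      rw [mem_filter_compatible] at hp
      obtain ⟨⟨⟨h1, h2⟩, ⟨h3, h4⟩, hd, h01, hE'⟩, hE, h5⟩ := hp
      simp only [mem_sigma, mem_avoidingFlows, mem_filter, mem_univ, true_and, IsFlow, flowDeg,
        permOf_apply hi]
      have hm : ∀ x, 0 < m x → m' (π x) = m' x := by
        intro x hx
        by_cases hx' : 0 < m' x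
        · rw [h5 x hx hx', h3]
        · by_contra hne
          exact hx' (pos_of_pos_apply h1 h3 h5 hx (by omega))
      refine ⟨⟨⟨fun x => ?_, fun x hx => ?_⟩, ?_, fun x hx => ?_⟩, fun x hx => ?_, fun x hx => ?_⟩
      · split_ifs with a
        · rw [h1, hm x a]
        · rw [h3]
          have : m (π' x) = 0 := by
            by_cases hx' : 0 < m' x
            · by_contra hne
              obtain ⟨z, hz⟩ := π.surjective (π' x)
              have hz0 : 0 < m z := by rw [← h1, hz]; omega
              have := hi (a₁ := z) (a₂ := x) (by simp only [if_pos hz0, if_neg a, hz])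
              rw [this] at hz0
              exact a hz0
            · rw [h4 x (by omega)]; omega
          rw [this]; omega
      · rw [if_neg (by omega), h4 x (by omega)]
      · rw [sum_add_distrib, hd]
      · rw [hE x hx, hE' x hx]
      · exact h2 x (by omega)
      · exact ⟨by omega, (if_pos hx).symm⟩
    · rintro ⟨g, S, π⟩ hq
      simp only [mem_sigma, mem_avoidingFlows, mem_filter, mem_univ, true_and] at hq
      obtain ⟨⟨hg, hd, hE⟩, h1, h2⟩ := hq
      have hi := inj2 g S π hg h1 h2
      rw [mem_filter_compatible]
      simp only [permOf_apply hi]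
      have hle : ∀ x, indic S x ≤ g.1 x := by
        intro x
        simp only [indic]
        split_ifs with hx
        · exact (h2 x hx).1
        · exact Nat.zero_le _
      have hS : ∀ x, g.2 x ∈ S ↔ x ∈ S := by
        intro x
        constructor
        · intro hx
          obtain ⟨z, hz⟩ := π.surjective (g.2 x)
          have hzS : z ∈ S := by
            rw [← maps_mem_of_fixes_compl h1, hz]; exact hx
          have := (h2 z hzS).2
          rw [hz] at this
          rw [g.2.injective this]
          exact hzS
        · intro hx
          rw [← (h2 x hx).2, maps_mem_of_fixes_compl h1]
          exact hx
      refine ⟨⟨⟨fun x => ?_, fun x hx => h1 x ?_⟩, ⟨fun x => ?_, fun x hx => ?_⟩, ?_, fun x => ?_,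
        fun x hx => ?_⟩, fun x hx => ?_, fun x hx hx' => ?_⟩
      · simp [indic, maps_mem_of_fixes_compl h1]
      · simpa [indic] using hx
      · split_ifs with a
        · have : indic S (g.2 x) = indic S x := by simp [indic, hS]
          rw [this, hg.1]
        · rfl
      · rw [if_neg (by omega)]
      · rw [← sum_add_distrib, ← hd, flowDeg]
        exact sum_congr rfl fun x _ => by have := hle x; omega
      · simp only [indic]; split_ifs <;> simp
      · rw [hE x hx]; simp
      · have := hle x
        rw [hE x hx] at this
        omega
      · rw [if_pos hx']
        refine (h2 x ?_).2
        by_contra hn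
        simp [indic, hn] at hx
    · intro p hp
      have hi := inj1 p hp
      obtain ⟨⟨m, π⟩, m', π'⟩ := p
      rw [mem_filter_compatible] at hp
      obtain ⟨⟨⟨h1, h2⟩, ⟨h3, h4⟩, hd, h01, hE'⟩, hE, h5⟩ := hp
      have e1 := eq_indic_of_le_one h01
      simp only [← e1, Prod.mk.injEq, true_and]
      have e2 : ∀ x, m x + m' x - m x = m' x := fun x => by omega
      refine ⟨by funext x; exact e2 x, ?_⟩
      have hfun : (fun x => if 0 < m x + m' x - m x then (permOf fun x => if 0 < m x then π x else π' x) x else x)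
          = π' := by
        funext x
        rw [e2, permOf_apply hi]
        split_ifs with a b
        · exact h5 x b a
        · rfl
        · exact (h4 x (by omega)).symm
      ext x
      rw [hfun, permOf_apply π'.injective]
    · rintro ⟨g, S, π⟩ hq
      simp only [mem_sigma, mem_avoidingFlows, mem_filter, mem_univ, true_and] at hq
      obtain ⟨⟨hg, hd, hE⟩, h1, h2⟩ := hq
      have hi := inj2 g S π hg h1 h2
      have hle : ∀ x, indic S x ≤ g.1 x := by
        intro x
        simp only [indic]
        split_ifs with hx
        · exact (h2 x hx).1
        · exact Nat.zero_le _
      have e1 : (fun x => indic S x + (g.1 x - indic S x)) = g.1 := by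
        funext x; have := hle x; omega
      have e2 := filter_indic_pos S
      have e3 : (fun x => if 0 < indic S x then π x else
          (permOf fun x => if 0 < g.1 x - indic S x then g.2 x else x) x) = g.2 := by
        funext x
        rw [permOf_apply hi]
        by_cases hx : x ∈ S
        · simp [indic, hx, (h2 x hx).2]
        · simp only [indic, hx, if_false, lt_irrefl, Nat.sub_zero]
          split_ifs with a
          · rfl
          · exact (hg.2 x (by omega)).symm
      simp only [e1, e2, e3, Sigma.mk.injEq, Prod.mk.injEq, heq_eq_eq, and_true]
      refine Prod.ext rfl ?_
      ext x
      simp only [permOf_apply g.2.injective]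
    · intro p hp
      have hi := inj1 p hp
      obtain ⟨⟨m, π⟩, m', π'⟩ := p
      rw [mem_filter_compatible] at hp
      obtain ⟨⟨⟨h1, h2⟩, ⟨h3, h4⟩, hd, h01, hE'⟩, hE, h5⟩ := hp
      have e1 : flowDeg (m, π) = (univ.filter fun x => 0 < m x).card := by
        rw [← sum_indic, ← eq_indic_of_le_one h01]; rfl
      simp only [pairTerm, e1]
      rw [mul_comm]
      congr 1
      simp only [flowWeight, permOf_apply hi]
      rw [← prod_mul_distrib]
      refine prod_congr rfl fun x _ => ?_
      rw [pow_add]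
      by_cases a : 0 < m x
      · simp only [a, if_true]
        by_cases b : 0 < m' x
        · rw [h5 x a b]
        · have : m' x = 0 := by omega
          simp [this]
      · have : m x = 0 := by omega
        simp [this]
  rw [key, sum_sigma]
  refine sum_eq_zero fun g hg => ?_
  rw [mem_avoidingFlows] at hg
  simp only
  rw [← mul_sum, sum_sign_subflows_eq_zero hg.1 ?_, mul_zero]
  by_contra hne
  push Not at hne
  have : flowDeg g = 0 := sum_eq_zero fun x _ => by have := hne x; omega
  omega

-- This is the error made by taking the generating function of flows for the inverse of `det(1 -
-- zP)`; all later estimates aim at its smallness.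
open Classical in
lemma sum_antidiagonal_eq_sum_incompatible (P : Matrix α α ℝ) (E : Finset α) {k : ℕ}
    (hk : 0 < k) :
    ∑ ij ∈ antidiagonal k, ((-1) ^ ij.1 * minorSum P ij.1) * flowSum P E ij.2 =
      ∑ p ∈ flowPairs E k with ¬ IsCompatible E p, pairTerm P p := by
  rw [sum_antidiagonal_minorSum_mul_flowSum,
    ← sum_filter_add_sum_filter_not (flowPairs E k) (IsCompatible E),
    sum_compatible_pairTerm_eq_zero P E hk, zero_add]

end Flows

end

section

/-! ### Averages over the uniform permutation -/

section Mean

variable {α : Type*} [Fintype α] [DecidableEq α]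

/-- The mean over the uniform permutation. -/
noncomputable def permMean (F : Equiv.Perm α → ℝ) : ℝ :=
  (∑ σ, F σ) / (Fintype.card (Equiv.Perm α) : ℝ)

lemma card_perm_pos : (0 : ℝ) < (Fintype.card (Equiv.Perm α) : ℝ) := by
  exact_mod_cast Fintype.card_pos

lemma permMean_sum {ι : Type*} (s : Finset ι) (F : ι → Equiv.Perm α → ℝ) :
    permMean (fun σ => ∑ i ∈ s, F i σ) = ∑ i ∈ s, permMean (F i) := by
  simp only [permMean]
  rw [sum_comm, sum_div]

lemma permMean_mono {F G : Equiv.Perm α → ℝ} (h : ∀ σ, F σ ≤ G σ) : permMean F ≤ permMean G :=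
  div_le_div_of_nonneg_right (sum_le_sum fun σ _ => h σ) card_perm_pos.le

lemma permMean_nonneg {F : Equiv.Perm α → ℝ} (h : ∀ σ, 0 ≤ F σ) : 0 ≤ permMean F :=
  div_nonneg (sum_nonneg fun σ _ => h σ) card_perm_pos.le

lemma permMean_comp_mul_right (F : Equiv.Perm α → ℝ) (θ : Equiv.Perm α) :
    permMean (fun σ => F (σ * θ)) = permMean F := by
  simp only [permMean]
  congr 1
  exact Fintype.sum_equiv (Equiv.mulRight θ) _ _ fun σ => rfl

lemma exists_perm_comp_eq {ι : Type*} [Fintype ι] (x y : ι ↪ α) :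
    ∃ θ : Equiv.Perm α, ∀ i, θ (x i) = y i := by
  classical
  let e : {a // a ∈ Set.range x} ≃ {a // a ∈ Set.range y} :=
    (Equiv.ofInjective x x.injective).symm.trans (Equiv.ofInjective y y.injective)
  refine ⟨e.extendSubtype, fun i => ?_⟩
  rw [Equiv.extendSubtype_apply_of_mem e (x i) ⟨i, rfl⟩]
  simp only [e, Equiv.trans_apply]
  have : (Equiv.ofInjective x x.injective).symm ⟨x i, ⟨i, rfl⟩⟩ = i := by
    rw [Equiv.symm_apply_eq]
    rfl
  rw [this]
  rfl

/-- The image of an injective family under the uniform permutation is a uniform injective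
family. -/
lemma permMean_comp_embedding {ι : Type*} [Fintype ι] [DecidableEq ι] (x : ι ↪ α)
    (F : (ι → α) → ℝ) :
    permMean (fun σ => F fun i => σ (x i)) =
      (∑ y : ι ↪ α, F y) / ((Fintype.card α).descFactorial (Fintype.card ι) : ℝ) := by
  -- Right translation by a permutation carrying `x` to `y` preserves the uniform law, so the mean
  -- does not depend on the embedding and may be averaged over all of them.
  have hT : ∀ y : ι ↪ α, permMean (fun σ => F fun i => σ (y i)) =
      permMean (fun σ => F fun i => σ (x i)) := by
    intro y
    obtain ⟨θ, hθ⟩ := exists_perm_comp_eq x y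
    rw [← permMean_comp_mul_right (fun σ => F fun i => σ (x i)) θ]
    simp [hθ]
  have h1 : ∑ y : ι ↪ α, permMean (fun σ => F fun i => σ (y i)) = ∑ y : ι ↪ α, F y := by
    rw [← permMean_sum]
    have : ∀ σ : Equiv.Perm α, ∑ y : ι ↪ α, F (fun i => σ (y i)) = ∑ y : ι ↪ α, F y := by
      intro σ
      refine Fintype.sum_equiv (Equiv.embeddingCongr (Equiv.refl ι) σ) _ _ fun y => ?_
      congr 1
    simp only [this, permMean, sum_const, card_univ, nsmul_eq_mul]
    rw [mul_div_assoc, mul_comm, div_mul_cancel₀]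
    exact card_perm_pos.ne'
  simp_rw [hT] at h1
  rw [sum_const, card_univ, Fintype.card_embedding_eq, nsmul_eq_mul] at h1
  have hne : ((Fintype.card α).descFactorial (Fintype.card ι) : ℝ) ≠ 0 := by
    have : 0 < Fintype.card (ι ↪ α) := Fintype.card_pos_iff.2 ⟨x⟩
    rw [Fintype.card_embedding_eq] at this
    exact_mod_cast this.ne'
  rw [← h1]
  field_simp

end Mean

/-! ### Second moments of the sums of principal minors -/

section Minors

variable {α : Type*} [Fintype α] [DecidableEq α]

lemma principalMinor_submatrix_mul_swap (A : Matrix α α ℝ) {S : Finset α} {a b : α} (ha : a ∈ S)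
    (hb : b ∈ S) (hab : a ≠ b) (σ : Equiv.Perm α) :
    principalMinor (A.submatrix ⇑(σ * Equiv.swap a b) id) S =
      - principalMinor (A.submatrix ⇑σ id) S := by
  unfold principalMinor
  rw [← sum_neg_distrib]
  have hsw : ∀ x, x ∉ S → Equiv.swap a b x = x := fun x hx =>
    Equiv.swap_apply_of_ne_of_ne (fun h => hx (h ▸ ha)) (fun h => hx (h ▸ hb))
  refine sum_bij' (fun π _ => π * Equiv.swap a b) (fun π _ => π * Equiv.swap a b) ?_ ?_ ?_ ?_ ?_
  · intro π hπ
    simp only [mem_filter, mem_univ, true_and, Equiv.Perm.mul_apply] at hπ ⊢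
    intro x hx
    rw [hsw x hx, hπ x hx]
  · intro π hπ
    simp only [mem_filter, mem_univ, true_and, Equiv.Perm.mul_apply] at hπ ⊢
    intro x hx
    rw [hsw x hx, hπ x hx]
  · intro π _
    simp [mul_assoc]
  · intro π _
    simp [mul_assoc]
  · intro π _
    have : ∏ x ∈ S, (A.submatrix ⇑(σ * Equiv.swap a b) id) x (π x) =
        ∏ x ∈ S, (A.submatrix ⇑σ id) x ((π * Equiv.swap a b) x) := by
      refine prod_bij' (fun x _ => Equiv.swap a b x) (fun x _ => Equiv.swap a b x) ?_ ?_ ?_ ?_ ?_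
      · intro x hx
        exact (maps_mem_of_fixes_compl hsw x).2 hx
      · intro x hx
        exact (maps_mem_of_fixes_compl hsw x).2 hx
      · intro x _; simp
      · intro x _; simp
      · intro x _; simp [Matrix.submatrix_apply]
    rw [this, Equiv.Perm.sign_mul, Equiv.Perm.sign_swap hab]
    push_cast
    ring

lemma principalMinor_congr {P P' : Matrix α α ℝ} {S : Finset α} (h : ∀ x ∈ S, P x = P' x) :
    principalMinor P S = principalMinor P' S := by
  unfold principalMinor
  refine sum_congr rfl fun π _ => ?_
  rw [prod_congr rfl fun x hx => by rw [h x hx]]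

/-- The transposition of `a` and `b` exchanges two rows of the first minor and touches none of the
second: the product changes sign while the uniform law is unchanged. -/
lemma permMean_principalMinor_mul_eq_zero (A : Matrix α α ℝ) {S T : Finset α} {a b : α}
    (ha : a ∈ S) (hb : b ∈ S) (hab : a ≠ b) (ha' : a ∉ T) (hb' : b ∉ T) :
    permMean (fun σ : Equiv.Perm α => principalMinor (A.submatrix ⇑σ id) S *
      principalMinor (A.submatrix ⇑σ id) T) = 0 := by
  have h := permMean_comp_mul_right (fun σ : Equiv.Perm α =>
    principalMinor (A.submatrix ⇑σ id) S * principalMinor (A.submatrix ⇑σ id) T) (Equiv.swap a b)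
  have h2 : ∀ σ : Equiv.Perm α, principalMinor (A.submatrix ⇑(σ * Equiv.swap a b) id) T =
      principalMinor (A.submatrix ⇑σ id) T := by
    intro σ
    refine principalMinor_congr fun x hx => ?_
    funext y
    simp only [Matrix.submatrix_apply, Equiv.Perm.mul_apply]
    rw [Equiv.swap_apply_of_ne_of_ne (by rintro rfl; exact ha' hx) (by rintro rfl; exact hb' hx)]
  simp only [principalMinor_submatrix_mul_swap A ha hb hab, h2] at h
  simp only [permMean, neg_mul, sum_neg_distrib] at h ⊢
  rw [neg_div] at h
  linarith

lemma card_perm_fixes_compl (S : Finset α) :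
    #{π : Equiv.Perm α | ∀ x, x ∉ S → π x = x} = S.card.factorial := by
  have e : {π : Equiv.Perm α // ∀ x, x ∉ S → π x = x} ≃ Equiv.Perm {x // x ∈ S} :=
    (Equiv.Perm.subtypeEquivSubtypePerm fun x => x ∈ S).symm
  rw [← Fintype.card_subtype, Fintype.card_congr e, Fintype.card_perm, Fintype.card_coe]

/-- Cauchy–Binet over all maps from `S` to the rows instead of subsets of rows, whence the
factorial: in the expanded square each `π` contributes the same Gram minor, indexed by the relative
permutation `π' * π⁻¹`. -/
lemma sum_sq_minor_eq (A : Matrix α α ℝ) (S : Finset α) :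
    ∑ y : {x // x ∈ S} → α, (∑ π : Equiv.Perm α with ∀ x, x ∉ S → π x = x,
      ((Equiv.Perm.sign π : ℤ) : ℝ) * ∏ x : {x // x ∈ S}, A (y x) (π x)) ^ 2 =
      S.card.factorial * principalMinor (A.transpose * A) S := by
  set F := (univ : Finset (Equiv.Perm α)).filter fun π => ∀ x, x ∉ S → π x = x with hF
  have hmem : ∀ π, π ∈ F ↔ ∀ x, x ∉ S → π x = x := by simp [hF]
  simp_rw [sq, sum_mul_sum]
  rw [sum_comm]
  simp_rw [sum_comm (s := univ) (t := F)]
  rw [← card_perm_fixes_compl S, ← nsmul_eq_mul, ← sum_const]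
  refine sum_congr rfl fun π hπ => ?_
  rw [hmem] at hπ
  unfold principalMinor
  refine sum_bij' (fun π' _ => π' * π⁻¹) (fun π' _ => π' * π) ?_ ?_ ?_ ?_ ?_
  · intro π' hπ'
    rw [hmem] at hπ'
    simp only [mem_filter, mem_univ, true_and, Equiv.Perm.mul_apply]
    intro x hx
    have : π⁻¹ x = x := by rw [Equiv.Perm.inv_eq_iff_eq, hπ x hx]
    rw [this, hπ' x hx]
  · intro π' hπ'
    simp only [mem_filter, mem_univ, true_and] at hπ'
    rw [hmem]
    intro x hx
    rw [Equiv.Perm.mul_apply, hπ x hx, hπ' x hx]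
  · intro π' _; simp [mul_assoc]
  · intro π' _; simp [mul_assoc]
  · intro π' hπ'
    have h1 : ∀ y : {x // x ∈ S} → α,
        ((Equiv.Perm.sign π : ℤ) : ℝ) * (∏ x : {x // x ∈ S}, A (y x) (π x)) *
          (((Equiv.Perm.sign π' : ℤ) : ℝ) * ∏ x : {x // x ∈ S}, A (y x) (π' x)) =
        ((Equiv.Perm.sign (π' * π⁻¹) : ℤ) : ℝ) *
          ∏ x : {x // x ∈ S}, (A (y x) (π x) * A (y x) (π' x)) := by
      intro y
      rw [prod_mul_distrib, Equiv.Perm.sign_mul, Equiv.Perm.sign_inv]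
      push_cast
      ring
    simp_rw [h1]
    rw [← mul_sum]
    congr 1
    rw [← Fintype.prod_sum (fun (x : {x // x ∈ S}) (v : α) => A v (π x) * A v (π' x)),
      ← prod_coe_sort S]
    let e : Equiv.Perm {x // x ∈ S} := π.subtypePerm fun x => maps_mem_of_fixes_compl hπ x
    refine Fintype.prod_equiv e _ _ fun x => ?_
    simp [e, Matrix.mul_apply]

/-- The rows selected by `S` form a uniform injective family, and dropping injectivity only adds
squares. -/
lemma permMean_principalMinor_sq_le (A : Matrix α α ℝ) (S : Finset α) :
    permMean (fun σ : Equiv.Perm α => principalMinor (A.submatrix ⇑σ id) S ^ 2) ≤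
      principalMinor (A.transpose * A) S / ((Fintype.card α).choose S.card : ℝ) := by
  set F : ({x // x ∈ S} → α) → ℝ := fun y => (∑ π : Equiv.Perm α with ∀ x, x ∉ S → π x = x,
      ((Equiv.Perm.sign π : ℤ) : ℝ) * ∏ x : {x // x ∈ S}, A (y x) (π x)) ^ 2 with hF
  have h1 : ∀ σ : Equiv.Perm α, principalMinor (A.submatrix ⇑σ id) S ^ 2 =
      F fun i => σ ((Function.Embedding.subtype fun x => x ∈ S) i) := by
    intro σ
    simp only [hF, principalMinor]
    congr 1
    refine sum_congr rfl fun π _ => ?_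
    rw [← prod_coe_sort S]
    rfl
  simp_rw [h1]
  rw [permMean_comp_embedding (Function.Embedding.subtype fun x => x ∈ S) F, Fintype.card_coe,
    Nat.descFactorial_eq_factorial_mul_choose]
  have h2 : ∑ y : {x // x ∈ S} ↪ α, F y ≤ ∑ y : {x // x ∈ S} → α, F y := by
    have := sum_image (s := (univ : Finset ({x // x ∈ S} ↪ α)))
      (f := F) (g := fun y : {x // x ∈ S} ↪ α => (y : {x // x ∈ S} → α))
      (fun a _ b _ h => DFunLike.coe_injective h)
    rw [← this]
    exact sum_le_sum_of_subset_of_nonneg (subset_univ _) fun y _ _ => sq_nonneg _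
  rw [sum_sq_minor_eq] at h2
  have hf : (0 : ℝ) < S.card.factorial := by exact_mod_cast Nat.factorial_pos _
  push_cast
  calc _ ≤ (S.card.factorial * principalMinor (A.transpose * A) S) /
        (S.card.factorial * ((Fintype.card α).choose S.card : ℝ)) := by
        gcongr
    _ = _ := by rw [mul_div_mul_left _ _ hf.ne']

lemma principalMinor_gram_nonneg (A : Matrix α α ℝ) (S : Finset α) :
    0 ≤ principalMinor (A.transpose * A) S := by
  have h := sum_sq_minor_eq A S
  have hf : (0 : ℝ) < S.card.factorial := by exact_mod_cast Nat.factorial_pos _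
  have h0 : 0 ≤ S.card.factorial * principalMinor (A.transpose * A) S := by
    rw [← h]
    exact sum_nonneg fun y _ => sq_nonneg _
  exact nonneg_of_mul_nonneg_right h0 hf

/-- After the cancellation only index sets `T` obtained from `S` by at most one exchange matter.
There are at most `n² + 1` of them, so bounding the covariances by the variances costs a polynomial
factor only. -/
lemma permMean_minorSum_sq_le_gram (A : Matrix α α ℝ) (k : ℕ) :
    permMean (fun σ : Equiv.Perm α => minorSum (A.submatrix ⇑σ id) k ^ 2) ≤
      ((Fintype.card α : ℝ) ^ 2 + 1) *
        (minorSum (A.transpose * A) k / ((Fintype.card α).choose k : ℝ)) := by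
  classical
  set C := powersetCard k (univ : Finset α) with hC
  set f : Finset α → Equiv.Perm α → ℝ := fun S σ => principalMinor (A.submatrix ⇑σ id) S with hf
  have h0 : ∀ S T, permMean (fun σ => f S σ * f T σ) ≤
      (permMean (fun σ => f S σ ^ 2) + permMean (fun σ => f T σ ^ 2)) / 2 := by
    intro S T
    have := permMean_mono (F := fun σ => ∑ i ∈ ({0} : Finset ℕ), f S σ * f T σ)
      (G := fun σ => ∑ i ∈ range 2, (if i = 0 then f S σ ^ 2 else f T σ ^ 2) / 2)
      (fun σ => by
        simp [sum_range_succ]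
        nlinarith [sq_nonneg (f S σ - f T σ)])
    rw [permMean_sum, permMean_sum] at this
    simp only [sum_singleton, sum_range_succ, range_zero, sum_empty, zero_add, if_true,
      one_ne_zero, if_false] at this
    have e : ∀ G : Equiv.Perm α → ℝ, permMean (fun σ => G σ / 2) = permMean G / 2 := by
      intro G
      simp only [permMean, ← sum_div]
      ring
    rw [e, e] at this
    linarith
  set N : Finset α → Finset (Finset α) := fun S => C.filter fun T => ¬ ∃ a b, a ∈ S ∧ b ∈ S ∧
    a ≠ b ∧ a ∉ T ∧ b ∉ T with hN
  have hsymm : ∀ S ∈ C, ∀ T ∈ C, T ∈ N S → S ∈ N T := by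
    intro S hS T hT hTS
    simp only [hN, mem_filter, hS, true_and] at hTS ⊢
    rintro ⟨a, b, ha, hb, hab, ha', hb'⟩
    apply hTS.2
    have h1 : 1 < (T \ S).card := by
      rw [one_lt_card]
      exact ⟨a, by simp [ha, ha'], b, by simp [hb, hb'], hab⟩
    have h2 : (T \ S).card = (S \ T).card :=
      card_sdiff_comm ((mem_powersetCard.1 hT).2.trans (mem_powersetCard.1 hS).2.symm)
    rw [h2, one_lt_card] at h1
    obtain ⟨c, hc, d, hd, hcd⟩ := h1
    rw [mem_sdiff] at hc hd
    exact ⟨c, d, hc.1, hd.1, hcd, hc.2, hd.2⟩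
  have hcard : ∀ S ∈ C, ((N S).card : ℝ) ≤ (Fintype.card α : ℝ) ^ 2 + 1 := by
    intro S hS
    have hsub : N S ⊆ insert S (image (fun p : α × α => insert p.2 (S.erase p.1)) univ) := by
      intro T hT
      simp only [hN, mem_filter] at hT
      rw [mem_insert]
      by_cases hTS : T = S
      · exact Or.inl hTS
      right
      have hct : T.card = S.card := (mem_powersetCard.1 hT.1).2.trans (mem_powersetCard.1 hS).2.symm
      have hne : (S \ T).Nonempty := by
        rw [sdiff_nonempty]
        intro h
        exact hTS (eq_of_subset_of_card_le h hct.le).symm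
      obtain ⟨a, ha⟩ := hne
      have h1 : (S \ T) = {a} := by
        rw [eq_singleton_iff_unique_mem]
        refine ⟨ha, fun b hb => ?_⟩
        by_contra hba
        rw [mem_sdiff] at ha hb
        exact hT.2 ⟨a, b, ha.1, hb.1, fun h => hba h.symm, ha.2, hb.2⟩
      have h2 : (T \ S).card = 1 := by
        rw [card_sdiff_comm hct, h1, card_singleton]
      obtain ⟨b, hb⟩ := card_eq_one.1 h2
      rw [mem_image]
      refine ⟨(a, b), mem_univ _, ?_⟩
      ext c
      have e1 : c ∈ S \ T ↔ c = a := by rw [h1, mem_singleton]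
      have e2 : c ∈ T \ S ↔ c = b := by rw [hb, mem_singleton]
      rw [mem_sdiff] at e1 e2
      simp only [mem_insert, mem_erase]
      tauto
    calc ((N S).card : ℝ) ≤ ((insert S (image (fun p : α × α => insert p.2 (S.erase p.1)) univ)).card : ℝ) := by
          exact_mod_cast card_le_card hsub
      _ ≤ ((Fintype.card α) ^ 2 + 1 : ℕ) := by
          norm_cast
          refine (card_insert_le _ _).trans (Nat.add_le_add_right (card_image_le.trans ?_) 1)
          rw [card_univ, Fintype.card_prod, sq]
      _ = _ := by push_cast; ring
  have h1 : permMean (fun σ : Equiv.Perm α => minorSum (A.submatrix ⇑σ id) k ^ 2) =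
      ∑ S ∈ C, ∑ T ∈ C, permMean (fun σ => f S σ * f T σ) := by
    simp only [minorSum, sq, sum_mul_sum]
    rw [permMean_sum]
    refine sum_congr rfl fun S _ => ?_
    rw [permMean_sum]
  have h2 : ∀ S ∈ C, ∑ T ∈ C, permMean (fun σ => f S σ * f T σ) ≤
      ∑ T ∈ N S, (permMean (fun σ => f S σ ^ 2) + permMean (fun σ => f T σ ^ 2)) / 2 := by
    intro S _
    rw [← sum_filter_add_sum_filter_not C (fun T => ¬ ∃ a b, a ∈ S ∧ b ∈ S ∧
      a ≠ b ∧ a ∉ T ∧ b ∉ T)]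
    have : ∑ T ∈ C.filter (fun T => ¬ ¬ ∃ a b, a ∈ S ∧ b ∈ S ∧ a ≠ b ∧ a ∉ T ∧ b ∉ T),
        permMean (fun σ => f S σ * f T σ) = 0 := by
      refine sum_eq_zero fun T hT => ?_
      simp only [mem_filter, not_not] at hT
      obtain ⟨-, a, b, ha, hb, hab, ha', hb'⟩ := hT
      exact permMean_principalMinor_mul_eq_zero A ha hb hab ha' hb'
    rw [this, add_zero]
    exact sum_le_sum fun T _ => h0 S T
  have h3 : ∑ S ∈ C, ∑ T ∈ N S, permMean (fun σ => f T σ ^ 2) =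
      ∑ S ∈ C, ∑ T ∈ N S, permMean (fun σ => f S σ ^ 2) := by
    have hN' : ∀ S, N S ⊆ C := fun S => filter_subset _ _
    refine sum_comm' fun S T => ⟨fun h => ?_, fun h => ?_⟩
    · exact ⟨hsymm S h.1 T (hN' S h.2) h.2, hN' S h.2⟩
    · exact ⟨hN' T h.1, hsymm T h.2 S (hN' T h.1) h.1⟩
  have h4 : ∀ S ∈ C, ∑ T ∈ N S, permMean (fun σ => f S σ ^ 2) ≤
      ((Fintype.card α : ℝ) ^ 2 + 1) *
        (principalMinor (A.transpose * A) S / ((Fintype.card α).choose k : ℝ)) := by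
    intro S hS
    rw [sum_const, nsmul_eq_mul]
    have := permMean_principalMinor_sq_le A S
    rw [(mem_powersetCard.1 hS).2] at this
    exact mul_le_mul (hcard S hS) this (permMean_nonneg fun σ => sq_nonneg _) (by positivity)
  rw [h1]
  calc _ ≤ ∑ S ∈ C, ∑ T ∈ N S,
        (permMean (fun σ => f S σ ^ 2) + permMean (fun σ => f T σ ^ 2)) / 2 := sum_le_sum h2
    _ = (∑ S ∈ C, ∑ T ∈ N S, permMean (fun σ => f S σ ^ 2) +
          ∑ S ∈ C, ∑ T ∈ N S, permMean (fun σ => f T σ ^ 2)) / 2 := by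
        rw [← sum_add_distrib, sum_div]
        refine sum_congr rfl fun S _ => ?_
        rw [← sum_add_distrib, sum_div]
    _ = ∑ S ∈ C, ∑ T ∈ N S, permMean (fun σ => f S σ ^ 2) := by rw [h3]; ring
    _ ≤ ∑ S ∈ C, ((Fintype.card α : ℝ) ^ 2 + 1) *
        (principalMinor (A.transpose * A) S / ((Fintype.card α).choose k : ℝ)) := sum_le_sum h4
    _ = _ := by rw [← mul_sum, ← sum_div, minorSum]

/-- The inequality between the arithmetic and geometric means of the eigenvalues. -/
lemma det_le_trace_div_pow {B : Matrix α α ℝ} (hB : B.PosSemidef) [Nonempty α] :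
    B.det ≤ (B.trace / Fintype.card α) ^ Fintype.card α := by
  have hn : (0 : ℝ) < Fintype.card α := by exact_mod_cast Fintype.card_pos
  have hH := hB.isHermitian
  have h1 : B.det = ∏ i, hH.eigenvalues i := by
    have := hH.det_eq_prod_eigenvalues
    simpa using this
  have h2 : B.trace = ∑ i, hH.eigenvalues i := by
    have := hH.trace_eq_sum_eigenvalues
    simpa using this
  have h0 : ∀ i, 0 ≤ hH.eigenvalues i := hB.eigenvalues_nonneg
  rw [h1, h2]
  have key := Real.geom_mean_le_arith_mean_weighted univ (fun _ : α => 1 / (Fintype.card α : ℝ))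
    hH.eigenvalues (fun _ _ => by positivity) (by simp [hn.ne']) (fun i _ => h0 i)
  rw [Real.finsetProd_rpow _ _ (fun i _ => h0 i), ← mul_sum] at key
  have hp : 0 ≤ ∏ i, hH.eigenvalues i := prod_nonneg fun i _ => h0 i
  calc ∏ i, hH.eigenvalues i
      = ((∏ i, hH.eigenvalues i) ^ (1 / (Fintype.card α : ℝ))) ^ Fintype.card α := by
        rw [← Real.rpow_natCast, ← Real.rpow_mul hp, one_div, inv_mul_cancel₀ hn.ne', Real.rpow_one]
    _ ≤ _ := by
        refine pow_le_pow_left₀ (by positivity) (key.trans (le_of_eq ?_)) _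
        ring

/-- Among the `n + 1` terms of the binomial expansion of `(k + (n - k))^n` the one of index `k` is
the largest, as the ratios of consecutive terms show. -/
lemma pow_self_le_choose_mul {n k : ℕ} (hk : k ≤ n) :
    (n : ℝ) ^ n ≤ (n + 1) * (n.choose k * (k : ℝ) ^ k * ((n - k : ℕ) : ℝ) ^ (n - k)) := by
  set g : ℕ → ℝ := fun j => (k : ℝ) ^ j * ((n - k : ℕ) : ℝ) ^ (n - j) * n.choose j with hg
  have hstep : ∀ j, j < n → (g j * (n - j) * k = g (j + 1) * ((j + 1) * ((n - k : ℕ) : ℝ))) := by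
    intro j hj
    have hc : (n.choose j : ℝ) * (n - j) = n.choose (j + 1) * (j + 1) := by
      have := Nat.choose_succ_right_eq n j
      have h2 : ((n.choose (j + 1) * (j + 1) : ℕ) : ℝ) = ((n.choose j * (n - j) : ℕ) : ℝ) := by
        rw [this]
      push_cast [Nat.cast_sub hj.le] at h2
      linarith
    have he : n - j = (n - (j + 1)) + 1 := by omega
    simp only [hg]
    rw [he, pow_succ, pow_succ]
    linear_combination (k : ℝ) ^ j * (((n - k : ℕ) : ℝ) ^ (n - (j + 1)) * ((n - k : ℕ) : ℝ)) * k * hc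
  have hnn : ∀ j, 0 ≤ g j := fun j => by simp only [hg]; positivity
  have hkn : ((n - k : ℕ) : ℝ) = n - k := by rw [Nat.cast_sub hk]
  have hmax : ∀ j, j ≤ n → g j ≤ g k := by
    have hup : ∀ i, i ≤ k → g (k - i) ≤ g k := by
      intro i
      induction i with
      | zero => intro _; simp
      | succ i ih =>
        intro hi
        refine le_trans ?_ (ih (by omega))
        have hj := hstep (k - (i + 1)) (by omega)
        have e : k - (i + 1) + 1 = k - i := by omega
        rw [e] at hj
        have e2 : ((k - (i + 1) : ℕ) : ℝ) = k - (i + 1) := by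
          rw [Nat.cast_sub hi]; push_cast; ring
        rw [e2, hkn] at hj
        have h3 : (k : ℝ) ≤ n := by exact_mod_cast hk
        have hk1 : (1 : ℝ) ≤ k := by exact_mod_cast (by omega : 1 ≤ k)
        have hi0 : (0 : ℝ) ≤ i := Nat.cast_nonneg i
        have hik : (i : ℝ) + 1 ≤ k := by exact_mod_cast hi
        have hpos : 0 < (n - (k - (i + 1)) : ℝ) * k := by
          apply mul_pos <;> linarith
        have h5 : (k - (i + 1) + 1 : ℝ) * (n - k) ≤ (n - (k - (i + 1)) : ℝ) * k := by
          nlinarith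
        have h6 := mul_le_mul_of_nonneg_left h5 (hnn (k - i))
        rw [← hj] at h6
        have h7 : g (k - (i + 1)) * ((n - (k - (i + 1)) : ℝ) * k) ≤
            g (k - i) * ((n - (k - (i + 1)) : ℝ) * k) := by linarith
        exact le_of_mul_le_mul_right h7 hpos
    have hdown : ∀ i, k + i ≤ n → g (k + i) ≤ g k := by
      intro i
      induction i with
      | zero => intro _; simp
      | succ i ih =>
        intro hi
        refine le_trans ?_ (ih (by omega))
        have hj := hstep (k + i) (by omega)
        push_cast at hj
        rw [hkn] at hj
        have hi0 : (0 : ℝ) ≤ i := Nat.cast_nonneg i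
        have hk0 : (0 : ℝ) ≤ k := Nat.cast_nonneg k
        have h3 : (k : ℝ) + i + 1 ≤ n := by exact_mod_cast hi
        have hpos : 0 < (k + i + 1 : ℝ) * (n - k) := by
          apply mul_pos <;> linarith
        have h5 : (n - (k + i) : ℝ) * k ≤ (k + i + 1 : ℝ) * (n - k) := by
          nlinarith
        have h6 := mul_le_mul_of_nonneg_left h5 (hnn (k + i))
        have h7 : g (k + (i + 1)) * ((k + i + 1 : ℝ) * (n - k)) ≤
            g (k + i) * ((k + i + 1 : ℝ) * (n - k)) := by
          have e : k + (i + 1) = k + i + 1 := by ring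
          rw [e]
          linarith
        exact le_of_mul_le_mul_right h7 hpos
    intro j hj
    rcases le_total j k with h | h
    · have := hup (k - j) (by omega)
      rwa [Nat.sub_sub_self h] at this
    · have := hdown (j - k) (by omega)
      rwa [Nat.add_sub_cancel' h] at this
  have hsum : (n : ℝ) ^ n = ∑ j ∈ range (n + 1), g j := by
    have := add_pow (k : ℝ) ((n - k : ℕ) : ℝ) n
    rw [← this, hkn]
    ring
  rw [hsum]
  calc ∑ j ∈ range (n + 1), g j ≤ ∑ j ∈ range (n + 1), g k :=
        sum_le_sum fun j hj => hmax j (by rw [mem_range] at hj; omega)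
    _ = _ := by
        rw [sum_const, card_range, nsmul_eq_mul]
        simp only [hg]
        push_cast
        ring

/-- Gram minors are nonnegative, so a single coefficient of `det(1 + t AᵀA)` is at most the
determinant, itself at most `(1 + tm)^n`; then `t` is optimised. -/
lemma minorSum_gram_le (A : Matrix α α ℝ) {m : ℝ} (hm : 0 < m) [Nonempty α]
    (h : ∑ x, ∑ y, A x y ^ 2 ≤ Fintype.card α * m) {k : ℕ} (hk : k ≤ Fintype.card α) :
    minorSum (A.transpose * A) k ≤
      3 * (Fintype.card α + 1) * (Fintype.card α).choose k * m ^ k := by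
  set n := Fintype.card α with hn
  have hn0 : 0 < n := Fintype.card_pos
  have hn0' : (0 : ℝ) < n := by exact_mod_cast hn0
  have hpsd : (A.transpose * A).PosSemidef := by
    have := Matrix.posSemidef_conjTranspose_mul_self A
    rwa [Matrix.conjTranspose_eq_transpose_of_trivial] at this
  have htr : (A.transpose * A).trace ≤ n * m := by
    refine le_trans (le_of_eq ?_) h
    simp only [Matrix.trace, Matrix.diag, Matrix.mul_apply, Matrix.transpose_apply, sq]
    rw [sum_comm]
  have hgen : ∀ t : ℝ, 0 ≤ t → t ^ k * minorSum (A.transpose * A) k ≤ (1 + t * m) ^ n := by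
    intro t ht
    have h1 : t ^ k * minorSum (A.transpose * A) k ≤ (1 + t • (A.transpose * A)).det := by
      rw [det_one_add_smul_eq_sum_minorSum]
      refine single_le_sum (f := fun k => t ^ k * minorSum (A.transpose * A) k) (fun j _ => ?_)
        (mem_range.2 (by omega))
      exact mul_nonneg (by positivity) (sum_nonneg fun S _ => principalMinor_gram_nonneg A S)
    have hps : (1 + t • (A.transpose * A)).PosSemidef :=
      Matrix.PosSemidef.one.add (hpsd.smul ht)
    refine h1.trans ((det_le_trace_div_pow hps).trans ?_)
    refine pow_le_pow_left₀ (div_nonneg hps.trace_nonneg (Nat.cast_nonneg _)) ?_ _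
    rw [Matrix.trace_add, Matrix.trace_one, Matrix.trace_smul, smul_eq_mul, ← hn,
      div_le_iff₀ hn0']
    nlinarith
  rcases hk.lt_or_eq with hk' | rfl
  · rcases Nat.eq_zero_or_pos k with rfl | hk0
    · have := hgen 0 le_rfl
      simp at this
      simp
      linarith
    · have hkr : (0 : ℝ) < k := by exact_mod_cast hk0
      have hnk : (0 : ℝ) < ((n - k : ℕ) : ℝ) := by exact_mod_cast Nat.sub_pos_of_lt hk'
      -- This `t` minimises `(1 + tm)^n / t^k`.
      have h1 := hgen (k / (((n - k : ℕ) : ℝ) * m)) (by positivity)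
      have e1 : 1 + k / (((n - k : ℕ) : ℝ) * m) * m = n / ((n - k : ℕ) : ℝ) := by
        field_simp
        rw [Nat.cast_sub hk]; ring
      rw [e1, div_pow, div_pow, mul_pow] at h1
      have h2 := pow_self_le_choose_mul hk
      have e2 : ((n - k : ℕ) : ℝ) ^ n = ((n - k : ℕ) : ℝ) ^ k * ((n - k : ℕ) : ℝ) ^ (n - k) := by
        rw [← pow_add]; congr 1; omega
      have h3 : (n : ℝ) ^ n / ((n - k : ℕ) : ℝ) ^ n ≤
          (n + 1) * (n.choose k * (k : ℝ) ^ k) / ((n - k : ℕ) : ℝ) ^ k := by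
        rw [e2, div_le_div_iff₀ (by positivity) (by positivity)]
        nlinarith [mul_le_mul_of_nonneg_right h2 (by positivity : (0:ℝ) ≤ ((n - k : ℕ) : ℝ) ^ k)]
      have h4 := h1.trans h3
      have h5 : minorSum (A.transpose * A) k ≤ (n + 1) * n.choose k * m ^ k := by
        have hc : (0 : ℝ) < (k : ℝ) ^ k / (((n - k : ℕ) : ℝ) ^ k * m ^ k) := by positivity
        refine le_of_mul_le_mul_left (h4.trans (le_of_eq ?_)) hc
        field_simp
      have : 0 ≤ (n + 1 : ℝ) * n.choose k * m ^ k := by positivity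
      linarith
  -- For `k = n` the optimal `t` is infinite; `n / m` loses only `(1 + 1/n)^n ≤ 3`.
  · have h1 := hgen (n / m) (by positivity)
    have e1 : 1 + n / m * m = n * (1 + 1 / (n : ℝ)) := by field_simp; ring
    rw [e1, mul_pow, div_pow] at h1
    have h2 : (1 + 1 / (n : ℝ)) ^ n ≤ 3 := by
      have h3 : (1 + 1 / (n : ℝ)) ≤ Real.exp (1 / n) := by
        have := Real.add_one_le_exp (1 / (n : ℝ)); linarith
      calc (1 + 1 / (n : ℝ)) ^ n ≤ (Real.exp (1 / n)) ^ n := pow_le_pow_left₀ (by positivity) h3 _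
        _ = Real.exp 1 := by rw [← Real.exp_nat_mul]; congr 1; field_simp
        _ ≤ 3 := by have := Real.exp_one_lt_d9; linarith
    have h3 : minorSum (A.transpose * A) n ≤ 3 * m ^ n := by
      have hc : (0 : ℝ) < (n : ℝ) ^ n / m ^ n := by positivity
      refine le_of_mul_le_mul_left (h1.trans ?_) hc
      have : (n : ℝ) ^ n / m ^ n * (3 * m ^ n) = (n : ℝ) ^ n * 3 := by field_simp
      rw [this]
      gcongr
    rw [Nat.choose_self]
    have : 0 ≤ 3 * (n : ℝ) * m ^ n := by positivity
    push_cast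
    nlinarith

/-- The second moment of the sums of minors of a matrix with uniformly permuted rows. -/
lemma permMean_minorSum_sq_le (A : Matrix α α ℝ) {m : ℝ} (hm : 0 < m) [Nonempty α]
    (h : ∑ x, ∑ y, A x y ^ 2 ≤ Fintype.card α * m) {k : ℕ} (hk : k ≤ Fintype.card α) :
    permMean (fun σ : Equiv.Perm α => minorSum (A.submatrix ⇑σ id) k ^ 2) ≤
      ((Fintype.card α : ℝ) ^ 2 + 1) * (3 * (Fintype.card α + 1)) * m ^ k := by
  refine (permMean_minorSum_sq_le_gram A k).trans ?_
  rw [mul_assoc]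
  refine mul_le_mul_of_nonneg_left ?_ (by positivity)
  have hc : (0 : ℝ) < (Fintype.card α).choose k := by exact_mod_cast Nat.choose_pos hk
  rw [div_le_iff₀ hc]
  refine (minorSum_gram_le A hm h hk).trans (le_of_eq (by ring))

end Minors

end

/-! ### Summation by elimination, and injective sums as signed sums over permutations -/

section

variable {α β V : Type*} [Fintype α] [DecidableEq α] [Fintype V] [DecidableEq V]

lemma card_mul_sum_eq_sum_update (F : (V → α) → ℝ) (v : V) :
    (Fintype.card α : ℝ) * ∑ z, F z = ∑ z : V → α, ∑ a, F (Function.update z v a) := by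
  have h : ∑ p : (V → α) × α, F p.1 = ∑ p : (V → α) × α, F (Function.update p.1 v p.2) := by
    have hinv : Function.Involutive
        fun p : (V → α) × α => (Function.update p.1 v p.2, p.1 v) := fun p => by simp
    exact (Equiv.sum_comp hinv.toPerm fun p : (V → α) × α => F p.1).symm
  rw [← Fintype.sum_prod_type' (f := fun z a => F (Function.update z v a)), ← h,
    Fintype.sum_prod_type, mul_sum]
  simp

/-- Summation over the variables of a product in which each factor depends on its own variable and
on variables of smaller height. -/
lemma sum_prod_le_of_height [Nonempty α] (h : V → ℕ) (w : V → (V → α) → ℝ) (c : V → ℝ)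
    (hw : ∀ v z, 0 ≤ w v z)
    (hdep : ∀ u v z a, v ≠ u → h u ≤ h v → w u (Function.update z v a) = w u z)
    (hsum : ∀ v z, ∑ a, w v (Function.update z v a) ≤ c v) :
    ∑ z : V → α, ∏ v, w v z ≤ ∏ v, c v := by
  have hn : (0 : ℝ) < Fintype.card α := by exact_mod_cast Fintype.card_pos
  have hc : ∀ v, 0 ≤ c v := fun v =>
    (sum_nonneg fun a _ => hw v _).trans (hsum v fun _ => Classical.arbitrary α)
  -- Variables are eliminated by decreasing height. The sum always runs over all of `V → α`, so a
  -- variable not used in `T` counts `n` times; the powers of `n` keep this balance.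
  have key : ∀ T : Finset V, (Fintype.card α : ℝ) ^ T.card * ∑ z : V → α, ∏ v ∈ T, w v z ≤
      (Fintype.card α : ℝ) ^ Fintype.card V * ∏ v ∈ T, c v := by
    intro T
    induction T using Finset.induction_on_max_value h with
    | empty => simp
    | insert v T hv hmax ih =>
      have e : ∀ z : V → α, ∑ a, ∏ u ∈ insert v T, w u (Function.update z v a) ≤
          c v * ∏ u ∈ T, w u z := by
        intro z
        have : ∀ a, ∏ u ∈ insert v T, w u (Function.update z v a) =
            w v (Function.update z v a) * ∏ u ∈ T, w u z := by
          intro a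
          rw [prod_insert hv]
          congr 1
          refine prod_congr rfl fun u hu => hdep u v z a ?_ (hmax u hu)
          rintro rfl; exact hv hu
        simp only [this, ← sum_mul]
        exact mul_le_mul_of_nonneg_right (hsum v z) (prod_nonneg fun u _ => hw u z)
      rw [card_insert_of_notMem hv, pow_succ, mul_assoc, card_mul_sum_eq_sum_update _ v,
        prod_insert hv]
      calc (Fintype.card α : ℝ) ^ T.card *
            ∑ z : V → α, ∑ a, ∏ u ∈ insert v T, w u (Function.update z v a)
          ≤ (Fintype.card α : ℝ) ^ T.card * ∑ z : V → α, c v * ∏ u ∈ T, w u z := by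
            gcongr with z; exact e z
        _ = c v * ((Fintype.card α : ℝ) ^ T.card * ∑ z : V → α, ∏ u ∈ T, w u z) := by
            rw [← mul_sum]; ring
        _ ≤ c v * ((Fintype.card α : ℝ) ^ Fintype.card V * ∏ v ∈ T, c v) := by
            gcongr; exact hc v
        _ = _ := by ring
  have := key univ
  rw [card_univ] at this
  exact le_of_mul_le_mul_left this (by positivity)

/-- If `y` takes the same value at `a` and `b`, multiplication by their transposition maps the
stabilizer to itself and reverses signs. -/
lemma sum_sign_stabilizer_eq (y : V → α) :
    ∑ τ ∈ univ.filter (fun τ : Equiv.Perm V => y ∘ ⇑τ = y), ((Equiv.Perm.sign τ : ℤ) : ℝ) =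
      if Function.Injective y then 1 else 0 := by
  split_ifs with h
  · have : (univ.filter fun τ : Equiv.Perm V => y ∘ ⇑τ = y) = {1} := by
      ext τ
      simp only [mem_filter, mem_univ, true_and, mem_singleton]
      constructor
      · intro hτ
        ext v
        exact h (congrFun hτ v)
      · rintro rfl; rfl
    rw [this]; simp
  · simp only [Function.Injective, not_forall] at h
    obtain ⟨a, b, hab, hne⟩ := h
    have hsw : y ∘ (Equiv.swap a b) = y := by
      funext v
      simp only [Function.comp_apply]
      rcases eq_or_ne v a with rfl | h1
      · simp [hab]
      rcases eq_or_ne v b with rfl | h2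
      · simp [hab]
      rw [Equiv.swap_apply_of_ne_of_ne h1 h2]
    have : ∑ τ ∈ univ.filter (fun τ : Equiv.Perm V => y ∘ ⇑τ = y), ((Equiv.Perm.sign τ : ℤ) : ℝ) =
        -∑ τ ∈ univ.filter (fun τ : Equiv.Perm V => y ∘ ⇑τ = y), ((Equiv.Perm.sign τ : ℤ) : ℝ) := by
      rw [← sum_neg_distrib]
      refine sum_bij' (fun τ _ => Equiv.swap a b * τ) (fun τ _ => Equiv.swap a b * τ) ?_ ?_ ?_ ?_ ?_
      · intro τ hτ
        simp only [mem_filter, mem_univ, true_and] at hτ ⊢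
        rw [Equiv.Perm.coe_mul, ← Function.comp_assoc, hsw, hτ]
      · intro τ hτ
        simp only [mem_filter, mem_univ, true_and] at hτ ⊢
        rw [Equiv.Perm.coe_mul, ← Function.comp_assoc, hsw, hτ]
      · intro τ _; simp [← mul_assoc]
      · intro τ _; simp [← mul_assoc]
      · intro τ _; simp [Equiv.Perm.sign_swap hne]
    linarith

/-- Trades injectivity, which couples all the variables, for invariance under `τ`, which leaves the
variables at fixed points of `τ` free. -/
lemma sum_injective_prod_eq (g : V → α → ℝ) :
    ∑ y : V ↪ α, ∏ s, g s (y s) = ∑ τ : Equiv.Perm V, ((Equiv.Perm.sign τ : ℤ) : ℝ) *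
      ∑ y : V → α with (y ∘ ⇑τ = y), ∏ s, g s (y s) := by
  have h1 : ∑ y : V ↪ α, ∏ s, g s (y s) =
      ∑ y : V → α, if Function.Injective y then ∏ s, g s (y s) else 0 := by
    rw [← sum_filter]
    refine sum_bij' (fun y _ => ⇑y) (fun y hy => ⟨y, (mem_filter.1 hy).2⟩) ?_ ?_ ?_ ?_ ?_
    · intro y _; simpa using y.injective
    · intro y _; simp
    · intro y _; rfl
    · intro y _; rfl
    · intro y _; rfl
  rw [h1]
  have h2 : ∀ y : V → α, (if Function.Injective y then ∏ s, g s (y s) else 0) =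
      ∑ τ : Equiv.Perm V, if y ∘ ⇑τ = y then
        ((Equiv.Perm.sign τ : ℤ) : ℝ) * ∏ s, g s (y s) else 0 := by
    intro y
    rw [← sum_filter, ← sum_mul, sum_sign_stabilizer_eq]
    split_ifs <;> simp
  simp only [h2]
  rw [sum_comm]
  refine sum_congr rfl fun τ _ => ?_
  rw [← sum_filter, mul_sum]

/-- The value of `y` at the fixed point `s` is unconstrained; summing over it first produces the
factor `∑ a, g s a`. -/
lemma sum_stabilized_prod_eq_zero [Nonempty α] (g : V → α → ℝ) (τ : Equiv.Perm V) (s : V)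
    (hs : τ s = s) (hg : ∑ a, g s a = 0) :
    ∑ y : V → α with (y ∘ ⇑τ = y), ∏ s, g s (y s) = 0 := by
  have hn : (Fintype.card α : ℝ) ≠ 0 := by exact_mod_cast Fintype.card_ne_zero
  rw [sum_filter]
  refine (mul_eq_zero.1 (?_ : (Fintype.card α : ℝ) * _ = 0)).resolve_left hn
  rw [card_mul_sum_eq_sum_update _ s]
  refine sum_eq_zero fun z _ => ?_
  have hinv : ∀ a, (Function.update z s a ∘ τ = Function.update z s a ↔
      ∀ t, t ≠ s → z (τ t) = z t) := by
    intro a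
    rw [funext_iff]
    refine ⟨fun h t ht => ?_, fun h t => ?_⟩
    · have := h t
      have h' : τ t ≠ s := fun h' => ht (τ.injective (h'.trans hs.symm))
      simpa [Function.update_of_ne ht, Function.update_of_ne h'] using this
    · by_cases ht : t = s
      · subst ht; simp [hs]
      · have h' : τ t ≠ s := fun h' => ht (τ.injective (h'.trans hs.symm))
        simpa [Function.update_of_ne ht, Function.update_of_ne h'] using h t ht
  by_cases hc : ∀ t, t ≠ s → z (τ t) = z t
  · rw [sum_congr rfl fun a _ => if_pos ((hinv a).2 hc)]
    have : ∀ a, ∏ t, g t (Function.update z s a t) = g s a * ∏ t ∈ univ.erase s, g t (z t) := by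
      intro a
      rw [← mul_prod_erase univ _ (mem_univ s)]
      simp only [Function.update_self]
      congr 1
      refine prod_congr rfl fun t ht => ?_
      rw [Function.update_of_ne (mem_erase.1 ht).1]
    simp only [this, ← sum_mul, hg, zero_mul]
  · exact sum_eq_zero fun a _ => if_neg fun h => hc ((hinv a).1 h)

/-- Expectation of a product of functions of the values of a uniform permutation at distinct
points: only the permutations `τ` of the points that move every centred factor contribute. -/
lemma abs_permMean_prod_le [Nonempty α] (x : V ↪ α) (g : V → α → ℝ) (C : V → Prop)
    [DecidablePred C] (hC : ∀ s, ¬ C s → ∑ a, g s a = 0) :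
    |permMean (fun σ : Equiv.Perm α => ∏ s, g s (σ (x s)))| ≤
      (∑ τ : Equiv.Perm V with ∀ s, τ s = s → C s,
        ∑ y : V → α with (y ∘ ⇑τ = y), ∏ s, |g s (y s)|) /
        ((Fintype.card α).descFactorial (Fintype.card V)) := by
  rw [permMean_comp_embedding x (fun y => ∏ s, g s (y s)), sum_injective_prod_eq, abs_div]
  rw [abs_of_nonneg (a := (((Fintype.card α).descFactorial (Fintype.card V) : ℕ) : ℝ))
    (Nat.cast_nonneg _)]
  refine div_le_div_of_nonneg_right ?_ (Nat.cast_nonneg _)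
  rw [sum_filter]
  refine (abs_sum_le_sum_abs _ _).trans (sum_le_sum fun τ _ => ?_)
  rw [abs_mul]
  have hsgn : |((Equiv.Perm.sign τ : ℤ) : ℝ)| = 1 := by
    rcases Int.units_eq_one_or (Equiv.Perm.sign τ) with h | h <;> simp [h]
  rw [hsgn, one_mul]
  split_ifs with h
  · refine (abs_sum_le_sum_abs _ _).trans (sum_le_sum fun y _ => ?_)
    rw [abs_prod]
  · push Not at h
    obtain ⟨s, hs, hCs⟩ := h
    rw [sum_stabilized_prod_eq_zero g τ s hs (hC s hCs), abs_zero]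

end

/-! ### Flows on slots and the components of the slot graph -/

section

variable {V α ι I : Type*} [Fintype α] [DecidableEq α] [Fintype ι] [DecidableEq ι] [Fintype I]
  [DecidableEq I]

/-- The sum, over all positions `x` of the slots with prescribed intersection with `E` and all
`τ`-invariant images `y`, of the absolute weights of a family of flows on the slots. -/
noncomputable def slotSum (A : Matrix α α ℝ) (E : Finset α) (m : ι → I → ℕ)
    (ρ : I → Equiv.Perm ι) (τ : Equiv.Perm ι) (e : Finset ι) : ℝ :=
  ∑ x : ι → α with (∀ s, x s ∈ E ↔ s ∈ e), ∑ y : ι → α with (y ∘ ⇑τ = y),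
    ∏ s, ∏ i, |A (y s) (x (ρ i s))| ^ m s i

/-- The slots which are not isolated loops away from the exceptional set. -/
def activeSlots (ρ : I → Equiv.Perm ι) (τ : Equiv.Perm ι) (e : Finset ι) : Finset ι :=
  univ.filter fun s => τ s ≠ s ∨ s ∈ e ∨ ∃ i, ρ i s ≠ s

lemma notMem_activeSlots {ρ : I → Equiv.Perm ι} {τ : Equiv.Perm ι} {e : Finset ι} {s : ι} :
    s ∉ activeSlots ρ τ e ↔ τ s = s ∧ s ∉ e ∧ ∀ i, ρ i s = s := by
  simp [activeSlots]

/-- Families of flows on slots, given by their multiplicities `m` and permutations `π`, together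
with a permutation `τ` of the slots and a set `e` of exceptional slots. -/
structure IsSlotFlow (m : ι → I → ℕ) (π : I → Equiv.Perm ι) (τ : Equiv.Perm ι) (e : Finset ι) :
    Prop where
  map_eq : ∀ s i, m (π i s) i = m s i
  fix : ∀ s i, m s i = 0 → π i s = s
  pos : ∀ s, ∃ i, 0 < m s i
  le_one : ∀ s ∈ e, ∀ i, m s i ≤ 1
  two_le : ∀ s, τ s = s → 2 ≤ ∑ i, m s i

/-- Families of flows on slots in which no isolated pair of distinct slots occurs. -/
structure IsReduced (m : ι → I → ℕ) (ρ : I → Equiv.Perm ι) (τ : Equiv.Perm ι) (e : Finset ι) :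
    Prop extends IsSlotFlow m ρ τ e where
  pair : ∀ s s', s' ∉ e → τ s = s → (∀ i, 0 < m s i → ρ i s = s') →
    (∀ i t, 0 < m t i → ρ i t = s' → t = s) → s = s'

/-- The graph on images (left) and positions (right) of the slots recording the coincidences of
images and the entries of the matrix. -/
def slotGraph (m : ι → I → ℕ) (ρ : I → Equiv.Perm ι) (τ : Equiv.Perm ι) : SimpleGraph (ι ⊕ ι) :=
  SimpleGraph.fromRel fun u v => (∃ s, u = Sum.inl s ∧ v = Sum.inl (τ s)) ∨
    ∃ s i, 0 < m s i ∧ u = Sum.inl s ∧ v = Sum.inr (ρ i s)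

/-- The slot of a vertex of the slot graph. -/
abbrev slotOf (v : ι ⊕ ι) : ι := Sum.elim id id v

section

variable {m : ι → I → ℕ} {ρ : I → Equiv.Perm ι} {τ : Equiv.Perm ι} {e : Finset ι}

lemma slotGraph_adj_cases {u v : ι ⊕ ι} (h : (slotGraph m ρ τ).Adj u v) :
    (∃ s t, u = Sum.inl s ∧ v = Sum.inl t ∧ (t = τ s ∨ s = τ t)) ∨
      ∃ s i, 0 < m s i ∧ (u = Sum.inl s ∧ v = Sum.inr (ρ i s) ∨
        v = Sum.inl s ∧ u = Sum.inr (ρ i s)) := by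
  simp only [slotGraph, SimpleGraph.fromRel_adj] at h
  rcases h.2 with (⟨s, hu, hv⟩ | ⟨s, i, hm, hu, hv⟩) | (⟨s, hu, hv⟩ | ⟨s, i, hm, hu, hv⟩)
  · exact Or.inl ⟨s, _, hu, hv, Or.inl rfl⟩
  · exact Or.inr ⟨s, i, hm, Or.inl ⟨hu, hv⟩⟩
  · exact Or.inl ⟨_, s, hv, hu, Or.inr rfl⟩
  · exact Or.inr ⟨s, i, hm, Or.inr ⟨hu, hv⟩⟩

lemma slotGraph_reachable_inl (s : ι) :
    (slotGraph m ρ τ).Reachable (Sum.inl s) (Sum.inl (τ s)) := by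
  by_cases h : (Sum.inl s : ι ⊕ ι) = Sum.inl (τ s)
  · rw [← h]
  · refine SimpleGraph.Adj.reachable ?_
    simp only [slotGraph, SimpleGraph.fromRel_adj]
    exact ⟨h, Or.inl (Or.inl ⟨s, rfl, rfl⟩)⟩

lemma slotGraph_reachable_inr {s : ι} {i : I} (hm : 0 < m s i) :
    (slotGraph m ρ τ).Reachable (Sum.inl s) (Sum.inr (ρ i s)) := by
  refine SimpleGraph.Adj.reachable ?_
  simp only [slotGraph, SimpleGraph.fromRel_adj]
  exact ⟨by simp, Or.inl (Or.inr ⟨s, i, hm, rfl, rfl⟩)⟩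

lemma mem_activeSlots_apply_iff (s : ι) : τ s ∈ activeSlots ρ τ e ↔ s ∈ activeSlots ρ τ e := by
  rw [← not_iff_not]
  constructor
  · intro h
    have := τ.injective (notMem_activeSlots.1 h).1
    rwa [this] at h
  · intro h
    rwa [(notMem_activeSlots.1 h).1]

lemma mem_activeSlots_apply_iff' (s : ι) (i : I) :
    ρ i s ∈ activeSlots ρ τ e ↔ s ∈ activeSlots ρ τ e := by
  rw [← not_iff_not]
  constructor
  · intro h
    have := (ρ i).injective ((notMem_activeSlots.1 h).2.2 i)
    rwa [this] at h
  · intro h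
    rwa [(notMem_activeSlots.1 h).2.2 i]

lemma slotOf_mem_activeSlots_iff {u v : ι ⊕ ι} (h : (slotGraph m ρ τ).Reachable u v) :
    slotOf u ∈ activeSlots ρ τ e ↔ slotOf v ∈ activeSlots ρ τ e := by
  obtain ⟨p⟩ := h
  induction p with
  | nil => rfl
  | cons h p ih =>
    rw [← ih]
    rcases slotGraph_adj_cases h with ⟨s, t, rfl, rfl, h | h⟩ | ⟨s, i, hm, ⟨rfl, rfl⟩ | ⟨rfl, rfl⟩⟩
    · subst h; exact (mem_activeSlots_apply_iff s).symm
    · subst h; exact mem_activeSlots_apply_iff t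
    · exact (mem_activeSlots_apply_iff' s i).symm
    · exact mem_activeSlots_apply_iff' s i

/-- A choice of a root in each component of the slot graph: always a position, and one in the
exceptional set whenever possible. -/
structure IsRooting (m : ι → I → ℕ) (ρ : I → Equiv.Perm ι) (τ : Equiv.Perm ι) (e : Finset ι)
    (r : ι ⊕ ι → ι ⊕ ι) : Prop where
  reachable : ∀ v, (slotGraph m ρ τ).Reachable v (r v)
  congr : ∀ u v, (slotGraph m ρ τ).Reachable u v → r u = r v
  isRight : ∀ v, ∃ s, r v = Sum.inr s

lemma IsReduced.exists_rooting (h : IsReduced m ρ τ e) : ∃ r, IsRooting m ρ τ e r := by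
  have H : ∀ c : (slotGraph m ρ τ).ConnectedComponent,
      ∃ s, (slotGraph m ρ τ).connectedComponentMk (Sum.inr s) = c := by
    intro c
    induction c using SimpleGraph.ConnectedComponent.ind with
    | h v =>
      rcases v with s | s
      · obtain ⟨i, hi⟩ := h.pos s
        exact ⟨ρ i s, SimpleGraph.ConnectedComponent.sound (slotGraph_reachable_inr hi).symm⟩
      · exact ⟨s, rfl⟩
  choose f hf using H
  refine ⟨fun v => Sum.inr (f ((slotGraph m ρ τ).connectedComponentMk v)), ⟨fun v => ?_,
    fun u v huv => ?_, fun v => ⟨_, rfl⟩⟩⟩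
  · exact (SimpleGraph.ConnectedComponent.exact (hf _)).symm
  · simp only [SimpleGraph.ConnectedComponent.sound huv]

/-- The vertices of the slot graph in active slots. -/
def activeVertices (ρ : I → Equiv.Perm ι) (τ : Equiv.Perm ι) (e : Finset ι) : Finset (ι ⊕ ι) :=
  univ.filter fun v => slotOf v ∈ activeSlots ρ τ e

lemma mem_activeVertices {v : ι ⊕ ι} :
    v ∈ activeVertices ρ τ e ↔ slotOf v ∈ activeSlots ρ τ e := by simp [activeVertices]

lemma card_activeVertices : (activeVertices ρ τ e).card = 2 * (activeSlots ρ τ e).card := by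
  have : activeVertices ρ τ e = (activeSlots ρ τ e).disjSum (activeSlots ρ τ e) := by
    ext v
    rcases v with v | v <;> simp [mem_activeVertices]
  rw [this, card_disjSum, two_mul]

/-- The roots of the components made of active slots. -/
def activeRoots (ρ : I → Equiv.Perm ι) (τ : Equiv.Perm ι) (e : Finset ι)
    (r : ι ⊕ ι → ι ⊕ ι) : Finset (ι ⊕ ι) :=
  (activeVertices ρ τ e).filter fun v => r v = v

/-- The active vertices, two per active slot, are counted by component. Each component contains a
position and an image, hence at least two vertices. With a root outside `e` it has at least three:
otherwise it would be an isolated pair, which in a reduced family is the loop of an inactive slot.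
-/
lemma IsReduced.card_activeRoots_le (h : IsReduced m ρ τ e) {r : ι ⊕ ι → ι ⊕ ι}
    (hr : IsRooting m ρ τ e r) :
    3 * ((activeRoots ρ τ e r).filter fun v => slotOf v ∉ e).card +
      2 * ((activeRoots ρ τ e r).filter fun v => slotOf v ∈ e).card ≤
      2 * (activeSlots ρ τ e).card := by
  have hmaps : ∀ v ∈ activeVertices ρ τ e, r v ∈ activeRoots ρ τ e r := by
    intro v hv
    rw [activeRoots, mem_filter, mem_activeVertices]
    refine ⟨?_, (hr.congr _ _ (hr.reachable v)).symm⟩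
    rw [← slotOf_mem_activeSlots_iff (hr.reachable v)]
    exact mem_activeVertices.1 hv
  rw [← card_activeVertices, card_eq_sum_card_fiberwise hmaps]
  have hmem : ∀ v ∈ activeRoots ρ τ e r, ∀ u, (slotGraph m ρ τ).Reachable u v →
      u ∈ (activeVertices ρ τ e).filter fun w => r w = v := by
    intro v hv u huv
    rw [activeRoots, mem_filter, mem_activeVertices] at hv
    rw [mem_filter, mem_activeVertices]
    exact ⟨(slotOf_mem_activeSlots_iff huv).2 hv.1, (hr.congr _ _ huv).trans hv.2⟩
  have hex : ∀ v ∈ activeRoots ρ τ e r, ∃ s t, v = Sum.inr s ∧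
      (slotGraph m ρ τ).Reachable (Sum.inl t) v := by
    intro v hv
    have hv2 := (mem_filter.1 hv).2
    obtain ⟨s, hs⟩ := hr.isRight v
    rw [hv2] at hs
    subst hs
    obtain ⟨i, hi⟩ := h.pos s
    refine ⟨s, (ρ i).symm s, rfl, ?_⟩
    have h1 : 0 < m ((ρ i).symm s) i := by
      rw [← h.map_eq, Equiv.apply_symm_apply]; exact hi
    have h2 := slotGraph_reachable_inr (ρ := ρ) (τ := τ) h1
    rwa [Equiv.apply_symm_apply] at h2
  have h2 : ∀ v ∈ activeRoots ρ τ e r,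
      2 ≤ ((activeVertices ρ τ e).filter fun w => r w = v).card := by
    intro v hv
    obtain ⟨s, t, rfl, ht⟩ := hex v hv
    calc 2 = ({Sum.inr s, Sum.inl t} : Finset (ι ⊕ ι)).card := by simp
      _ ≤ _ := card_le_card (by
        intro u hu
        rw [mem_insert, mem_singleton] at hu
        rcases hu with rfl | rfl
        · exact hmem _ hv _ (SimpleGraph.Reachable.refl _)
        · exact hmem _ hv _ ht)
  have h3 : ∀ v ∈ activeRoots ρ τ e r, slotOf v ∉ e →
      3 ≤ ((activeVertices ρ τ e).filter fun w => r w = v).card := by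
    intro v hv hve
    obtain ⟨s, t, rfl, ht⟩ := hex v hv
    by_contra hlt
    have hsub : ({Sum.inr s, Sum.inl t} : Finset (ι ⊕ ι)) ⊆
        (activeVertices ρ τ e).filter fun w => r w = Sum.inr s := by
      intro u hu
      rw [mem_insert, mem_singleton] at hu
      rcases hu with rfl | rfl
      · exact hmem _ hv _ (SimpleGraph.Reachable.refl _)
      · exact hmem _ hv _ ht
    have heq := eq_of_subset_of_card_le hsub (by
      have : ({Sum.inr s, Sum.inl t} : Finset (ι ⊕ ι)).card = 2 := by simp
      omega)
    have hall : ∀ u, (slotGraph m ρ τ).Reachable u (Sum.inr s) → u = Sum.inr s ∨ u = Sum.inl t := by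
      intro u hu
      have := hmem _ hv u hu
      rw [← heq] at this
      simpa using this
    have hτ : τ t = t := by
      have := hall _ ((slotGraph_reachable_inl (m := m) (ρ := ρ) t).symm.trans ht)
      simpa using this
    have hst : ∀ i, 0 < m t i → ρ i t = s := by
      intro i hi
      have := hall _ ((slotGraph_reachable_inr (ρ := ρ) (τ := τ) hi).symm.trans ht)
      simpa using this
    have := h.pair t s hve hτ hst (by
      intro i t' hi hs'
      have := hall (Sum.inl t') (by rw [← hs']; exact slotGraph_reachable_inr hi)
      simpa using this)
    subst this
    have hD : t ∈ activeSlots ρ τ e := mem_activeVertices.1 (mem_filter.1 hv).1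
    refine (notMem_activeSlots.2 ⟨hτ, hve, fun i => ?_⟩) hD
    rcases Nat.eq_zero_or_pos (m t i) with h0 | h0
    · exact h.fix t i h0
    · exact hst i h0
  rw [← sum_filter_add_sum_filter_not (activeRoots ρ τ e r) (fun v => slotOf v ∈ e), add_comm]
  refine add_le_add ?_ ?_
  · rw [mul_comm, ← smul_eq_mul, ← sum_const]
    exact sum_le_sum fun v hv => h2 v (mem_filter.1 hv).1
  · rw [mul_comm, ← smul_eq_mul, ← sum_const]
    exact sum_le_sum fun v hv => h3 v (mem_filter.1 hv).1 (mem_filter.1 hv).2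

lemma exists_tail_walk {G : SimpleGraph V} {a b : V} (w : G.Walk a b) (h : a ≠ b) :
    ∃ p, G.Adj a p ∧ ∃ w' : G.Walk p b, w'.length + 1 = w.length := by
  cases w with
  | nil => exact absurd rfl h
  | cons hadj w' => exact ⟨_, hadj, w', rfl⟩

/-- The parent is the next vertex on a shortest path to the root. -/
lemma IsRooting.exists_parent {r : ι ⊕ ι → ι ⊕ ι} (hr : IsRooting m ρ τ e r) {v : ι ⊕ ι}
    (hv : r v ≠ v) : ∃ p, (slotGraph m ρ τ).Adj v p ∧
      (slotGraph m ρ τ).dist p (r p) < (slotGraph m ρ τ).dist v (r v) := by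
  obtain ⟨w, hw⟩ := (hr.reachable v).exists_walk_length_eq_dist
  obtain ⟨p, hadj, w', hw'⟩ := exists_tail_walk w hv.symm
  refine ⟨p, hadj, ?_⟩
  rw [← hw, ← hw', ← hr.congr _ _ hadj.reachable]
  exact Nat.lt_succ_of_le (SimpleGraph.dist_le w')

end

end

/-! ### Pointwise bounds by the links of a spanning forest -/

section

variable {V α ι I : Type*} [Fintype α] [DecidableEq α] [Fintype ι] [DecidableEq ι] [Fintype I]
  [DecidableEq I]

/-- Bounds on the entries, rows and columns of a matrix, with an exceptional set `E` of columns. -/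
structure EntryBounds (A : Matrix α α ℝ) (E : Finset α) (θ : ℝ) : Prop where
  pos : 0 < θ
  le_one : θ ≤ 1
  entry : ∀ y x, |A y x| ≤ 1
  entry_of_notMem : ∀ y, ∀ x ∉ E, |A y x| ≤ θ
  row : ∀ y, ∑ x, |A y x| ≤ 2
  col : ∀ x, ∑ y, |A y x| ≤ 2
  sq : ∑ x, ∑ y, A y x ^ 2 ≤ Fintype.card α * θ ^ 2

/-- Keeps `c ≤ 1` copies of an entry, to be summed along its row or column, and replaces the rest by
`θ`. The factor `θ⁻¹ ^ 2` pays for the extracted copy, and for entries in exceptional columns,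
bounded by 1 only but of multiplicity at most one. -/
lemma pow_le_pow_mul_inv_sq_mul {a θ : ℝ} (hθ : 0 < θ) (hθ1 : θ ≤ 1) (ha : 0 ≤ a) {m c : ℕ}
    (hc : c ≤ 1) (hm : m = 0 → c = 0) (h : a ≤ θ ∨ a ≤ 1 ∧ m ≤ 1) :
    a ^ m ≤ θ ^ m * θ⁻¹ ^ 2 * a ^ c := by
  have hi : 1 ≤ θ⁻¹ := (one_le_inv₀ hθ).2 hθ1
  have hi2 : 1 ≤ θ⁻¹ ^ 2 := one_le_pow₀ hi
  rcases Nat.le_one_iff_eq_zero_or_eq_one.1 hc with rfl | rfl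
  · rw [pow_zero, mul_one]
    rcases h with h | ⟨h, hm1⟩
    · calc a ^ m ≤ θ ^ m := pow_le_pow_left₀ ha h m
        _ = θ ^ m * 1 := (mul_one _).symm
        _ ≤ _ := by gcongr
    · calc a ^ m ≤ 1 := pow_le_one₀ ha h
        _ = θ ^ 2 * θ⁻¹ ^ 2 := by field_simp
        _ ≤ θ ^ m * θ⁻¹ ^ 2 := by
          gcongr ?_ * _
          exact pow_le_pow_of_le_one hθ.le hθ1 (by omega)
  · obtain ⟨k, rfl⟩ : ∃ k, m = k + 1 := Nat.exists_eq_succ_of_ne_zero fun h => by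
      simpa using hm h
    have h1 : a ^ k ≤ θ ^ k := by
      rcases h with h | ⟨h, hm1⟩
      · exact pow_le_pow_left₀ ha h k
      · obtain rfl : k = 0 := by omega
        simp
    calc a ^ (k + 1) = a ^ k * a := pow_succ _ _
      _ ≤ θ ^ k * a := by gcongr
      _ = θ ^ (k + 1) * θ⁻¹ * a := by field_simp; ring
      _ ≤ θ ^ (k + 1) * θ⁻¹ ^ 2 * a ^ 1 := by
        rw [pow_one]
        gcongr
        exact le_self_pow₀ hi two_ne_zero

/-- For a loop: with `S` the sum of squares of a column, `a ^ 2 / S` is to be summed over the image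
and `S` over the position. If `S = 0` then `a = 0`, consistently with division by zero. -/
lemma pow_le_mul_mul_div {a θ S : ℝ} (hθ : 0 < θ) (ha : 0 ≤ a) (haθ : a ≤ θ) (hS : a ^ 2 ≤ S)
    {m : ℕ} (hm : 2 ≤ m) : a ^ m ≤ a ^ 2 / S * (θ ^ (m - 2) * S) := by
  rcases (sq_nonneg a).trans hS |>.eq_or_lt with h0 | h0
  · have : a = 0 := by
      rw [← h0] at hS
      exact pow_eq_zero_iff two_ne_zero |>.1 (le_antisymm hS (sq_nonneg a))
    subst this
    rw [zero_pow (by omega)]; simp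
  · have : a ^ 2 / S * (θ ^ (m - 2) * S) = a ^ 2 * θ ^ (m - 2) := by field_simp
    rw [this]
    calc a ^ m = a ^ 2 * a ^ (m - 2) := by rw [← pow_add]; congr 1; omega
      _ ≤ _ := by gcongr

section

variable {m : ι → I → ℕ} {ρ : I → Equiv.Perm ι} {τ : Equiv.Perm ι} {e : Finset ι}

/-- The kind of an edge of the slot graph between `v` and `p`: equality of two images, or an entry
of the matrix. -/
def IsLink (m : ι → I → ℕ) (ρ : I → Equiv.Perm ι) (τ : Equiv.Perm ι) (v p : ι ⊕ ι) :
    Option (ι × I) → Prop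
  | none => ∃ s t, v = Sum.inl s ∧ p = Sum.inl t ∧ (t = τ s ∨ s = τ t)
  | some (s, i) => 0 < m s i ∧ (v = Sum.inl s ∧ p = Sum.inr (ρ i s) ∨
      p = Sum.inl s ∧ v = Sum.inr (ρ i s))

/-- The weight of a link. -/
noncomputable def linkWeight (A : Matrix α α ℝ) (ρ : I → Equiv.Perm ι) (v p : ι ⊕ ι)
    (l : Option (ι × I)) (z : ι ⊕ ι → α) : ℝ :=
  l.elim (if z v = z p then 1 else 0) fun si => |A (z (Sum.inl si.1)) (z (Sum.inr (ρ si.2 si.1)))|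

lemma linkWeight_nonneg (A : Matrix α α ℝ) (ρ : I → Equiv.Perm ι) (v p : ι ⊕ ι)
    (l : Option (ι × I)) (z : ι ⊕ ι → α) : 0 ≤ linkWeight A ρ v p l z := by
  cases l
  · simp only [linkWeight, Option.elim]; split_ifs <;> norm_num
  · simp only [linkWeight, Option.elim]; positivity

lemma linkWeight_congr {A : Matrix α α ℝ} {v p : ι ⊕ ι} {l : Option (ι × I)}
    (h : IsLink m ρ τ v p l) {z z' : ι ⊕ ι → α} (hv : z v = z' v) (hp : z p = z' p) :
    linkWeight A ρ v p l z = linkWeight A ρ v p l z' := by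
  rcases l with _ | ⟨s, i⟩
  · simp only [linkWeight, Option.elim, hv, hp]
  · obtain ⟨-, ⟨rfl, rfl⟩ | ⟨rfl, rfl⟩⟩ := h
    · simp only [linkWeight, Option.elim, hv, hp]
    · simp only [linkWeight, Option.elim, hv, hp]

lemma sum_linkWeight_le {A : Matrix α α ℝ} {E : Finset α} {θ : ℝ} (hA : EntryBounds A E θ)
    {v p : ι ⊕ ι} {l : Option (ι × I)} (h : IsLink m ρ τ v p l) (hpv : p ≠ v)
    (z : ι ⊕ ι → α) : ∑ a, linkWeight A ρ v p l (Function.update z v a) ≤ 2 := by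
  rcases l with _ | ⟨s, i⟩
  · simp only [linkWeight, Option.elim, Function.update_self, Function.update_of_ne hpv]
    rw [sum_ite_eq' univ (z p)]
    simp
  · obtain ⟨-, ⟨rfl, rfl⟩ | ⟨rfl, rfl⟩⟩ := h
    · simp only [linkWeight, Option.elim, Function.update_self, Function.update_of_ne hpv]
      exact hA.col _
    · simp only [linkWeight, Option.elim, Function.update_self, Function.update_of_ne hpv]
      exact hA.row _

lemma linkWeight_none_eq_one {A : Matrix α α ℝ} {v p : ι ⊕ ι} (h : IsLink m ρ τ v p none)
    {y x : ι → α} (hy : y ∘ ⇑τ = y) : linkWeight A ρ v p none (Sum.elim y x) = 1 := by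
  obtain ⟨s, t, rfl, rfl, h⟩ := h
  have : y s = y t := by
    rcases h with rfl | rfl
    · exact (congrFun hy s).symm
    · exact congrFun hy t
  simp [linkWeight, this]

lemma IsRooting.exists_link {r : ι ⊕ ι → ι ⊕ ι} (hr : IsRooting m ρ τ e r) (v : ι ⊕ ι) :
    ∃ (p : ι ⊕ ι) (l : Option (ι × I)), r v ≠ v → IsLink m ρ τ v p l ∧
      (slotGraph m ρ τ).dist p (r p) < (slotGraph m ρ τ).dist v (r v) ∧
      (slotGraph m ρ τ).Reachable v p := by
  by_cases hv : r v = v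
  · exact ⟨v, none, fun h => absurd hv h⟩
  · obtain ⟨p, hadj, hd⟩ := hr.exists_parent hv
    rcases slotGraph_adj_cases hadj with h | ⟨s, i, h⟩
    · exact ⟨p, none, fun _ => ⟨h, hd, hadj.reachable⟩⟩
    · exact ⟨p, some (s, i), fun _ => ⟨h, hd, hadj.reachable⟩⟩

/-- Pointwise bound by the weights of the links of a spanning forest. -/
lemma prod_active_le {A : Matrix α α ℝ} {E : Finset α} {θ : ℝ} (hA : EntryBounds A E θ)
    (h : IsReduced m ρ τ e) {r : ι ⊕ ι → ι ⊕ ι} (p : ι ⊕ ι → ι ⊕ ι) (l : ι ⊕ ι → Option (ι × I))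
    (hl : ∀ v, r v ≠ v → IsLink m ρ τ v (p v) (l v) ∧
      (slotGraph m ρ τ).dist (p v) (r (p v)) < (slotGraph m ρ τ).dist v (r v) ∧
      (slotGraph m ρ τ).Reachable v (p v))
    {x y : ι → α} (hx : ∀ s, x s ∈ E ↔ s ∈ e) (hy : y ∘ ⇑τ = y) :
    ∏ s ∈ activeSlots ρ τ e, ∏ i, |A (y s) (x (ρ i s))| ^ m s i ≤
      (∏ s ∈ activeSlots ρ τ e, ∏ i, (θ ^ m s i * θ⁻¹ ^ 2)) *
        ∏ v ∈ (activeVertices ρ τ e).filter (fun v => r v ≠ v),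
          linkWeight A ρ v (p v) (l v) (Sum.elim y x) := by
  set NR := (activeVertices ρ τ e).filter (fun v => r v ≠ v) with hNR
  have hNRl : ∀ v ∈ NR, IsLink m ρ τ v (p v) (l v) := fun v hv =>
    (hl v (mem_filter.1 hv).2).1
  have h1 : ∏ v ∈ NR, linkWeight A ρ v (p v) (l v) (Sum.elim y x) =
      ∏ s, ∏ i, |A (y s) (x (ρ i s))| ^ (NR.filter fun v => l v = some (s, i)).card := by
    rw [← prod_fiberwise NR l, Fintype.prod_option, Fintype.prod_prod_type]
    have : ∏ v ∈ NR with l v = none, linkWeight A ρ v (p v) (l v) (Sum.elim y x) = 1 := by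
      refine prod_eq_one fun v hv => ?_
      have hv' := mem_filter.1 hv
      have := hNRl v hv'.1
      rw [hv'.2] at this ⊢
      exact linkWeight_none_eq_one this hy
    rw [this, one_mul]
    refine prod_congr rfl fun s _ => prod_congr rfl fun i _ => ?_
    rw [← prod_const]
    refine prod_congr rfl fun v hv => ?_
    rw [(mem_filter.1 hv).2]
    simp [linkWeight]
  have h0 : ∀ s i, s ∉ activeSlots ρ τ e → (NR.filter fun v => l v = some (s, i)).card = 0 := by
    intro s i hs
    rw [card_eq_zero, filter_eq_empty_iff]
    intro v hv hlv
    have h2 := hNRl v hv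
    rw [hlv] at h2
    have h3 := mem_activeVertices.1 (mem_filter.1 hv).1
    rcases h2.2 with ⟨rfl, -⟩ | ⟨-, rfl⟩
    · exact hs h3
    · exact hs ((mem_activeSlots_apply_iff' s i).1 h3)
  rw [h1, ← prod_subset (subset_univ (activeSlots ρ τ e)) (fun s _ hs => by
    simp only [h0 s _ hs, pow_zero, prod_const_one]), ← prod_mul_distrib]
  refine prod_le_prod (fun s _ => prod_nonneg fun i _ => by positivity) fun s _ => ?_
  rw [← prod_mul_distrib]
  refine prod_le_prod (fun i _ => by positivity) fun i _ => ?_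
  refine pow_le_pow_mul_inv_sq_mul hA.pos hA.le_one (abs_nonneg _) ?_ ?_ ?_
  -- An entry links at most one vertex to its parent: if both endpoints used it, each would be the
  -- parent of the other, against the strict decrease of the distance to the root.
  · rw [card_le_one]
    intro v hv v' hv'
    rw [mem_filter] at hv hv'
    have g1 := hl v (mem_filter.1 hv.1).2
    have g2 := hl v' (mem_filter.1 hv'.1).2
    rw [hv.2] at g1
    rw [hv'.2] at g2
    rcases g1.1.2 with ⟨a1, a2⟩ | ⟨a1, a2⟩ <;> rcases g2.1.2 with ⟨b1, b2⟩ | ⟨b1, b2⟩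
    · rw [a1, b1]
    · exfalso
      have e1 : v = p v' := a1.trans b1.symm
      have e2 : v' = p v := b2.trans a2.symm
      have := g1.2.1.trans (e1 ▸ g2.2.1)
      rw [← e2] at this
      exact lt_irrefl _ this
    · exfalso
      have e1 : v' = p v := b1.trans a1.symm
      have e2 : v = p v' := a2.trans b2.symm
      have := g1.2.1.trans (e2 ▸ g2.2.1)
      rw [← e1] at this
      exact lt_irrefl _ this
    · rw [a2, b2]
  · intro hm
    rw [card_eq_zero, filter_eq_empty_iff]
    intro v hv hlv
    have h2 := hNRl v hv
    rw [hlv] at h2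
    exact absurd h2.1 (by omega)
  -- The multiplicity is the same at `s` and at `ρ i s`, so it is at most one at an exceptional
  -- position.
  · by_cases hs : ρ i s ∈ e
    · refine Or.inr ⟨hA.entry _ _, ?_⟩
      rw [← h.map_eq]
      exact h.le_one _ hs i
    · exact Or.inl (hA.entry_of_notMem _ _ fun hE => hs ((hx _).1 hE))

/-- The weights of the variables attached to inactive slots. -/
noncomputable def loopWeight (A : Matrix α α ℝ) (m : ι → I → ℕ) (θ : ℝ) (z : ι ⊕ ι → α) :
    ι ⊕ ι → ℝ :=
  Sum.elim (fun s => A (z (Sum.inl s)) (z (Sum.inr s)) ^ 2 / ∑ y, A y (z (Sum.inr s)) ^ 2)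
    (fun s => θ ^ (∑ i, m s i - 2) * ∑ y, A y (z (Sum.inr s)) ^ 2)

lemma prod_inactive_le {A : Matrix α α ℝ} {E : Finset α} {θ : ℝ} (hA : EntryBounds A E θ)
    (h : IsReduced m ρ τ e) {x y : ι → α} (hx : ∀ s, x s ∈ E ↔ s ∈ e) {s : ι}
    (hs : s ∉ activeSlots ρ τ e) :
    ∏ i, |A (y s) (x (ρ i s))| ^ m s i ≤ loopWeight A m θ (Sum.elim y x) (Sum.inl s) *
      loopWeight A m θ (Sum.elim y x) (Sum.inr s) := by
  obtain ⟨h1, h2, h3⟩ := notMem_activeSlots.1 hs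
  simp only [h3, prod_pow_eq_pow_sum, loopWeight, Sum.elim_inl, Sum.elim_inr]
  rw [← sq_abs (A (y s) (x s))]
  refine pow_le_mul_mul_div hA.pos (abs_nonneg _)
    (hA.entry_of_notMem _ _ fun hE => h2 ((hx s).1 hE)) ?_ (h.two_le s h1)
  rw [sq_abs]
  exact single_le_sum (f := fun y => A y (x s) ^ 2) (fun y _ => sq_nonneg _) (mem_univ (y s))

end

end

/-! ### Bound of a reduced slot sum by powers of `n` and of `|E|` -/

section

variable {V α ι I : Type*} [Fintype α] [DecidableEq α] [Fintype ι] [DecidableEq ι] [Fintype I]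
  [DecidableEq I]

lemma prod_ite_mem_slotOf (D : Finset ι) (f g : ι ⊕ ι → ℝ) :
    ∏ v, (if slotOf v ∈ D then f v else g v) =
      (∏ v ∈ univ.filter (fun v => slotOf v ∈ D), f v) *
        ∏ s ∈ Dᶜ, (g (Sum.inl s) * g (Sum.inr s)) := by
  rw [prod_ite]
  congr 1
  have : (univ.filter fun v : ι ⊕ ι => ¬ slotOf v ∈ D) = Dᶜ.disjSum Dᶜ := by
    ext v
    rcases v with v | v <;> simp
  rw [this, prod_disjSum, prod_mul_distrib]

section

variable {m : ι → I → ℕ} {ρ : I → Equiv.Perm ι} {τ : Equiv.Perm ι} {e : Finset ι}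

lemma sum_sum_prod_le [Nonempty α] {A : Matrix α α ℝ} {E : Finset α} {θ : ℝ}
    (hA : EntryBounds A E θ) (h : IsReduced m ρ τ e) {r : ι ⊕ ι → ι ⊕ ι}
    (hr : IsRooting m ρ τ e r) (p : ι ⊕ ι → ι ⊕ ι) (l : ι ⊕ ι → Option (ι × I))
    (hl : ∀ v, r v ≠ v → IsLink m ρ τ v (p v) (l v) ∧
      (slotGraph m ρ τ).dist (p v) (r (p v)) < (slotGraph m ρ τ).dist v (r v) ∧
      (slotGraph m ρ τ).Reachable v (p v)) :
    ∑ z : ι ⊕ ι → α, ∏ v, (if slotOf v ∈ activeSlots ρ τ e then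
      (if r v = v then (if slotOf v ∈ e then (if z v ∈ E then 1 else 0) else 1)
        else linkWeight A ρ v (p v) (l v) z) else loopWeight A m θ z v) ≤
    ∏ v, (if slotOf v ∈ activeSlots ρ τ e then
      (if r v = v then (if slotOf v ∈ e then (E.card : ℝ) else Fintype.card α) else 2) else
        Sum.elim (fun _ => 1) (fun s => Fintype.card α * θ ^ ∑ i, m s i) v) := by
  have hpv : ∀ v, r v ≠ v → p v ≠ v := by
    intro v hv hp
    have := (hl v hv).2.1
    rw [hp] at this
    exact lt_irrefl _ this
  -- On active slots the height is the distance to the root, so a link involves only its vertex and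
  -- a lower one. In an inactive slot the image is above the position and is therefore summed first,
  -- against the normalised square.
  refine sum_prod_le_of_height (fun v => if slotOf v ∈ activeSlots ρ τ e then
    (slotGraph m ρ τ).dist v (r v) else Sum.elim (fun _ => 1) (fun _ => 0) v) (fun v z =>
      if slotOf v ∈ activeSlots ρ τ e then
      (if r v = v then (if slotOf v ∈ e then (if z v ∈ E then 1 else 0) else 1)
        else linkWeight A ρ v (p v) (l v) z) else loopWeight A m θ z v) _ ?_ ?_ ?_
  · intro v z
    have := hA.pos
    split_ifs
    · norm_num
    · norm_num
    · norm_num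
    · exact linkWeight_nonneg _ _ _ _ _ _
    · rcases v with s | s
      · simp only [loopWeight, Sum.elim_inl]
        exact div_nonneg (sq_nonneg _) (sum_nonneg fun _ _ => sq_nonneg _)
      · simp only [loopWeight, Sum.elim_inr]
        exact mul_nonneg (by positivity) (sum_nonneg fun _ _ => sq_nonneg _)
  · intro u v z a hvu hle
    by_cases hu : slotOf u ∈ activeSlots ρ τ e
    · rw [if_pos hu, if_pos hu]
      by_cases hru : r u = u
      · rw [if_pos hru, if_pos hru, Function.update_of_ne hvu.symm]
      · rw [if_neg hru, if_neg hru]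
        obtain ⟨h1, h2, h3⟩ := hl u hru
        refine linkWeight_congr h1 (Function.update_of_ne hvu.symm _ _)
          (Function.update_of_ne ?_ _ _)
        rintro rfl
        rw [if_pos hu, if_pos ((slotOf_mem_activeSlots_iff h3).1 hu)] at hle
        omega
    · rw [if_neg hu, if_neg hu]
      rw [if_neg hu] at hle
      rcases u with s | s
      · have hvs : v ≠ Sum.inr s := by
          rintro rfl
          rw [if_neg (show slotOf (Sum.inr s : ι ⊕ ι) ∉ activeSlots ρ τ e from hu)] at hle
          simp at hle
        simp only [loopWeight, Sum.elim_inl, Function.update_of_ne hvu.symm,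
          Function.update_of_ne hvs.symm]
      · simp only [loopWeight, Sum.elim_inr, Function.update_of_ne hvu.symm]
  · intro v z
    split_ifs with h1 h2 h3
    · simp
    · simp
    · exact sum_linkWeight_le hA (hl v h2).1 (hpv v h2) z
    · rcases v with s | s
      · simp only [loopWeight, Sum.elim_inl, Function.update_self,
          Function.update_of_ne (Sum.inr_ne_inl : (Sum.inr s : ι ⊕ ι) ≠ Sum.inl s), ← sum_div]
        exact div_self_le_one _
      · simp only [loopWeight, Sum.elim_inr, Function.update_self, ← mul_sum]
        have h2 : 2 ≤ ∑ i, m s i := h.two_le s (notMem_activeSlots.1 h1).1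
        have := hA.pos
        calc θ ^ (∑ i, m s i - 2) * ∑ x, ∑ y, A y x ^ 2
            ≤ θ ^ (∑ i, m s i - 2) * (Fintype.card α * θ ^ 2) := by gcongr; exact hA.sq
          _ = Fintype.card α * θ ^ (∑ i, m s i - 2 + 2) := by rw [pow_add]; ring
          _ = _ := by rw [Nat.sub_add_cancel h2]

lemma slotSum_le_prod [Nonempty α] {A : Matrix α α ℝ} {E : Finset α} {θ : ℝ}
    (hA : EntryBounds A E θ) (h : IsReduced m ρ τ e) {r : ι ⊕ ι → ι ⊕ ι}
    (hr : IsRooting m ρ τ e r) :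
    slotSum A E m ρ τ e ≤ (∏ s ∈ activeSlots ρ τ e, ∏ i, (θ ^ m s i * θ⁻¹ ^ 2)) *
      ∏ v, (if slotOf v ∈ activeSlots ρ τ e then
      (if r v = v then (if slotOf v ∈ e then (E.card : ℝ) else Fintype.card α) else 2) else
        Sum.elim (fun _ => 1) (fun s => Fintype.card α * θ ^ ∑ i, m s i) v) := by
  choose p l hl using hr.exists_link
  have hθ := hA.pos
  refine le_trans ?_ (mul_le_mul_of_nonneg_left (sum_sum_prod_le hA h hr p l hl)
    (prod_nonneg fun s _ => prod_nonneg fun i _ => by positivity))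
  have hloop : ∀ (z : ι ⊕ ι → α) v, 0 ≤ loopWeight A m θ z v := by
    intro z v
    rcases v with s | s
    · simp only [loopWeight, Sum.elim_inl]
      exact div_nonneg (sq_nonneg _) (sum_nonneg fun _ _ => sq_nonneg _)
    · simp only [loopWeight, Sum.elim_inr]
      exact mul_nonneg (by positivity) (sum_nonneg fun _ _ => sq_nonneg _)
  set C := ∏ s ∈ activeSlots ρ τ e, ∏ i, (θ ^ m s i * θ⁻¹ ^ 2) with hC
  have hC0 : 0 ≤ C := prod_nonneg fun s _ => prod_nonneg fun i _ => by positivity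
  set W : (ι ⊕ ι → α) → ℝ := fun z => ∏ v, (if slotOf v ∈ activeSlots ρ τ e then
      (if r v = v then (if slotOf v ∈ e then (if z v ∈ E then 1 else 0) else 1)
        else linkWeight A ρ v (p v) (l v) z) else loopWeight A m θ z v) with hW
  have hW0 : ∀ z, 0 ≤ W z := by
    intro z
    refine prod_nonneg fun v _ => ?_
    split_ifs
    · norm_num
    · norm_num
    · norm_num
    · exact linkWeight_nonneg _ _ _ _ _ _
    · exact hloop z v
  have hpt : ∀ x y : ι → α, (∀ s, x s ∈ E ↔ s ∈ e) → y ∘ ⇑τ = y →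
      ∏ s, ∏ i, |A (y s) (x (ρ i s))| ^ m s i ≤ C * W (Sum.elim y x) := by
    intro x y hx hy
    rw [hW]
    dsimp only
    rw [prod_ite_mem_slotOf (activeSlots ρ τ e), ← mul_assoc,
      ← prod_mul_prod_compl (activeSlots ρ τ e)]
    refine mul_le_mul ?_ (prod_le_prod (fun s _ => prod_nonneg fun i _ => by positivity)
      fun s hs => prod_inactive_le hA h hx (mem_compl.1 hs))
      (prod_nonneg fun s _ => prod_nonneg fun i _ => by positivity)
      (mul_nonneg hC0 (prod_nonneg fun v _ => ?_))
    · refine (prod_active_le hA h p l hl hx hy).trans (mul_le_mul_of_nonneg_left ?_ hC0)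
      rw [prod_filter]
      refine le_of_eq (prod_congr rfl fun v hv => ?_)
      by_cases hv' : r v = v
      · rw [if_neg (not_not.2 hv'), if_pos hv']
        split_ifs with h1 h2
        · rfl
        · exfalso
          obtain ⟨s, hs⟩ := hr.isRight v
          rw [hv'] at hs
          subst hs
          exact h2 ((hx s).2 h1)
        · rfl
      · rw [if_pos hv', if_neg hv']
    · split_ifs
      · norm_num
      · norm_num
      · norm_num
      · exact linkWeight_nonneg _ _ _ _ _ _
  have e1 : ∑ z, W z = ∑ x : ι → α, ∑ y : ι → α, W (Sum.elim y x) := by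
    rw [sum_comm, ← Fintype.sum_prod_type' (f := fun y x => W (Sum.elim y x))]
    exact Fintype.sum_equiv (Equiv.sumArrowEquivProdArrow ι ι α) _ _ fun z => by
      congr 1
      funext v
      rcases v with v | v <;> rfl
  rw [e1, slotSum, mul_sum]
  refine (sum_le_sum fun x hx => ?_).trans (sum_le_sum_of_subset_of_nonneg (filter_subset _ _)
    fun x _ _ => mul_nonneg hC0 (sum_nonneg fun y _ => hW0 _))
  rw [mul_sum]
  exact (sum_le_sum fun y hy => hpt x y (mem_filter.1 hx).2 (mem_filter.1 hy).2).trans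
    (sum_le_sum_of_subset_of_nonneg (filter_subset _ _) fun y _ _ => mul_nonneg hC0 (hW0 _))

/-- Bound for the sum over positions and images of a reduced family of flows on slots. -/
theorem IsReduced.slotSum_le [Nonempty α] {A : Matrix α α ℝ} {E : Finset α} {θ : ℝ}
    (hA : EntryBounds A E θ) (h : IsReduced m ρ τ e) :
    ∃ a b : ℕ, 3 * a + 2 * b ≤ 2 * (activeSlots ρ τ e).card ∧
      slotSum A E m ρ τ e ≤ θ ^ (∑ s, ∑ i, m s i) *
        (4 * θ⁻¹ ^ (2 * Fintype.card I)) ^ (activeSlots ρ τ e).card *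
        (Fintype.card α : ℝ) ^ (Fintype.card ι - (activeSlots ρ τ e).card) *
        ((Fintype.card α : ℝ) ^ a * (E.card : ℝ) ^ b) := by
  obtain ⟨r, hr⟩ := h.exists_rooting
  -- `a` and `b` count the active roots outside and inside `e`, which cost a free sum over `α` or
  -- over `E`. Every other active vertex costs a row or column sum or an equality, at most 2, and
  -- there are at most two such vertices per active slot: hence the 4.
  refine ⟨_, _, h.card_activeRoots_le hr, (slotSum_le_prod hA h hr).trans ?_⟩
  set D := activeSlots ρ τ e with hD
  have hθ := hA.pos
  have h1 : ∏ s ∈ D, ∏ i, (θ ^ m s i * θ⁻¹ ^ 2) =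
      (∏ s ∈ D, θ ^ ∑ i, m s i) * (θ⁻¹ ^ (2 * Fintype.card I)) ^ D.card := by
    have : ∀ s, ∏ i, (θ ^ m s i * θ⁻¹ ^ 2) =
        θ ^ (∑ i, m s i) * θ⁻¹ ^ (2 * Fintype.card I) := by
      intro s
      rw [prod_mul_distrib, prod_pow_eq_pow_sum, prod_const, card_univ, ← pow_mul]
    rw [prod_congr rfl fun s _ => this s, prod_mul_distrib, prod_const]
  have h2 : ∏ v ∈ univ.filter (fun v => slotOf v ∈ D), (if r v = v then
        (if slotOf v ∈ e then (E.card : ℝ) else Fintype.card α) else 2) ≤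
      (Fintype.card α : ℝ) ^ ((activeRoots ρ τ e r).filter fun v => slotOf v ∉ e).card *
        (E.card : ℝ) ^ ((activeRoots ρ τ e r).filter fun v => slotOf v ∈ e).card * 4 ^ D.card := by
    rw [prod_ite, prod_ite, prod_const, prod_const, prod_const]
    have e1 : (univ.filter fun v => slotOf v ∈ D).filter (fun v => r v = v) =
      activeRoots ρ τ e r := rfl
    rw [e1, mul_comm ((E.card : ℝ) ^ _)]
    gcongr
    calc (2 : ℝ) ^ ((univ.filter fun v => slotOf v ∈ D).filter (fun v => ¬ r v = v)).card
        ≤ 2 ^ (2 * D.card) := by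
          refine pow_le_pow_right₀ (by norm_num) ?_
          rw [← card_activeVertices (ρ := ρ) (τ := τ) (e := e)]
          exact card_le_card (filter_subset _ _)
      _ = 4 ^ D.card := by rw [pow_mul]; norm_num
  have h3 : ∏ s ∈ Dᶜ, ((Sum.elim (fun _ => (1 : ℝ)) (fun s => Fintype.card α * θ ^ ∑ i, m s i)
        (Sum.inl s : ι ⊕ ι)) * (Sum.elim (fun _ => (1 : ℝ))
        (fun s => Fintype.card α * θ ^ ∑ i, m s i) (Sum.inr s : ι ⊕ ι))) =
      (Fintype.card α : ℝ) ^ (Fintype.card ι - D.card) * ∏ s ∈ Dᶜ, θ ^ ∑ i, m s i := by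
    simp only [Sum.elim_inl, Sum.elim_inr, one_mul]
    rw [prod_mul_distrib, prod_const, card_compl]
  have h4 : θ ^ (∑ s, ∑ i, m s i) =
      (∏ s ∈ D, θ ^ ∑ i, m s i) * ∏ s ∈ Dᶜ, θ ^ ∑ i, m s i := by
    rw [prod_mul_prod_compl, prod_pow_eq_pow_sum]
  rw [prod_ite_mem_slotOf D, h1, h3, h4, mul_pow]
  have p1 : 0 ≤ ∏ s ∈ D, θ ^ ∑ i, m s i := prod_nonneg fun s _ => by positivity
  have p2 : 0 ≤ ∏ s ∈ Dᶜ, θ ^ ∑ i, m s i := prod_nonneg fun s _ => by positivity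
  calc _ ≤ ((∏ s ∈ D, θ ^ ∑ i, m s i) * (θ⁻¹ ^ (2 * Fintype.card I)) ^ D.card) *
        (((Fintype.card α : ℝ) ^ ((activeRoots ρ τ e r).filter fun v => slotOf v ∉ e).card *
        (E.card : ℝ) ^ ((activeRoots ρ τ e r).filter fun v => slotOf v ∈ e).card * 4 ^ D.card) *
        ((Fintype.card α : ℝ) ^ (Fintype.card ι - D.card) * ∏ s ∈ Dᶜ, θ ^ ∑ i, m s i)) := by
        gcongr
    _ = _ := by ring

end

end

/-! ### Relabelling of the positions and counting of slot families -/

section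

variable {α ι I T : Type*} [Fintype α] [DecidableEq α] [Fintype ι] [DecidableEq ι] [Fintype I]
  [DecidableEq I] [DecidableEq T]

/-- The family `(m, ρ, e')` arises from `(m, π, e)` by relabelling the positions by `φ`. -/
structure IsRelabelling (m : ι → I → ℕ) (π : I → Equiv.Perm ι) (e : Finset ι)
    (φ : Equiv.Perm ι) (ρ : I → Equiv.Perm ι) (e' : Finset ι) : Prop where
  map_eq : ∀ s, m (φ s) = m s
  fix : ∀ s i, m s i = 0 → ρ i s = s
  apply_eq : ∀ s i, 0 < m s i → φ (ρ i s) = π i s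
  mem_iff : ∀ s, s ∈ e' ↔ φ s ∈ e

section

variable {m : ι → I → ℕ} {π ρ : I → Equiv.Perm ι} {τ φ : Equiv.Perm ι} {e e' : Finset ι}

lemma IsRelabelling.isSlotFlow (h : IsRelabelling m π e φ ρ e') (hπ : IsSlotFlow m π τ e) :
    IsSlotFlow m ρ τ e' where
  map_eq s i := by
    rcases Nat.eq_zero_or_pos (m s i) with h0 | h0
    · rw [h.fix s i h0]
    · rw [← h.map_eq, h.apply_eq s i h0, hπ.map_eq]
  fix := h.fix
  pos := hπ.pos
  le_one s hs i := by
    rw [← h.map_eq]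
    exact hπ.le_one _ ((h.mem_iff s).1 hs) i
  two_le := hπ.two_le

lemma IsRelabelling.slotSum_eq (h : IsRelabelling m π e φ ρ e') (A : Matrix α α ℝ)
    (E : Finset α) : slotSum A E m π τ e = slotSum A E m ρ τ e' := by
  rw [slotSum, slotSum]
  refine sum_bij' (fun x _ => x ∘ ⇑φ) (fun x _ => x ∘ ⇑φ.symm) ?_ ?_ ?_ ?_ ?_
  · intro x hx
    simp only [mem_filter, mem_univ, true_and, Function.comp_apply] at hx ⊢
    intro s
    rw [hx, h.mem_iff]
  · intro x hx
    simp only [mem_filter, mem_univ, true_and, Function.comp_apply] at hx ⊢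
    intro s
    rw [hx, h.mem_iff, Equiv.apply_symm_apply]
  · intro x _; funext s; simp
  · intro x _; funext s; simp
  · intro x _
    refine sum_congr rfl fun y _ => prod_congr rfl fun s _ => prod_congr rfl fun i _ => ?_
    rcases Nat.eq_zero_or_pos (m s i) with h0 | h0
    · rw [h0, pow_zero, pow_zero]
    · rw [Function.comp_apply, h.apply_eq s i h0]

/-- Applied to an isolated pair `s`, `s'`, exchanging the two positions turns the entries from `s`
to `s'` into loops at `s`. Flows with `m s i = 0` vanish at both slots and are left alone. -/
lemma IsRelabelling.swap (h : IsRelabelling m π e φ ρ e') {s s' : ι} (hs : m s = m s')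
    (hρ : ∀ t i, m (ρ i t) i = m t i) :
    IsRelabelling m π e (φ * Equiv.swap s s')
      (fun i => if m s i = 0 then ρ i else Equiv.swap s s' * ρ i)
      (e'.image (Equiv.swap s s')) := by
  have hsw : ∀ t, m (Equiv.swap s s' t) = m t := by
    intro t
    rcases eq_or_ne t s with rfl | h1
    · rw [Equiv.swap_apply_left, hs]
    rcases eq_or_ne t s' with rfl | h2
    · rw [Equiv.swap_apply_right, hs]
    rw [Equiv.swap_apply_of_ne_of_ne h1 h2]
  refine ⟨fun t => ?_, fun t i h0 => ?_, fun t i h0 => ?_, fun t => ?_⟩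
  · rw [Equiv.Perm.mul_apply, h.map_eq, hsw]
  · split_ifs with hc
    · exact h.fix t i h0
    · rw [Equiv.Perm.mul_apply, h.fix t i h0, Equiv.swap_apply_of_ne_of_ne]
      · rintro rfl; exact hc h0
      · rintro rfl; rw [hs] at hc; exact hc h0
  · split_ifs with hc
    · rw [Equiv.Perm.mul_apply, Equiv.swap_apply_of_ne_of_ne, h.apply_eq t i h0]
      · intro h1
        have := hρ t i
        rw [h1] at this; omega
      · intro h1
        have := hρ t i
        rw [h1, ← hs] at this; omega
    · rw [Equiv.Perm.mul_apply, Equiv.Perm.mul_apply, Equiv.swap_apply_self, h.apply_eq t i h0]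
  · rw [Equiv.Perm.mul_apply, ← h.mem_iff, mem_image]
    constructor
    · rintro ⟨u, hu, rfl⟩
      rwa [Equiv.swap_apply_self]
    · intro hu
      exact ⟨_, hu, Equiv.swap_apply_self _ _ _⟩

/-- A relabelling with the fewest active slots is reduced: an isolated pair could be swapped into a
loop, which makes one slot inactive and activates none. -/
lemma IsSlotFlow.exists_isReduced (hπ : IsSlotFlow m π τ e) :
    ∃ φ ρ e', IsRelabelling m π e φ ρ e' ∧ IsReduced m ρ τ e' := by
  classical
  let F : Finset (Equiv.Perm ι × (I → Equiv.Perm ι) × Finset ι) :=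
    univ.filter fun c => IsRelabelling m π e c.1 c.2.1 c.2.2
  have hF : F.Nonempty := ⟨(1, π, e), by
    simp only [F, mem_filter, mem_univ, true_and]
    exact ⟨fun _ => rfl, hπ.fix, fun _ _ _ => rfl, fun _ => Iff.rfl⟩⟩
  obtain ⟨⟨φ, ρ, e'⟩, hc, hmin⟩ :=
    exists_min_image F (fun c => (activeSlots c.2.1 τ c.2.2).card) hF
  have h : IsRelabelling m π e φ ρ e' := (mem_filter.1 hc).2
  have hρ := h.isSlotFlow hπ
  refine ⟨φ, ρ, e', h, ⟨hρ, fun s s' hs' hτ h1 h2 => ?_⟩⟩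
  by_contra hne
  have hms : m s = m s' := by
    funext i
    rcases Nat.eq_zero_or_pos (m s i) with h0 | h0
    · rcases Nat.eq_zero_or_pos (m s' i) with h0' | h0'
      · rw [h0, h0']
      · have h3 : 0 < m ((ρ i).symm s') i := by
          rw [← hρ.map_eq, Equiv.apply_symm_apply]; exact h0'
        have h4 := h2 i _ h3 (Equiv.apply_symm_apply _ _)
        rw [h4] at h3; omega
    · rw [← hρ.map_eq s i, h1 i h0]
  obtain ⟨i₀, hi₀⟩ := hρ.pos s
  have hsw := h.swap hms hρ.map_eq
  have hle := hmin (_, _, _) (by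
    simp only [F, mem_filter, mem_univ, true_and]
    exact hsw)
  refine absurd hle (not_le.2 (card_lt_card ?_))
  refine Finset.ssubset_iff_subset_ne.2 ⟨fun t => ?_, fun heq => ?_⟩
  · contrapose
    intro ht
    obtain ⟨t1, t2, t3⟩ := notMem_activeSlots.1 ht
    have hts : t ≠ s := by
      rintro rfl
      exact hne ((t3 i₀).symm.trans (h1 i₀ hi₀))
    have hts' : t ≠ s' := by
      rintro rfl
      exact hne ((ρ i₀).injective ((h1 i₀ hi₀).trans (t3 i₀).symm))
    have hswt := Equiv.swap_apply_of_ne_of_ne hts hts'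
    refine notMem_activeSlots.2 ⟨t1, ?_, fun i => ?_⟩
    · rw [mem_image]
      rintro ⟨u, hu, hut⟩
      rw [Equiv.swap_apply_eq_iff, hswt] at hut
      rw [hut] at hu
      exact t2 hu
    · dsimp only
      split_ifs
      · exact t3 i
      · rw [Equiv.Perm.mul_apply, t3 i, hswt]
  · have hs : s ∈ activeSlots ρ τ e' := by
      by_contra hs
      exact hne (((notMem_activeSlots.1 hs).2.2 i₀).symm.trans (h1 i₀ hi₀))
    dsimp only at heq
    rw [← heq] at hs
    refine (notMem_activeSlots.2 ⟨hτ, ?_, fun i => ?_⟩) hs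
    · rw [mem_image]
      rintro ⟨u, hu, hut⟩
      rw [Equiv.swap_apply_eq_iff, Equiv.swap_apply_left] at hut
      rw [hut] at hu
      exact hs' hu
    · split_ifs with h0
      · exact hρ.fix s i h0
      · rw [Equiv.Perm.mul_apply, h1 i (Nat.pos_of_ne_zero h0), Equiv.swap_apply_right]

end

lemma exists_perm_of_map_univ_eq {f g : ι → T}
    (h : Multiset.map f univ.val = Multiset.map g univ.val) : ∃ ψ : Equiv.Perm ι, g ∘ ⇑ψ = f := by
  have hc : ∀ t, Fintype.card {s // f s = t} = Fintype.card {s // g s = t} := by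
    intro t
    have := congrArg (Multiset.count t) h
    rw [Multiset.count_map, Multiset.count_map] at this
    rw [Fintype.card_subtype, Fintype.card_subtype, card_def, card_def, filter_val, filter_val]
    simpa only [eq_comm] using this
  have F : ∀ t, {s // f s = t} ≃ {s // g s = t} := fun t => Fintype.equivOfCardEq (hc t)
  refine ⟨(Equiv.sigmaFiberEquiv f).symm.trans
    ((Equiv.sigmaCongrRight F).trans (Equiv.sigmaFiberEquiv g)), ?_⟩
  funext s
  simp only [Function.comp_apply, Equiv.trans_apply]
  exact (F (f s) ⟨s, rfl⟩).2

/-- The number of pairs of a colouring and a permutation preserving it is at most the number of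
colourings up to permutation times `b!`. -/
lemma card_stabilizer_pairs_le (M : Finset (ι → T)) :
    ((M ×ˢ (univ : Finset (Equiv.Perm ι))).filter fun p => ∀ s, p.1 (p.2 s) = p.1 s).card ≤
      (M.image fun f => Multiset.map f univ.val).card * (Fintype.card ι).factorial := by
  classical
  rcases isEmpty_or_nonempty (ι → T) with hem | hne
  · rw [eq_empty_of_isEmpty M]; simp
  have hrep : ∀ u : Multiset T, ∃ g : ι → T, ∀ f : ι → T, Multiset.map f univ.val = u →
      Multiset.map g univ.val = u := by
    intro u
    by_cases hu : ∃ f : ι → T, Multiset.map f univ.val = u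
    · obtain ⟨f, hf⟩ := hu
      exact ⟨f, fun _ _ => hf⟩
    · exact ⟨hne.some, fun f hf => absurd ⟨f, hf⟩ hu⟩
  choose R hR using hrep
  choose ψ hψ using fun f : ι → T => exists_perm_of_map_univ_eq (hR _ f rfl).symm
  have : (Fintype.card ι).factorial = (univ : Finset (Equiv.Perm ι)).card := by
    rw [card_univ, Fintype.card_perm]
  rw [this, ← card_product]
  -- `R` picks one colouring per multiset and `ψ f` carries it to `f`. Since `f ∘ φ = f`, the
  -- multiset and `ψ f * φ` recover `f`, and then `φ`.
  refine card_le_card_of_injOn (fun p => (Multiset.map p.1 univ.val, ψ p.1 * p.2)) ?_ ?_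
  · intro p hp
    have hp' := (mem_filter.1 hp).1
    simp only [coe_product, Set.mem_prod, mem_coe, mem_univ, and_true]
    exact mem_image_of_mem _ (mem_product.1 hp').1
  · rintro ⟨f, φ⟩ hf ⟨f', φ'⟩ hf' heq
    simp only [Prod.mk.injEq] at heq
    have key : ∀ f φ, (∀ s, f (φ s) = f s) → f = R (Multiset.map f univ.val) ∘ ⇑(ψ f * φ) := by
      intro f φ h
      funext s
      rw [Equiv.Perm.coe_mul, ← Function.comp_assoc, hψ, Function.comp_apply, h]
    have e1 : f = f' := by
      rw [key f φ (mem_filter.1 hf).2, key f' φ' (mem_filter.1 hf').2, heq.1, heq.2]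
    subst e1
    rw [mul_left_cancel heq.2]

lemma card_filter_fixes_compl_pi (D : Finset ι) :
    ((univ : Finset (I → Equiv.Perm ι)).filter fun ρ => ∀ i s, s ∉ D → ρ i s = s).card =
      D.card.factorial ^ Fintype.card I := by
  have : ((univ : Finset (I → Equiv.Perm ι)).filter fun ρ => ∀ i s, s ∉ D → ρ i s = s) =
      Fintype.piFinset fun _ : I => univ.filter fun π : Equiv.Perm ι => ∀ x, x ∉ D → π x = x := by
    ext ρ
    simp [Fintype.mem_piFinset]
  rw [this, Fintype.card_piFinset, prod_const, card_perm_fixes_compl, card_univ]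

/-- Families of permutations with a given number of active slots. -/
lemma sum_card_activeSlots_le (F : ℕ → ℝ) (hF : ∀ q, 0 ≤ F q) :
    ∑ c : (I → Equiv.Perm ι) × Equiv.Perm ι × Finset ι, F (activeSlots c.1 c.2.1 c.2.2).card ≤
      ∑ q ∈ range (Fintype.card ι + 1), ((Fintype.card ι).choose q *
        (q.factorial ^ Fintype.card I * (q.factorial * 2 ^ q)) : ℕ) * F q := by
  -- Outside the active set `D` everything is trivial: `τ` and the `ρ i` are permutations of `D`,
  -- and `e` is a subset of it.
  have h1 : ∀ D : Finset ι, ((univ : Finset ((I → Equiv.Perm ι) × Equiv.Perm ι × Finset ι)).filter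
      fun c => activeSlots c.1 c.2.1 c.2.2 = D).card ≤
      D.card.factorial ^ Fintype.card I * (D.card.factorial * 2 ^ D.card) := by
    intro D
    rw [← card_filter_fixes_compl_pi (I := I), ← card_perm_fixes_compl, ← card_powerset,
      ← card_product, ← card_product]
    refine card_le_card fun c hc => ?_
    obtain ⟨ρ, τ, e⟩ := c
    have hD : activeSlots ρ τ e = D := (mem_filter.1 hc).2
    have h : ∀ s, s ∉ D → τ s = s ∧ s ∉ e ∧ ∀ i, ρ i s = s := by
      intro s hs
      rw [← hD] at hs
      exact notMem_activeSlots.1 hs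
    simp only [mem_product, mem_filter, mem_univ, true_and, mem_powerset]
    refine ⟨fun i s hs => (h s hs).2.2 i, fun s hs => (h s hs).1, fun s hs => ?_⟩
    by_contra hs'
    exact (h s hs').2.1 hs
  rw [← sum_fiberwise univ fun c : (I → Equiv.Perm ι) × Equiv.Perm ι × Finset ι =>
    activeSlots c.1 c.2.1 c.2.2]
  calc _ ≤ ∑ D : Finset ι, ((D.card.factorial ^ Fintype.card I *
        (D.card.factorial * 2 ^ D.card) : ℕ) : ℝ) * F D.card := by
        refine sum_le_sum fun D _ => ?_
        rw [sum_congr rfl fun c hc => by rw [(mem_filter.1 hc).2], sum_const, nsmul_eq_mul]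
        exact mul_le_mul_of_nonneg_right (by exact_mod_cast h1 D) (hF _)
    _ = _ := by
        rw [← powerset_univ, sum_powerset_apply_card (fun q =>
          ((q.factorial ^ Fintype.card I * (q.factorial * 2 ^ q) : ℕ) : ℝ) * F q), card_univ]
        refine sum_congr rfl fun q _ => ?_
        rw [nsmul_eq_mul]
        push_cast
        ring

/-- Summation of the slot sums over a set of families of flows on slots: after relabelling, the
slot sums depend on the multiplicities only through the stabilizers. -/
theorem sum_slotSum_le (A : Matrix α α ℝ) (E : Finset α) (F : ℕ → ℝ) (hF : ∀ q, 0 ≤ F q)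
    (M : Finset (ι → I → ℕ))
    (S : Finset ((ι → I → ℕ) × (I → Equiv.Perm ι) × Equiv.Perm ι × Finset ι))
    (hM : ∀ c ∈ S, c.1 ∈ M) (hS : ∀ c ∈ S, IsSlotFlow c.1 c.2.1 c.2.2.1 c.2.2.2)
    (hSF : ∀ c ∈ S, ∀ φ ρ e', IsRelabelling c.1 c.2.1 c.2.2.2 φ ρ e' →
      IsReduced c.1 ρ c.2.2.1 e' →
      slotSum A E c.1 ρ c.2.2.1 e' ≤ F (activeSlots ρ c.2.2.1 e').card) :
    ∑ c ∈ S, slotSum A E c.1 c.2.1 c.2.2.1 c.2.2.2 ≤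
      ((M.image fun f => Multiset.map f univ.val).card * (Fintype.card ι).factorial : ℕ) *
        ∑ q ∈ range (Fintype.card ι + 1), ((Fintype.card ι).choose q *
          (q.factorial ^ Fintype.card I * (q.factorial * 2 ^ q)) : ℕ) * F q := by
  have hex : ∀ c : (ι → I → ℕ) × (I → Equiv.Perm ι) × Equiv.Perm ι × Finset ι, ∃ φ ρ e', c ∈ S →
      IsRelabelling c.1 c.2.1 c.2.2.2 φ ρ e' ∧ IsReduced c.1 ρ c.2.2.1 e' := by
    intro c
    by_cases hc : c ∈ S
    · obtain ⟨φ, ρ, e', h⟩ := (hS c hc).exists_isReduced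
      exact ⟨φ, ρ, e', fun _ => h⟩
    · exact ⟨1, 1, ∅, fun h => absurd h hc⟩
  choose φ ρ e' h using hex
  let Z := (M ×ˢ (univ : Finset (Equiv.Perm ι))).filter fun p => ∀ s, p.1 (p.2 s) = p.1 s
  -- A family is encoded without loss by a pair `(m, φ)` with `φ` preserving `m`, and by reduced
  -- data `(ρ, τ, e')` whose bound depends only on the number of active slots. The two parts are
  -- then counted independently.
  let g : ((ι → I → ℕ) × (I → Equiv.Perm ι) × Equiv.Perm ι × Finset ι) →
      ((ι → I → ℕ) × Equiv.Perm ι) × ((I → Equiv.Perm ι) × Equiv.Perm ι × Finset ι) :=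
    fun c => ((c.1, φ c), (ρ c, c.2.2.1, e' c))
  have hg : Set.InjOn g S := by
    rintro ⟨m, π, τ, e⟩ hc ⟨m₂, π₂, τ₂, e₂⟩ hc₂ heq
    have H := (h _ hc).1
    have H₂ := (h _ hc₂).1
    simp only [g, Prod.mk.injEq] at heq
    obtain ⟨⟨rfl, hφ⟩, hρ, rfl, he⟩ := heq
    have hπ : π = π₂ := by
      funext i
      ext s
      rcases Nat.eq_zero_or_pos (m s i) with h0 | h0
      · rw [(hS _ hc).fix s i h0, (hS _ hc₂).fix s i h0]
      · rw [← H.apply_eq s i h0, ← H₂.apply_eq s i h0, hφ, hρ]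
    have hee : e = e₂ := by
      ext s
      have a1 := H.mem_iff ((φ (m, π, τ, e)).symm s)
      have a2 := H₂.mem_iff ((φ (m, π, τ, e)).symm s)
      rw [← hφ, ← he, Equiv.apply_symm_apply] at a2
      rw [Equiv.apply_symm_apply] at a1
      exact a1.symm.trans a2
    subst hπ hee
    rfl
  have hmem : ∀ c ∈ S, g c ∈ Z ×ˢ (univ : Finset ((I → Equiv.Perm ι) × Equiv.Perm ι × Finset ι)) := by
    intro c hc
    simp only [g, Z, mem_product, mem_filter, mem_univ, and_true]
    exact ⟨hM c hc, (h c hc).1.map_eq⟩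
  classical
  calc ∑ c ∈ S, slotSum A E c.1 c.2.1 c.2.2.1 c.2.2.2
      ≤ ∑ c ∈ S, F (activeSlots (g c).2.1 (g c).2.2.1 (g c).2.2.2).card := by
        refine sum_le_sum fun c hc => ?_
        rw [(h c hc).1.slotSum_eq]
        exact hSF c hc _ _ _ (h c hc).1 (h c hc).2
    _ = ∑ c ∈ S.image g, F (activeSlots c.2.1 c.2.2.1 c.2.2.2).card :=
        (sum_image (f := fun c => F (activeSlots c.2.1 c.2.2.1 c.2.2.2).card) hg).symm
    _ ≤ ∑ c ∈ Z ×ˢ (univ : Finset ((I → Equiv.Perm ι) × Equiv.Perm ι × Finset ι)),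
        F (activeSlots c.2.1 c.2.2.1 c.2.2.2).card := by
        refine sum_le_sum_of_subset_of_nonneg ?_ fun _ _ _ => hF _
        intro c hc
        obtain ⟨c', hc', rfl⟩ := mem_image.1 hc
        exact hmem c' hc'
    _ = (Z.card : ℝ) * ∑ c : (I → Equiv.Perm ι) × Equiv.Perm ι × Finset ι,
        F (activeSlots c.1 c.2.1 c.2.2).card := by
        rw [sum_product]
        dsimp only
        rw [sum_const, nsmul_eq_mul]
    _ ≤ _ := by
        refine mul_le_mul ?_ (sum_card_activeSlots_le F hF) (sum_nonneg fun _ _ => hF _)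
          (Nat.cast_nonneg _)
        exact_mod_cast card_stabilizer_pairs_le M

end

/-! ### From flows on the vertices to flows on slots -/

section

variable {α ι I : Type*} [Fintype α] [DecidableEq α] [Fintype ι] [DecidableEq ι] [Fintype I]
  [DecidableEq I]

/-- The points at which some member of a family of flows is positive. -/
def familySupport (f : I → FlowData α) : Finset α := univ.filter fun a => ∃ i, 0 < (f i).1 a

/-- The multiplicities `m` and permutations `π` are those of the family `f` read along the
enumeration `x` of its support; `e` records the elements of `E`. -/
structure IsPullback (E : Finset α) (f : I → FlowData α) (x : ι ↪ α) (m : ι → I → ℕ)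
    (π : I → Equiv.Perm ι) (e : Finset ι) : Prop where
  support : ∀ a, (∃ i, 0 < (f i).1 a) ↔ ∃ s, x s = a
  mult : ∀ s i, m s i = (f i).1 (x s)
  apply_eq : ∀ s i, x (π i s) = (f i).2 (x s)
  mem_iff : ∀ s, s ∈ e ↔ x s ∈ E

lemma exists_isPullback {E : Finset α} {f : I → FlowData α} (hf : ∀ i, IsFlow (f i)) (x : ι ↪ α)
    (hx : ∀ a, (∃ i, 0 < (f i).1 a) ↔ ∃ s, x s = a) : ∃ m π e, IsPullback E f x m π e := by
  have h : ∀ i s, ∃ t, x t = (f i).2 (x s) := by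
    intro i s
    rcases Nat.eq_zero_or_pos ((f i).1 (x s)) with h0 | h0
    · exact ⟨s, ((hf i).2 _ h0).symm⟩
    · exact (hx _).1 ⟨i, by rw [(hf i).1]; exact h0⟩
  choose t ht using h
  have hinj : ∀ i, Function.Injective (t i) := by
    intro i a b hab
    have := congrArg x hab
    rw [ht, ht] at this
    exact x.injective ((f i).2.injective this)
  refine ⟨fun s i => (f i).1 (x s), fun i => permOf (t i), univ.filter fun s => x s ∈ E,
    ⟨hx, fun _ _ => rfl, fun s i => ?_, fun s => by simp⟩⟩
  rw [permOf_apply (hinj i), ht]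

section

variable {A : Matrix α α ℝ} {E : Finset α} {f : I → FlowData α} {x : ι ↪ α} {m : ι → I → ℕ}
  {π : I → Equiv.Perm ι} {e : Finset ι}

lemma IsPullback.prod_flowWeight_eq (h : IsPullback E f x m π e) (P : Matrix α α ℝ) :
    ∏ i, flowWeight P (f i) = ∏ s, ∏ i, P (x s) (x (π i s)) ^ m s i := by
  have h1 : ∏ i, flowWeight P (f i) = ∏ a, ∏ i, P a ((f i).2 a) ^ (f i).1 a := by
    simp only [flowWeight]
    rw [prod_comm]
  rw [h1, ← prod_subset (subset_univ (univ.map x))]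
  · rw [prod_map]
    refine prod_congr rfl fun s _ => prod_congr rfl fun i _ => ?_
    rw [h.apply_eq, h.mult]
  · intro a _ ha
    refine prod_eq_one fun i _ => ?_
    have : (f i).1 a = 0 := by
      by_contra h0
      obtain ⟨s, hs⟩ := (h.support a).1 ⟨i, Nat.pos_of_ne_zero h0⟩
      exact ha (mem_map.2 ⟨s, mem_univ _, hs⟩)
    rw [this, pow_zero]

/-- A slot of total multiplicity one carries a single entry, whose sum over the rows is zero; hence
it is a centred factor and must be moved by `τ`. -/
lemma IsPullback.abs_permMean_le [Nonempty α] (h : IsPullback E f x m π e)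
    (hA : ∀ a, ∑ b, A b a = 0) :
    |permMean fun σ : Equiv.Perm α => ∏ i, flowWeight (A.submatrix ⇑σ id) (f i)| ≤
      (∑ τ : Equiv.Perm ι with ∀ s, τ s = s → 2 ≤ ∑ i, m s i,
        ∑ y : ι → α with (y ∘ ⇑τ = y), ∏ s, ∏ i, |A (y s) (x (π i s))| ^ m s i) /
        ((Fintype.card α).descFactorial (Fintype.card ι)) := by
  simp only [h.prod_flowWeight_eq, Matrix.submatrix_apply, id]
  refine (abs_permMean_prod_le x (fun s a => ∏ i, A a (x (π i s)) ^ m s i)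
    (fun s => 2 ≤ ∑ i, m s i) ?_).trans ?_
  · intro s hs
    obtain ⟨i, hi⟩ : ∃ i, 0 < m s i := by
      obtain ⟨i, hi⟩ := (h.support (x s)).2 ⟨s, rfl⟩
      exact ⟨i, by rw [h.mult]; exact hi⟩
    have hsum : m s i + ∑ j ∈ univ.erase i, m s j = ∑ j, m s j :=
      add_sum_erase univ (fun j => m s j) (mem_univ i)
    have hi1 : m s i = 1 := by omega
    have hj : ∀ j ∈ univ.erase i, m s j = 0 := by
      have : ∑ j ∈ univ.erase i, m s j = 0 := by omega
      exact sum_eq_zero_iff.1 this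
    have : ∀ a, ∏ j, A a (x (π j s)) ^ m s j = A a (x (π i s)) := by
      intro a
      rw [← mul_prod_erase univ _ (mem_univ i), hi1, pow_one,
        prod_eq_one fun j hj' => by rw [hj j hj', pow_zero], mul_one]
    simp only [this, hA]
  · simp only [abs_prod, abs_pow]
    exact le_rfl

lemma IsPullback.isSlotFlow (h : IsPullback E f x m π e) (hf : ∀ i, IsFlow (f i))
    (hE : ∀ a ∈ E, ∀ i, (f i).1 a ≤ 1) {τ : Equiv.Perm ι}
    (hτ : ∀ s, τ s = s → 2 ≤ ∑ i, m s i) : IsSlotFlow m π τ e where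
  map_eq s i := by rw [h.mult, h.mult, h.apply_eq, (hf i).1]
  fix s i h0 := by
    apply x.injective
    rw [h.apply_eq, (hf i).2]
    rw [← h.mult, h0]
  pos s := by
    obtain ⟨i, hi⟩ := (h.support (x s)).2 ⟨s, rfl⟩
    exact ⟨i, by rw [h.mult]; exact hi⟩
  le_one s hs i := by
    rw [h.mult]
    exact hE _ ((h.mem_iff s).1 hs) i
  two_le := hτ

lemma IsPullback.family_eq {f' : I → FlowData α} (h : IsPullback E f x m π e)
    (h' : IsPullback E f' x m π e) (hf : ∀ i, IsFlow (f i)) (hf' : ∀ i, IsFlow (f' i)) :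
    f = f' := by
  funext i
  have hz : ∀ a, (¬ ∃ s, x s = a) → (f i).1 a = 0 ∧ (f' i).1 a = 0 := by
    intro a ha
    constructor
    · by_contra h0
      exact ha ((h.support a).1 ⟨i, Nat.pos_of_ne_zero h0⟩)
    · by_contra h0
      exact ha ((h'.support a).1 ⟨i, Nat.pos_of_ne_zero h0⟩)
  refine Prod.ext ?_ ?_
  · funext a
    by_cases ha : ∃ s, x s = a
    · obtain ⟨s, rfl⟩ := ha
      rw [← h.mult, ← h'.mult]
    · rw [(hz a ha).1, (hz a ha).2]
  · ext a
    by_cases ha : ∃ s, x s = a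
    · obtain ⟨s, rfl⟩ := ha
      rw [← h.apply_eq, ← h'.apply_eq]
    · rw [(hf i).2 a (hz a ha).1, (hf' i).2 a (hz a ha).2]

end

/-- Counting every support with all its enumerations gains a factorial, which compensates the one
lost in `card_stabilizer_pairs_le`. -/
lemma factorial_le_card_enumerations (U : Finset α) (hU : U.card = Fintype.card ι) :
    (Fintype.card ι).factorial ≤
      ((univ : Finset (ι ↪ α)).filter fun x => ∀ a, a ∈ U ↔ ∃ s, x s = a).card := by
  have e : ι ≃ U := Fintype.equivOfCardEq (by rw [Fintype.card_coe, hU])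
  rw [← Fintype.card_perm, ← card_univ]
  refine card_le_card_of_injOn
    (fun ψ : Equiv.Perm ι => (ψ.trans e).toEmbedding.trans (Function.Embedding.subtype _)) ?_ ?_
  · intro ψ _
    simp only [coe_filter, mem_univ, true_and, Set.mem_ofPred_eq]
    intro a
    constructor
    · intro ha
      exact ⟨ψ.symm (e.symm ⟨a, ha⟩), by simp⟩
    · rintro ⟨s, rfl⟩
      exact (e (ψ s)).2
  · intro ψ _ ψ' _ h
    ext s
    have := DFunLike.congr_fun h s
    simp only [Function.Embedding.trans_apply, Equiv.coe_toEmbedding, Equiv.trans_apply,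
      Function.Embedding.subtype_apply] at this
    exact e.injective (Subtype.ext this)

lemma sum_le_sum_image_sum {P X C : Type*} [Fintype X] [DecidableEq X] [DecidableEq C]
    (Z : Finset P) (a : P → X) (g : P → C) (G : X → C → ℝ) (hG : ∀ x c, 0 ≤ G x c)
    (hinj : Set.InjOn (fun p => (a p, g p)) Z) (R : X → C → Prop) [∀ x c, Decidable (R x c)]
    (hR : ∀ p ∈ Z, R (a p) (g p)) :
    ∑ p ∈ Z, G (a p) (g p) ≤ ∑ c ∈ Z.image g, ∑ x with R x c, G x c := by
  calc ∑ p ∈ Z, G (a p) (g p)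
      = ∑ q ∈ Z.image (fun p => (a p, g p)), G q.1 q.2 :=
        (sum_image (f := fun q : X × C => G q.1 q.2) hinj).symm
    _ ≤ ∑ q ∈ ((univ : Finset X) ×ˢ Z.image g).filter (fun q => R q.1 q.2), G q.1 q.2 := by
        refine sum_le_sum_of_subset_of_nonneg (fun q hq => ?_) fun _ _ _ => hG _ _
        obtain ⟨p, hp, rfl⟩ := mem_image.1 hq
        simp only [mem_filter, mem_product, mem_univ, true_and]
        exact ⟨mem_image_of_mem g hp, hR p hp⟩
    _ = _ := by
        rw [sum_filter, sum_product_right]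
        refine sum_congr rfl fun c _ => ?_
        rw [← sum_filter]

/-- Passing from families of flows on `α` with support of a given size to families of flows on
slots. -/
theorem exists_slot_families [Nonempty α] {A : Matrix α α ℝ} (hA : ∀ a, ∑ b, A b a = 0)
    (E : Finset α) (S : Finset (I → FlowData α)) (hS : ∀ f ∈ S, ∀ i, IsFlow (f i))
    (hSE : ∀ f ∈ S, ∀ a ∈ E, ∀ i, (f i).1 a ≤ 1)
    (hcard : ∀ f ∈ S, (familySupport f).card = Fintype.card ι) :
    ∃ S' : Finset ((ι → I → ℕ) × (I → Equiv.Perm ι) × Equiv.Perm ι × Finset ι),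
      (∀ c ∈ S', IsSlotFlow c.1 c.2.1 c.2.2.1 c.2.2.2 ∧
        ∃ f ∈ S, ∃ x : ι ↪ α, IsPullback E f x c.1 c.2.1 c.2.2.2) ∧
      (Fintype.card ι).factorial *
        ∑ f ∈ S, |permMean fun σ : Equiv.Perm α => ∏ i, flowWeight (A.submatrix ⇑σ id) (f i)| ≤
        (∑ c ∈ S', slotSum A E c.1 c.2.1 c.2.2.1 c.2.2.2) /
          ((Fintype.card α).descFactorial (Fintype.card ι)) := by
  classical
  have hex : ∀ p : (I → FlowData α) × (ι ↪ α), ∃ (m : ι → I → ℕ) (π : I → Equiv.Perm ι)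
      (e : Finset ι), (p.1 ∈ S ∧ ∀ a, a ∈ familySupport p.1 ↔ ∃ s, p.2 s = a) →
      IsPullback E p.1 p.2 m π e := by
    intro p
    by_cases hp : p.1 ∈ S ∧ ∀ a, a ∈ familySupport p.1 ↔ ∃ s, p.2 s = a
    · obtain ⟨m, π, e, h⟩ := exists_isPullback (E := E) (hS _ hp.1) p.2 (fun a => by
        rw [← hp.2 a, familySupport, mem_filter]; simp)
      exact ⟨m, π, e, fun _ => h⟩
    · exact ⟨fun _ _ => 0, 1, ∅, fun h => absurd h hp⟩
  choose m π e h using hex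
  let Z : Finset (((I → FlowData α) × (ι ↪ α)) × Equiv.Perm ι) :=
    ((S ×ˢ univ) ×ˢ univ).filter fun p =>
      (∀ a, a ∈ familySupport p.1.1 ↔ ∃ s, p.1.2 s = a) ∧
        ∀ s, p.2 s = s → 2 ≤ ∑ i, m p.1 s i
  have hZ : ∀ p ∈ Z, p.1.1 ∈ S ∧ IsPullback E p.1.1 p.1.2 (m p.1) (π p.1) (e p.1) ∧
      ∀ s, p.2 s = s → 2 ≤ ∑ i, m p.1 s i := by
    intro p hp
    simp only [Z, mem_filter, mem_product, mem_univ, and_true] at hp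
    exact ⟨hp.1, h _ ⟨hp.1, hp.2.1⟩, hp.2.2⟩
  let g : (((I → FlowData α) × (ι ↪ α)) × Equiv.Perm ι) →
      ((ι → I → ℕ) × (I → Equiv.Perm ι) × Equiv.Perm ι × Finset ι) :=
    fun p => (m p.1, π p.1, p.2, e p.1)
  let G : (ι → α) → ((ι → I → ℕ) × (I → Equiv.Perm ι) × Equiv.Perm ι × Finset ι) → ℝ :=
    fun x c => ∑ y : ι → α with (y ∘ ⇑c.2.2.1 = y), ∏ s, ∏ i, |A (y s) (x (c.2.1 i s))| ^ c.1 s i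
  have hG : ∀ x c, 0 ≤ G x c := fun x c => sum_nonneg fun y _ => prod_nonneg fun s _ =>
    prod_nonneg fun i _ => by positivity
  refine ⟨Z.image g, ?_, ?_⟩
  · intro c hc
    obtain ⟨p, hp, rfl⟩ := mem_image.1 hc
    obtain ⟨h1, h2, h3⟩ := hZ p hp
    exact ⟨h2.isSlotFlow (hS _ h1) (hSE _ h1) h3, p.1.1, h1, p.1.2, h2⟩
  · set N : ℝ := (((Fintype.card α).descFactorial (Fintype.card ι) : ℕ) : ℝ) with hN
    have hN0 : 0 ≤ N := Nat.cast_nonneg _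
    set w : (I → FlowData α) → ℝ := fun f =>
      |permMean fun σ : Equiv.Perm α => ∏ i, flowWeight (A.submatrix ⇑σ id) (f i)| with hw
    have h1 : (Fintype.card ι).factorial * ∑ f ∈ S, w f ≤
        ∑ p ∈ (S ×ˢ (univ : Finset (ι ↪ α))).filter
          (fun p => ∀ a, a ∈ familySupport p.1 ↔ ∃ s, p.2 s = a), w p.1 := by
      rw [sum_filter, sum_product, mul_sum]
      refine sum_le_sum fun f hf => ?_
      rw [← sum_filter]
      dsimp only
      rw [sum_const, nsmul_eq_mul]
      refine mul_le_mul_of_nonneg_right ?_ (abs_nonneg _)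
      exact_mod_cast factorial_le_card_enumerations _ (hcard f hf)
    have h2 : ∑ p ∈ (S ×ˢ (univ : Finset (ι ↪ α))).filter
          (fun p => ∀ a, a ∈ familySupport p.1 ↔ ∃ s, p.2 s = a), w p.1 ≤
        ∑ p ∈ Z, G p.1.2 (g p) / N := by
      have eR : ∑ p ∈ Z, G p.1.2 (g p) / N = ∑ p ∈ S ×ˢ (univ : Finset (ι ↪ α)),
          ∑ τ : Equiv.Perm ι, if (∀ a, a ∈ familySupport p.1 ↔ ∃ s, p.2 s = a) ∧
            ∀ s, τ s = s → 2 ≤ ∑ i, m p s i then G p.2 (g (p, τ)) / N else 0 := by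
        simp only [Z]
        rw [sum_filter, sum_product]
      rw [eR, sum_filter]
      refine sum_le_sum fun p hp => ?_
      split_ifs with hc
      · refine ((h p ⟨(mem_product.1 hp).1, hc⟩).abs_permMean_le hA).trans (le_of_eq ?_)
        rw [sum_filter, sum_div]
        refine sum_congr rfl fun τ _ => ?_
        simp only [hc, implies_true, true_and]
        split_ifs with h3
        · rfl
        · simp
      · exact sum_nonneg fun τ _ => by
          split_ifs
          · exact div_nonneg (hG _ _) hN0
          · exact le_rfl
    have h3 : ∑ p ∈ Z, G p.1.2 (g p) ≤
        ∑ c ∈ Z.image g, slotSum A E c.1 c.2.1 c.2.2.1 c.2.2.2 := by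
      -- Slot data and enumeration together determine the flows, so the enumerations are absorbed by
      -- the sum over positions in `slotSum`.
      have hinj : Set.InjOn (fun p : ((I → FlowData α) × (ι ↪ α)) × Equiv.Perm ι =>
          ((⟨⇑p.1.2, g p⟩ : (ι → α) × _))) Z := by
        rintro ⟨⟨f, x⟩, τ⟩ hp ⟨⟨f', x'⟩, τ'⟩ hp' heq
        obtain ⟨a1, a2, a3⟩ := hZ _ hp
        obtain ⟨b1, b2, b3⟩ := hZ _ hp'
        simp only [g, Prod.mk.injEq] at heq a2 b2
        obtain ⟨hx, hm, hπ, hτ, he⟩ := heq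
        have hx : x = x' := DFunLike.coe_injective hx
        subst hx
        rw [← hm, ← hπ, ← he] at b2
        rw [a2.family_eq b2 (hS _ a1) (hS _ b1), hτ]
      exact sum_le_sum_image_sum Z (fun p => (⇑p.1.2 : ι → α)) g G hG hinj
        (fun x c => ∀ s, x s ∈ E ↔ s ∈ c.2.2.2)
        (fun p hp s => ((hZ p hp).2.1.mem_iff s).symm)
    rw [← sum_div] at h2
    exact (h1.trans h2).trans (div_le_div_of_nonneg_right h3 hN0)

end

/-! ### Counting multiplicities up to permutation of the slots -/

section

variable {ι T : Type*} [Fintype ι] [DecidableEq ι] [DecidableEq T]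

lemma sum_range_pow_le {y : ℝ} (h0 : 0 ≤ y) (h1 : y < 1) (n : ℕ) :
    ∑ c ∈ range n, y ^ c ≤ (1 - y)⁻¹ := by
  rw [← tsum_geometric_of_lt_one h0 h1]
  exact (summable_geometric_of_lt_one h0 h1).sum_le_tsum _ fun _ _ => by positivity

/-- The number of multisets of total weight `N` is bounded by the generating function. -/
lemma card_multisets_le (W : Finset (Multiset T)) (wt : T → ℕ) (Ty : Finset T) (N : ℕ)
    (hpos : ∀ t ∈ Ty, 1 ≤ wt t) (hW : ∀ u ∈ W, (∀ t ∈ u, t ∈ Ty) ∧ (u.map wt).sum = N)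
    {a : ℝ} (ha : 0 < a) :
    (W.card : ℝ) ≤ Real.exp (a * N) * ∏ t ∈ Ty, (1 - Real.exp (-(a * wt t)))⁻¹ := by
  have hcount : ∀ u ∈ W, ∑ t ∈ Ty, u.count t * wt t = N := by
    intro u hu
    rw [← (hW u hu).2, sum_multiset_map_count]
    simp only [smul_eq_mul]
    refine (sum_subset (fun t ht => (hW u hu).1 t (Multiset.mem_toFinset.1 ht)) ?_).symm
    intro t _ ht
    rw [Multiset.mem_toFinset] at ht
    rw [Multiset.count_eq_zero_of_notMem ht, zero_mul]
  have hle : ∀ u ∈ W, ∀ t ∈ Ty, u.count t < N + 1 := by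
    intro u hu t ht
    have h1 := single_le_sum (f := fun t => u.count t * wt t) (fun _ _ => Nat.zero_le _) ht
    rw [hcount u hu] at h1
    have h2 : u.count t * 1 ≤ u.count t * wt t := Nat.mul_le_mul_left _ (hpos t ht)
    omega
  -- A multiset of total weight `N` has tilted weight exactly 1; releasing the constraint on the
  -- total weight then gives a product of geometric series.
  have hone : ∀ u ∈ W, Real.exp (a * N) * ∏ t : Ty, Real.exp (-(a * wt t)) ^ u.count t.1 = 1 := by
    intro u hu
    rw [prod_coe_sort Ty fun t => Real.exp (-(a * wt t)) ^ u.count t]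
    simp only [← Real.exp_nat_mul]
    rw [← Real.exp_sum, ← Real.exp_add, Real.exp_eq_one_iff]
    have : (N : ℝ) = ∑ t ∈ Ty, (u.count t : ℝ) * wt t := by
      rw [← hcount u hu]; push_cast; rfl
    rw [this, mul_sum, ← sum_add_distrib]
    exact sum_eq_zero fun t _ => by ring
  have hinj : Set.InjOn (fun (u : Multiset T) (t : Ty) => u.count t.1) W := by
    intro u hu v hv h
    ext t
    by_cases ht : t ∈ Ty
    · exact congrFun h ⟨t, ht⟩
    · rw [Multiset.count_eq_zero_of_notMem fun h' => ht ((hW u hu).1 t h'),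
        Multiset.count_eq_zero_of_notMem fun h' => ht ((hW v hv).1 t h')]
  calc (W.card : ℝ) = ∑ u ∈ W, Real.exp (a * N) *
        ∏ t : Ty, Real.exp (-(a * wt t)) ^ u.count t.1 := by
        rw [sum_congr rfl hone]; simp
    _ = Real.exp (a * N) * ∑ c ∈ W.image (fun (u : Multiset T) (t : Ty) => u.count t.1),
        ∏ t : Ty, Real.exp (-(a * wt t)) ^ c t := by
        rw [← mul_sum, sum_image hinj]
    _ ≤ Real.exp (a * N) * ∑ c ∈ Fintype.piFinset (fun _ : Ty => range (N + 1)),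
        ∏ t : Ty, Real.exp (-(a * wt t)) ^ c t := by
        gcongr
        intro c hc
        obtain ⟨u, hu, rfl⟩ := mem_image.1 hc
        rw [Fintype.mem_piFinset]
        exact fun t => mem_range.2 (hle u hu t.1 t.2)
    _ = Real.exp (a * N) * ∏ t : Ty, ∑ c ∈ range (N + 1), Real.exp (-(a * wt t)) ^ c := by
        rw [prod_univ_sum]
    _ ≤ Real.exp (a * N) * ∏ t : Ty, (1 - Real.exp (-(a * wt t)))⁻¹ := by
        gcongr with t _
        refine sum_range_pow_le (Real.exp_pos _).le ?_ _
        rw [Real.exp_lt_one_iff]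
        have := hpos t.1 t.2
        have h1 : (0 : ℝ) < wt t.1 := by exact_mod_cast this
        simp only [Left.neg_neg_iff]
        positivity
    _ = _ := by rw [prod_coe_sort Ty fun t => (1 - Real.exp (-(a * wt t)))⁻¹]

/-- A form of `2 sinh(s/2) ≥ s`. The decay `exp(-s/2)` makes the later sum over slot types converge.
-/
lemma inv_one_sub_exp_neg_le {s : ℝ} (hs : 0 < s) :
    (1 - Real.exp (-s))⁻¹ ≤ Real.exp (Real.exp (-(s / 2)) / s) := by
  have h1 : s ≤ Real.exp (s / 2) - Real.exp (-(s / 2)) := by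
    have := Real.self_le_sinh_iff.2 (by positivity : 0 ≤ s / 2)
    rw [Real.sinh_eq] at this
    linarith
  have hE : 0 < Real.exp (-(s / 2)) := Real.exp_pos _
  have h2 : Real.exp (s / 2) * Real.exp (-(s / 2)) = 1 := by rw [← Real.exp_add]; simp
  have h3 : Real.exp (-s) = Real.exp (-(s / 2)) * Real.exp (-(s / 2)) := by
    rw [← Real.exp_add]; congr 1; ring
  set E := Real.exp (-(s / 2)) with hEdef
  have h4 : 1 - Real.exp (-s) = E * (Real.exp (s / 2) - E) := by rw [h3]; linarith
  have h5 : s * E ≤ 1 - Real.exp (-s) := by rw [h4]; nlinarith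
  have h6 : 0 < 1 - Real.exp (-s) := lt_of_lt_of_le (by positivity) h5
  have h7 : (1 - Real.exp (-s))⁻¹ ≤ 1 + E / s := by
    rw [inv_le_iff_one_le_mul₀ h6]
    have h8 : E * E ≤ E / s * (1 - Real.exp (-s)) := by
      calc E * E = E / s * (s * E) := by field_simp
        _ ≤ _ := by gcongr
    rw [← h3] at h8
    linarith
  linarith [Real.add_one_le_exp (E / s)]

/-- Indices of the four flows in a pair of pairs: the second component tells whether the flow has
multiplicities at most one. -/
abbrev FlowIdx := Bool × Bool

/-- The multiplicities of nonempty slots of total weight `N`. -/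
def multFamilies (ι : Type*) [Fintype ι] [DecidableEq ι] (N : ℕ) : Finset (ι → FlowIdx → ℕ) :=
  (Fintype.piFinset fun _ => Fintype.piFinset fun _ => range (N + 1)).filter fun m =>
    (∀ s, 0 < ∑ i, m s i) ∧ (∑ s, ∑ i, m s i = N) ∧ ∀ s j, m s (j, true) ≤ 1

/-- The possible multiplicities of a slot. -/
def slotTypes (N : ℕ) : Finset (FlowIdx → ℕ) :=
  (Fintype.piFinset fun _ => range (N + 1)).filter fun t =>
    0 < ∑ i, t i ∧ (∑ i, t i ≤ N) ∧ ∀ j, t (j, true) ≤ 1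

/-- Two of the four multiplicities are 0 or 1 and the total is prescribed, so one free multiplicity
remains: the growth is linear in `j`. This gives the exponent 2 of `1/a` in the entropy bound. -/
lemma card_slotTypes_weight_le (N j : ℕ) (hj : 0 < j) :
    ((slotTypes N).filter fun t => ∑ i, t i = j).card ≤ 8 * j := by
  have : ((range 2 ×ˢ range 2) ×ˢ range (j + 1)).card ≤ 8 * j := by
    simp only [card_product, card_range]; omega
  refine le_trans (card_le_card_of_injOn
    (fun t => ((t (false, true), t (true, true)), t (false, false))) ?_ ?_) this
  · intro t ht
    simp only [slotTypes, coe_filter, mem_filter, Set.mem_ofPred_eq, Fintype.sum_prod_type,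
      Fintype.sum_bool] at ht
    have h1 := ht.1.2.2.2 false
    have h2 := ht.1.2.2.2 true
    simp only [coe_product, Set.mem_prod, mem_coe, mem_range]
    omega
  · intro t ht t' ht' h
    simp only [coe_filter, mem_filter, Set.mem_ofPred_eq, Fintype.sum_prod_type,
      Fintype.sum_bool] at ht ht'
    simp only [Prod.mk.injEq] at h
    funext ⟨a, b⟩
    rcases a <;> rcases b
    · exact h.2
    · exact h.1.1
    · omega
    · exact h.1.2

/-- The linear number of types cancels the denominator `a j` up to `8/a`, and the remaining
geometric series is at most `2/a`. -/
lemma sum_slotTypes_le (N : ℕ) {a : ℝ} (ha : 0 < a) :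
    ∑ t ∈ slotTypes N, Real.exp (-(a * (∑ i, t i : ℕ) / 2)) / (a * (∑ i, t i : ℕ)) ≤
      16 / a ^ 2 := by
  have hmaps : ∀ t ∈ slotTypes N, ∑ i, t i ∈ range (N + 1) := by
    intro t ht
    have := (mem_filter.1 ht).2.2.1
    exact mem_range.2 (by omega)
  rw [← sum_fiberwise_of_maps_to hmaps]
  have hE : Real.exp (-(a / 2)) < 1 := by
    rw [Real.exp_lt_one_iff]; linarith
  have h1 : ∀ j ∈ range (N + 1), ∑ t ∈ slotTypes N with ∑ i, t i = j,
      Real.exp (-(a * (∑ i, t i : ℕ) / 2)) / (a * (∑ i, t i : ℕ)) ≤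
      if j = 0 then 0 else 8 / a * Real.exp (-(a / 2)) ^ j := by
    intro j _
    split_ifs with h0
    · subst h0
      refine le_of_eq (sum_eq_zero fun t ht => ?_)
      have h2 := mem_filter.1 ht
      have := (mem_filter.1 h2.1).2.1
      omega
    · have hj : (0 : ℝ) < j := by exact_mod_cast Nat.pos_of_ne_zero h0
      rw [sum_congr rfl fun t ht => by rw [(mem_filter.1 ht).2], sum_const, nsmul_eq_mul]
      have h3 : (((slotTypes N).filter fun t => ∑ i, t i = j).card : ℝ) ≤ 8 * j := by
        exact_mod_cast card_slotTypes_weight_le N j (Nat.pos_of_ne_zero h0)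
      calc _ ≤ 8 * j * (Real.exp (-(a * j / 2)) / (a * j)) := by gcongr
        _ = 8 / a * Real.exp (-(a * j / 2)) := by field_simp
        _ = _ := by rw [← Real.exp_nat_mul]; congr 2; ring
  refine (sum_le_sum h1).trans ?_
  rw [sum_range_succ']
  simp only [Nat.succ_ne_zero, Nat.add_eq_zero_iff, one_ne_zero, and_false, if_false, if_true,
    add_zero]
  have h2 : ∑ j ∈ range N, 8 / a * Real.exp (-(a / 2)) ^ (j + 1) =
      8 / a * Real.exp (-(a / 2)) * ∑ j ∈ range N, Real.exp (-(a / 2)) ^ j := by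
    rw [mul_sum]; exact sum_congr rfl fun j _ => by ring
  rw [h2]
  have h3 : Real.exp (-(a / 2)) * (1 - Real.exp (-(a / 2)))⁻¹ ≤ 2 / a := by
    have h4 : Real.exp (a / 2) * Real.exp (-(a / 2)) = 1 := by rw [← Real.exp_add]; simp
    have h5 := Real.add_one_le_exp (a / 2)
    have h6 : 0 < Real.exp (-(a / 2)) := Real.exp_pos _
    rw [← div_eq_mul_inv, div_le_div_iff₀ (by linarith) ha]
    nlinarith
  calc _ ≤ 8 / a * Real.exp (-(a / 2)) * (1 - Real.exp (-(a / 2)))⁻¹ := by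
        gcongr
        exact sum_range_pow_le (Real.exp_pos _).le hE N
    _ = 8 / a * (Real.exp (-(a / 2)) * (1 - Real.exp (-(a / 2)))⁻¹) := by ring
    _ ≤ 8 / a * (2 / a) := by gcongr
    _ = _ := by field_simp; norm_num

/-- The number of multiplicity families up to permutation of the slots. -/
theorem card_image_multFamilies_le (N : ℕ) {a : ℝ} (ha : 0 < a) :
    (((multFamilies ι N).image fun f => Multiset.map f univ.val).card : ℝ) ≤
      Real.exp (a * N + 16 / a ^ 2) := by
  have h1 := card_multisets_le ((multFamilies ι N).image fun f => Multiset.map f univ.val)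
    (fun t => ∑ i, t i) (slotTypes N) N (fun t ht => (mem_filter.1 ht).2.1) (by
      intro u hu
      obtain ⟨m, hm, rfl⟩ := mem_image.1 hu
      obtain ⟨hm1, hm2, hm3, hm4⟩ := mem_filter.1 hm
      rw [Fintype.mem_piFinset] at hm1
      refine ⟨fun t ht => ?_, ?_⟩
      · obtain ⟨s, -, rfl⟩ := Multiset.mem_map.1 ht
        refine mem_filter.2 ⟨hm1 s, hm2 s, ?_, hm4 s⟩
        rw [← hm3]
        exact single_le_sum (f := fun s => ∑ i, m s i) (fun _ _ => Nat.zero_le _) (mem_univ s)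
      · rw [Multiset.map_map]
        exact hm3) ha
  refine h1.trans ?_
  rw [Real.exp_add]
  gcongr
  calc ∏ t ∈ slotTypes N, (1 - Real.exp (-(a * (∑ i, t i : ℕ))))⁻¹
      ≤ ∏ t ∈ slotTypes N,
        Real.exp (Real.exp (-(a * (∑ i, t i : ℕ) / 2)) / (a * (∑ i, t i : ℕ))) := by
        refine prod_le_prod (fun t ht => ?_) fun t ht => ?_
        · rw [inv_nonneg, sub_nonneg, Real.exp_le_one_iff, Left.neg_nonpos_iff]
          positivity
        · have : (0 : ℝ) < (∑ i, t i : ℕ) := by exact_mod_cast (mem_filter.1 ht).2.1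
          exact inv_one_sub_exp_neg_le (by positivity)
    _ = Real.exp (∑ t ∈ slotTypes N,
        Real.exp (-(a * (∑ i, t i : ℕ) / 2)) / (a * (∑ i, t i : ℕ))) := by rw [Real.exp_sum]
    _ ≤ _ := Real.exp_le_exp.2 (sum_slotTypes_le N ha)

end

/-! ### Second moments of families of four flows -/

section

variable {α ι : Type*} [Fintype α] [DecidableEq α] [Fintype ι] [DecidableEq ι]

/-- The first pair of flows of the family is incompatible. -/
def IsBadFamily (E : Finset α) (f : FlowIdx → FlowData α) : Prop :=
  (∃ a ∈ E, 0 < (f (false, true)).1 a) ∨ ∃ a, 0 < (f (false, true)).1 a ∧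
    0 < (f (false, false)).1 a ∧ (f (false, true)).2 a ≠ (f (false, false)).2 a

/-- Without active slots, after relabelling every slot is a loop of all the flows at a position off
`E`. Undoing the relabelling, the flows avoid `E` and agree wherever both are positive, so the
family is not bad. -/
lemma IsPullback.activeSlots_ne_empty {E : Finset α} {f : FlowIdx → FlowData α} {x : ι ↪ α}
    {m : ι → FlowIdx → ℕ} {π ρ : FlowIdx → Equiv.Perm ι} {e e' : Finset ι}
    {φ τ : Equiv.Perm ι} (h : IsPullback E f x m π e) (hr : IsRelabelling m π e φ ρ e')
    (hf : IsBadFamily E f) : activeSlots ρ τ e' ≠ ∅ := by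
  intro h0
  have hD : ∀ s, τ s = s ∧ s ∉ e' ∧ ∀ i, ρ i s = s := fun s =>
    notMem_activeSlots.1 (by rw [h0]; exact notMem_empty s)
  rcases hf with ⟨a, ha, hpos⟩ | ⟨a, h1, h2, h3⟩
  · obtain ⟨s, rfl⟩ := (h.support a).1 ⟨_, hpos⟩
    have : φ.symm s ∈ e' := (hr.mem_iff _).2 (by
      rw [Equiv.apply_symm_apply]; exact (h.mem_iff s).2 ha)
    exact (hD _).2.1 this
  · obtain ⟨s, rfl⟩ := (h.support a).1 ⟨_, h1⟩
    rw [← h.mult] at h1 h2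
    apply h3
    rw [← h.apply_eq, ← h.apply_eq, ← hr.apply_eq s _ h1, ← hr.apply_eq s _ h2, (hD s).2.2,
      (hD s).2.2]

/-- The bound for a slot sum with `q` active slots. -/
noncomputable def activeBound (n b N : ℕ) (θ δ c : ℝ) (q : ℕ) : ℝ :=
  θ ^ N * (n : ℝ) ^ b * if q = 0 then c else
    (4 * θ⁻¹ ^ 8) ^ q * (n : ℝ) ^ (-max δ (δ * q / 3))

/-- An active slot pays for at most two thirds of a free sum, or for one sum over `E`, worth
`n^(1-δ)`. The gain `δ` is the one that enters the probability; `δ q / 3` makes the sum over the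
number of active slots converge. -/
lemma exponent_le {a b q : ℕ} {δ : ℝ} (hδ : 0 < δ) (hδ1 : δ ≤ 1) (hq : q ≠ 0)
    (h : 3 * a + 2 * b ≤ 2 * q) :
    (a : ℝ) + (1 - δ) * b ≤ q - max δ (δ * q / 3) := by
  have h' : 3 * (a : ℝ) + 2 * b ≤ 2 * q := by exact_mod_cast h
  have hb : (b : ℝ) ≤ q := by exact_mod_cast (by omega : b ≤ q)
  have ha0 : (0 : ℝ) ≤ a := Nat.cast_nonneg _
  have hb0 : (0 : ℝ) ≤ b := Nat.cast_nonneg _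
  have hq0 : (1 : ℝ) ≤ q := by exact_mod_cast Nat.one_le_iff_ne_zero.2 hq
  rw [le_sub_comm]
  refine max_le ?_ ?_
  · rcases Nat.eq_zero_or_pos b with rfl | hbpos
    · have : a + 1 ≤ q := by omega
      have : (a : ℝ) + 1 ≤ q := by exact_mod_cast this
      simp; linarith
    · have h1 : (1 : ℝ) ≤ b := by exact_mod_cast hbpos
      have h2 : a + b ≤ q := by omega
      have h2 : (a : ℝ) + b ≤ q := by exact_mod_cast h2
      nlinarith
  · rcases le_total δ (1 / 3) with hd | hd
    · nlinarith
    · nlinarith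

lemma slotSum_le_activeBound [Nonempty α] {A : Matrix α α ℝ} {E : Finset α} {θ δ c : ℝ}
    (hA : EntryBounds A E θ) (hδ : 0 < δ) (hδ1 : δ ≤ 1)
    (hE : (E.card : ℝ) ≤ (Fintype.card α : ℝ) ^ (1 - δ)) {N : ℕ} {m : ι → FlowIdx → ℕ}
    {ρ : FlowIdx → Equiv.Perm ι} {τ : Equiv.Perm ι} {e : Finset ι} (h : IsReduced m ρ τ e)
    (hN : ∑ s, ∑ i, m s i = N) (hc : activeSlots ρ τ e = ∅ → c = 1) :
    slotSum A E m ρ τ e ≤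
      activeBound (Fintype.card α) (Fintype.card ι) N θ δ c (activeSlots ρ τ e).card := by
  obtain ⟨a, b, hab, hle⟩ := h.slotSum_le hA
  set q := (activeSlots ρ τ e).card with hq
  have hn : (0 : ℝ) < Fintype.card α := by exact_mod_cast Fintype.card_pos
  have hn1 : (1 : ℝ) ≤ Fintype.card α := by exact_mod_cast Fintype.card_pos
  have hθ := hA.pos
  rw [hN] at hle
  unfold activeBound
  split_ifs with h0
  · rw [hc (card_eq_zero.1 h0)]
    have ha : a = 0 := by omega
    have hb : b = 0 := by omega
    rw [ha, hb, h0] at hle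
    simpa using hle
  · refine hle.trans ?_
    have hcard : Fintype.card FlowIdx = 4 := by simp [FlowIdx]
    have hqb : q ≤ Fintype.card ι := card_le_univ _
    have e1 : (Fintype.card α : ℝ) ^ a * (E.card : ℝ) ^ b ≤
        (Fintype.card α : ℝ) ^ (q - max δ (δ * q / 3)) := by
      calc (Fintype.card α : ℝ) ^ a * (E.card : ℝ) ^ b
          ≤ (Fintype.card α : ℝ) ^ a * ((Fintype.card α : ℝ) ^ (1 - δ)) ^ b := by gcongr
        _ = (Fintype.card α : ℝ) ^ ((a : ℝ) + (1 - δ) * b) := by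
            rw [Real.rpow_add hn, Real.rpow_natCast, Real.rpow_mul hn.le, Real.rpow_natCast]
        _ ≤ _ := Real.rpow_le_rpow_of_exponent_le hn1 (exponent_le hδ hδ1 h0 hab)
    rw [hcard]
    calc _ ≤ θ ^ N * (4 * θ⁻¹ ^ (2 * 4)) ^ q * (Fintype.card α : ℝ) ^ (Fintype.card ι - q) *
          (Fintype.card α : ℝ) ^ (q - max δ (δ * q / 3)) := by gcongr
      _ = θ ^ N * (4 * θ⁻¹ ^ 8) ^ q * ((Fintype.card α : ℝ) ^ (Fintype.card ι - q) *
          (Fintype.card α : ℝ) ^ q) * (Fintype.card α : ℝ) ^ (- max δ (δ * q / 3)) := by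
          rw [sub_eq_add_neg, Real.rpow_add hn, Real.rpow_natCast]; ring
      _ = _ := by rw [← pow_add, Nat.sub_add_cancel hqb]; ring

/-- Summation over the number of active slots. -/
lemma sum_activeBound_le {n b N : ℕ} {θ δ c : ℝ} (hn : 1 ≤ n) (hθ : 0 < θ) (hθ1 : θ ≤ 1)
    (hδ : 0 < δ) (hc : 0 ≤ c) (hb : b ≤ N)
    (hX : 8 * N ^ 6 * θ⁻¹ ^ 8 ≤ (n : ℝ) ^ (δ / 3)) :
    ∑ q ∈ range (b + 1), (b.choose q * (q.factorial ^ 4 * (q.factorial * 2 ^ q)) : ℕ) *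
        activeBound n b N θ δ c q ≤
      θ ^ N * (n : ℝ) ^ b * (c + N * ((8 * N ^ 6 * θ⁻¹ ^ 8) ^ 3 * (n : ℝ) ^ (-δ))) := by
  have hn0 : (0 : ℝ) < n := by exact_mod_cast hn
  have hn1 : (1 : ℝ) ≤ n := by exact_mod_cast hn
  set X : ℝ := 8 * N ^ 6 * θ⁻¹ ^ 8 with hXdef
  rw [sum_range_succ']
  have h0 : ((b.choose 0 * (Nat.factorial 0 ^ 4 * (Nat.factorial 0 * 2 ^ 0)) : ℕ) : ℝ) *
      activeBound n b N θ δ c 0 = θ ^ N * (n : ℝ) ^ b * c := by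
    simp [activeBound]
  rw [h0, mul_add, add_comm]
  gcongr
  have key : ∀ q ∈ range b,
      ((b.choose (q + 1) * ((q + 1).factorial ^ 4 * ((q + 1).factorial * 2 ^ (q + 1))) : ℕ) : ℝ) *
        activeBound n b N θ δ c (q + 1) ≤
      θ ^ N * (n : ℝ) ^ b * (X ^ 3 * (n : ℝ) ^ (-δ)) := by
    intro q hq
    rw [mem_range] at hq
    have hN1 : 1 ≤ N := by omega
    have hX1 : 1 ≤ X := by
      have a1 : (1 : ℝ) ≤ N := by exact_mod_cast hN1
      have a2 : 1 ≤ θ⁻¹ := (one_le_inv₀ hθ).2 hθ1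
      have a3 : (1 : ℝ) ≤ (N : ℝ) ^ 6 := one_le_pow₀ a1
      have a4 : (1 : ℝ) ≤ θ⁻¹ ^ 8 := one_le_pow₀ a2
      rw [hXdef]
      nlinarith
    -- The sixth power comes from one binomial coefficient and five factorials, for four flows and
    -- `τ`.
    have hnat : b.choose (q + 1) * ((q + 1).factorial ^ 4 * ((q + 1).factorial * 2 ^ (q + 1))) ≤
        (2 * N ^ 6) ^ (q + 1) := by
      have b1 : b.choose (q + 1) ≤ N ^ (q + 1) :=
        (Nat.choose_le_pow _ _).trans (Nat.pow_le_pow_left hb _)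
      have b2 : (q + 1).factorial ≤ N ^ (q + 1) :=
        (Nat.factorial_le_pow _).trans (Nat.pow_le_pow_left (by omega) _)
      calc _ ≤ N ^ (q + 1) * ((N ^ (q + 1)) ^ 4 * (N ^ (q + 1) * 2 ^ (q + 1))) := by gcongr
        _ = _ := by rw [mul_pow, ← pow_mul]; ring
    have hnat' : ((b.choose (q + 1) * ((q + 1).factorial ^ 4 *
        ((q + 1).factorial * 2 ^ (q + 1))) : ℕ) : ℝ) ≤ (2 * (N : ℝ) ^ 6) ^ (q + 1) := by
      exact_mod_cast hnat
    have hmain : X ^ (q + 1) * (n : ℝ) ^ (-max δ (δ * (q + 1 : ℕ) / 3)) ≤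
        X ^ 3 * (n : ℝ) ^ (-δ) := by
      -- Up to three active slots the gain `n^(-δ)` is used with `1 ≤ X`. Beyond that, each further
      -- slot contributes a factor `X n^(-δ/3) ≤ 1`.
      rcases le_total (q + 1) 3 with h3 | h3
      · exact mul_le_mul (pow_le_pow_right₀ hX1 h3) (Real.rpow_le_rpow_of_exponent_le hn1
          (neg_le_neg (le_max_left _ _))) (by positivity) (by positivity)
      · have c1 : (n : ℝ) ^ (-max δ (δ * (q + 1 : ℕ) / 3)) ≤ ((n : ℝ) ^ (-(δ / 3))) ^ (q + 1) := by
          rw [← Real.rpow_natCast, ← Real.rpow_mul hn0.le]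
          refine Real.rpow_le_rpow_of_exponent_le hn1 ?_
          have := le_max_right δ (δ * (q + 1 : ℕ) / 3)
          linarith
        have c2 : X * (n : ℝ) ^ (-(δ / 3)) ≤ 1 := by
          rw [Real.rpow_neg hn0.le, ← div_eq_mul_inv, div_le_one (by positivity)]
          exact hX
        have c3 : 0 ≤ X * (n : ℝ) ^ (-(δ / 3)) := by positivity
        calc _ ≤ X ^ (q + 1) * ((n : ℝ) ^ (-(δ / 3))) ^ (q + 1) := by gcongr
          _ = (X * (n : ℝ) ^ (-(δ / 3))) ^ (q + 1) := (mul_pow _ _ _).symm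
          _ ≤ (X * (n : ℝ) ^ (-(δ / 3))) ^ 3 := pow_le_pow_of_le_one c3 c2 h3
          _ = X ^ 3 * (n : ℝ) ^ (-δ) := by
            rw [mul_pow, ← Real.rpow_natCast ((n : ℝ) ^ (-(δ / 3))), ← Real.rpow_mul hn0.le]
            congr 2
            push_cast
            ring
    rw [activeBound, if_neg (Nat.succ_ne_zero q)]
    calc _ ≤ (2 * (N : ℝ) ^ 6) ^ (q + 1) * (θ ^ N * (n : ℝ) ^ b * ((4 * θ⁻¹ ^ 8) ^ (q + 1) *
          (n : ℝ) ^ (-max δ (δ * (q + 1 : ℕ) / 3)))) := by gcongr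
      _ = θ ^ N * (n : ℝ) ^ b * (X ^ (q + 1) * (n : ℝ) ^ (-max δ (δ * (q + 1 : ℕ) / 3))) := by
          rw [hXdef, show (8 : ℝ) * N ^ 6 * θ⁻¹ ^ 8 = 2 * N ^ 6 * (4 * θ⁻¹ ^ 8) by ring,
            mul_pow (2 * (N : ℝ) ^ 6)]
          ring
      _ ≤ _ := by gcongr
  refine (sum_le_sum key).trans ?_
  rw [sum_const, card_range, nsmul_eq_mul]
  have : (b : ℝ) ≤ N := by exact_mod_cast hb
  calc _ ≤ (N : ℝ) * (θ ^ N * (n : ℝ) ^ b * (X ^ 3 * (n : ℝ) ^ (-δ))) := by gcongr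
    _ = _ := by ring

/-- Bernoulli: `(n - b)^b ≥ n^b (1 - b²/n)`, and `b² ≤ n/2`. -/
lemma pow_le_two_mul_descFactorial {n b N : ℕ} (hb : b ≤ N) (hN : 2 * N ^ 2 ≤ n) :
    (n : ℝ) ^ b ≤ 2 * n.descFactorial b := by
  rcases Nat.eq_zero_or_pos b with rfl | hb0
  · simp
  have hbn : b ≤ n := by nlinarith
  have hn : (0 : ℝ) < n := by exact_mod_cast (by omega : 0 < n)
  have h1 : ((n - b : ℕ) : ℝ) ^ b ≤ n.descFactorial b := by
    have := Nat.pow_sub_le_descFactorial n b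
    calc ((n - b : ℕ) : ℝ) ^ b ≤ ((n + 1 - b : ℕ) : ℝ) ^ b := by
          gcongr; omega
      _ ≤ _ := by exact_mod_cast this
  have h2 : 1 + (b : ℝ) * (-(b / n)) ≤ (1 + -(b / n : ℝ)) ^ b := by
    refine one_add_mul_le_pow ?_ b
    have : (b : ℝ) / n ≤ 1 := by rw [div_le_one hn]; exact_mod_cast hbn
    linarith
  have h3 : (b : ℝ) * (b / n) ≤ 1 / 2 := by
    rw [← mul_div_assoc, div_le_div_iff₀ hn (by norm_num)]
    have : 2 * (b * b) ≤ n := by nlinarith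
    have : 2 * ((b : ℝ) * b) ≤ n := by exact_mod_cast this
    linarith
  have h4 : ((n - b : ℕ) : ℝ) ^ b = (n : ℝ) ^ b * (1 + -(b / n : ℝ)) ^ b := by
    rw [← mul_pow, Nat.cast_sub hbn]
    congr 1
    field_simp
    ring
  have h5 : (1 : ℝ) / 2 ≤ (1 + -(b / n : ℝ)) ^ b := by linarith
  have h6 : (n : ℝ) ^ b * (1 / 2) ≤ (n : ℝ) ^ b * (1 + -(b / n : ℝ)) ^ b := by gcongr
  linarith

lemma mem_multFamilies {N : ℕ} {m : ι → FlowIdx → ℕ} : m ∈ multFamilies ι N ↔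
    (∀ s, 0 < ∑ i, m s i) ∧ (∑ s, ∑ i, m s i = N) ∧ ∀ s j, m s (j, true) ≤ 1 := by
  rw [multFamilies, mem_filter, and_iff_right_iff_imp]
  rintro ⟨-, hN, -⟩
  simp only [Fintype.mem_piFinset, mem_range, Nat.lt_succ_iff]
  intro s i
  rw [← hN]
  exact (single_le_sum (f := fun i => m s i) (fun _ _ => Nat.zero_le _)
    (mem_univ i)).trans (single_le_sum (f := fun s => ∑ i, m s i)
    (fun _ _ => Nat.zero_le _) (mem_univ s))

/-- Second moment bound: the sum of the absolute expectations of the weights of a set of families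
of flows of total degree `N`. -/
theorem sum_abs_permMean_flowWeight_le [Nonempty α] {A : Matrix α α ℝ} {E : Finset α}
    {θ δ c a : ℝ} (hA : EntryBounds A E θ) (hA0 : ∀ x, ∑ y, A y x = 0) (hδ : 0 < δ) (hδ1 : δ ≤ 1)
    (hE : (E.card : ℝ) ≤ (Fintype.card α : ℝ) ^ (1 - δ)) (N : ℕ)
    (S : Finset (FlowIdx → FlowData α)) (hS : ∀ f ∈ S, ∀ i, IsFlow (f i))
    (hSE : ∀ f ∈ S, ∀ a ∈ E, ∀ i, (f i).1 a ≤ 1) (hS1 : ∀ f ∈ S, ∀ a j, (f (j, true)).1 a ≤ 1)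
    (hSN : ∀ f ∈ S, ∑ i, flowDeg (f i) = N)
    (hc : c = 1 ∨ c = 0 ∧ ∀ f ∈ S, IsBadFamily E f) (ha : 0 < a)
    (hX : 8 * N ^ 6 * θ⁻¹ ^ 8 ≤ (Fintype.card α : ℝ) ^ (δ / 3))
    (hN : 2 * N ^ 2 ≤ Fintype.card α) :
    ∑ f ∈ S, |permMean fun σ : Equiv.Perm α => ∏ i, flowWeight (A.submatrix ⇑σ id) (f i)| ≤
      2 * (N + 1) * Real.exp (a * N + 16 / a ^ 2) * θ ^ N *
        (c + N * ((8 * N ^ 6 * θ⁻¹ ^ 8) ^ 3 * (Fintype.card α : ℝ) ^ (-δ))) := by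
  have hθ := hA.pos
  have hc0 : 0 ≤ c := by rcases hc with rfl | ⟨rfl, -⟩ <;> norm_num
  set n := Fintype.card α with hn
  have hn1 : 1 ≤ n := Fintype.card_pos
  have hn0 : (0 : ℝ) < n := by exact_mod_cast hn1
  set Y : ℝ := c + N * ((8 * N ^ 6 * θ⁻¹ ^ 8) ^ 3 * (n : ℝ) ^ (-δ)) with hY
  have hY0 : 0 ≤ Y := by positivity
  have hsupp : ∀ f ∈ S, (familySupport f).card ∈ range (N + 1) := by
    intro f hf
    rw [mem_range, Nat.lt_succ_iff, ← hSN f hf]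
    simp only [flowDeg]
    rw [sum_comm, card_eq_sum_ones]
    refine (sum_le_sum fun x hx => ?_).trans (sum_le_sum_of_subset (subset_univ _))
    obtain ⟨i, hi⟩ := (mem_filter.1 hx).2
    exact le_trans hi (single_le_sum (f := fun i => (f i).1 x) (fun _ _ => Nat.zero_le _)
      (mem_univ i))
  rw [← sum_fiberwise_of_maps_to hsupp]
  have key : ∀ b ∈ range (N + 1), ∑ f ∈ S with (familySupport f).card = b,
      |permMean fun σ : Equiv.Perm α => ∏ i, flowWeight (A.submatrix ⇑σ id) (f i)| ≤
      2 * Real.exp (a * N + 16 / a ^ 2) * θ ^ N * Y := by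
    intro b hb
    rw [mem_range, Nat.lt_succ_iff] at hb
    obtain ⟨S', h1, h2⟩ := exists_slot_families (ι := Fin b) hA0 E
      (S.filter fun f => (familySupport f).card = b) (fun f hf => hS f (mem_filter.1 hf).1)
      (fun f hf => hSE f (mem_filter.1 hf).1) (fun f hf => by
        rw [(mem_filter.1 hf).2, Fintype.card_fin])
    have hmult : ∀ c ∈ S', c.1 ∈ multFamilies (Fin b) N := by
      intro c hc
      obtain ⟨h3, f, hf, x, h4⟩ := h1 c hc
      have hfS := (mem_filter.1 hf).1
      have hsum : ∑ s, ∑ i, c.1 s i = N := by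
        rw [← hSN f hfS]
        simp only [flowDeg, h4.mult]
        rw [sum_comm]
        refine sum_congr rfl fun i _ => ?_
        rw [← sum_map univ x fun y => (f i).1 y]
        refine sum_subset (subset_univ _) fun y _ hy => ?_
        by_contra h0
        obtain ⟨s, hs⟩ := (h4.support y).1 ⟨i, Nat.pos_of_ne_zero h0⟩
        exact hy (mem_map.2 ⟨s, mem_univ _, hs⟩)
      refine mem_multFamilies.2 ⟨fun s => ?_, hsum, fun s j => ?_⟩
      · obtain ⟨i, hi⟩ := h3.pos s
        exact lt_of_lt_of_le hi (single_le_sum (f := fun i => c.1 s i)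
          (fun _ _ => Nat.zero_le _) (mem_univ i))
      · rw [h4.mult]
        exact hS1 f hfS _ _
    have h5 := sum_slotSum_le A E (activeBound n b N θ δ c) (fun q => by
      unfold activeBound
      split_ifs <;> positivity) (multFamilies (Fin b) N) S' hmult (fun c hc => (h1 c hc).1) (by
      intro p hp φ ρ e' hr hred
      obtain ⟨h3, f, hf, x, h4⟩ := h1 p hp
      have := slotSum_le_activeBound (δ := δ) (c := c) hA hδ hδ1 hE hred
        (mem_multFamilies.1 (hmult p hp)).2.1 (fun h0 => by
          rcases hc with h | h
          · exact h
          · exact absurd h0 (h4.activeSlots_ne_empty hr (h.2 f (mem_filter.1 hf).1)))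
      rwa [Fintype.card_fin] at this)
    have h6 := sum_activeBound_le (c := c) hn1 hθ hA.le_one hδ hc0 hb hX
    have hcard : Fintype.card FlowIdx = 4 := by simp [FlowIdx]
    rw [Fintype.card_fin, hcard] at h5
    rw [Fintype.card_fin] at h2
    have h7 := card_image_multFamilies_le (ι := Fin b) N ha
    set V : ℝ := (((multFamilies (Fin b) N).image fun f => Multiset.map f univ.val).card : ℝ)
      with hV
    have hbf : (0 : ℝ) < b.factorial := by exact_mod_cast Nat.factorial_pos b
    have hdf0 : 0 < n.descFactorial b := by
      rw [Nat.pos_iff_ne_zero, Ne, Nat.descFactorial_eq_zero_iff_lt]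
      nlinarith
    have hdf : (0 : ℝ) < n.descFactorial b := by exact_mod_cast hdf0
    refine le_of_mul_le_mul_left (h2.trans ?_) hbf
    rw [div_le_iff₀ hdf]
    refine h5.trans ?_
    rw [Nat.cast_mul]
    have h8 := pow_le_two_mul_descFactorial hb hN
    calc _ ≤ Real.exp (a * N + 16 / a ^ 2) * b.factorial * (θ ^ N * (n : ℝ) ^ b * Y) := by
          refine mul_le_mul ?_ h6 ?_ (by positivity)
          · gcongr
          · refine sum_nonneg fun q _ => mul_nonneg (Nat.cast_nonneg _) ?_
            unfold activeBound
            split_ifs <;> positivity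
      _ ≤ Real.exp (a * N + 16 / a ^ 2) * b.factorial *
          (θ ^ N * (2 * n.descFactorial b) * Y) := by gcongr
      _ = _ := by ring
  refine (sum_le_sum key).trans (le_of_eq ?_)
  rw [sum_const, card_range, nsmul_eq_mul]
  push_cast
  ring

end

/-! ### Second moments of the coefficients of `H` and of the product -/

section

variable {α : Type*} [Fintype α] [DecidableEq α]

/-- The family of four flows formed by two pairs. -/
def familyOfPairs (p : (FlowData α × FlowData α) × FlowData α × FlowData α) :
    FlowIdx → FlowData α
  | (false, true) => p.1.1
  | (false, false) => p.1.2
  | (true, true) => p.2.1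
  | (true, false) => p.2.2

lemma familyOfPairs_injective : Function.Injective (familyOfPairs (α := α)) := by
  intro p q h
  exact Prod.ext (Prod.ext (congrFun h (false, true)) (congrFun h (false, false)))
    (Prod.ext (congrFun h (true, true)) (congrFun h (true, false)))

/-- Second moment of a combination of weights of pairs of flows. -/
theorem permMean_sq_sum_pairs_le [Nonempty α] {A : Matrix α α ℝ} {E : Finset α} {θ δ c a : ℝ}
    (hA : EntryBounds A E θ) (hA0 : ∀ x, ∑ y, A y x = 0) (hδ : 0 < δ) (hδ1 : δ ≤ 1)
    (hE : (E.card : ℝ) ≤ (Fintype.card α : ℝ) ^ (1 - δ)) (k : ℕ)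
    (S : Finset (FlowData α × FlowData α)) (hS : S ⊆ flowPairs E k)
    (hc : c = 1 ∨ c = 0 ∧ ∀ p ∈ S, ¬ IsCompatible E p) (ha : 0 < a)
    (u : FlowData α × FlowData α → ℝ) (hu : ∀ p, |u p| ≤ 1)
    (hX : 8 * (2 * k : ℕ) ^ 6 * θ⁻¹ ^ 8 ≤ (Fintype.card α : ℝ) ^ (δ / 3))
    (hN : 2 * (2 * k) ^ 2 ≤ Fintype.card α) :
    permMean (fun σ : Equiv.Perm α => (∑ p ∈ S, u p * (flowWeight (A.submatrix ⇑σ id) p.1 *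
        flowWeight (A.submatrix ⇑σ id) p.2)) ^ 2) ≤
      2 * ((2 * k : ℕ) + 1) * Real.exp (a * (2 * k : ℕ) + 16 / a ^ 2) * θ ^ (2 * k) *
        (c + (2 * k : ℕ) * ((8 * (2 * k : ℕ) ^ 6 * θ⁻¹ ^ 8) ^ 3 *
          (Fintype.card α : ℝ) ^ (-δ))) := by
  classical
  -- The square is a double sum over pairs of flows, that is, over families of four flows. As the
  -- coefficients `u` are at most 1 in modulus, expectations are bounded term by term.
  -- Incompatibility of the first pair is enough for the family to be bad.
  let S' : Finset (FlowIdx → FlowData α) := (S ×ˢ S).image familyOfPairs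
  have hmem : ∀ f ∈ S', ∃ p q, p ∈ S ∧ q ∈ S ∧ familyOfPairs (p, q) = f := by
    intro f hf
    obtain ⟨⟨p, q⟩, hpq, rfl⟩ := mem_image.1 hf
    exact ⟨p, q, (mem_product.1 hpq).1, (mem_product.1 hpq).2, rfl⟩
  have hprod : ∀ (P : Matrix α α ℝ) (p : (FlowData α × FlowData α) × FlowData α × FlowData α),
      ∏ i, flowWeight P (familyOfPairs p i) =
        (flowWeight P p.1.1 * flowWeight P p.1.2) * (flowWeight P p.2.1 * flowWeight P p.2.2) := by
    intro P p
    rw [Fintype.prod_prod_type]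
    simp only [Fintype.prod_bool, familyOfPairs]
    ring
  have hfam : ∀ p q, p ∈ S → q ∈ S → (∀ i, IsFlow (familyOfPairs (p, q) i)) ∧
      (∀ a ∈ E, ∀ i, (familyOfPairs (p, q) i).1 a ≤ 1) ∧
      (∀ a j, (familyOfPairs (p, q) (j, true)).1 a ≤ 1) ∧
      ∑ i, flowDeg (familyOfPairs (p, q) i) = 2 * k := by
    intro p q hp hq
    obtain ⟨a1, a2, a3, a4, a5⟩ := mem_flowPairs.1 (hS hp)
    obtain ⟨b1, b2, b3, b4, b5⟩ := mem_flowPairs.1 (hS hq)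
    refine ⟨?_, ?_, ?_, ?_⟩
    · rintro ⟨i, j⟩
      cases i <;> cases j <;> simp only [familyOfPairs] <;> assumption
    · rintro x hx ⟨i, j⟩
      have c1 := a5 x hx
      have c2 := b5 x hx
      cases i <;> cases j <;> simp only [familyOfPairs]
      · omega
      · exact a4 x
      · omega
      · exact b4 x
    · intro x j
      cases j
      · exact a4 x
      · exact b4 x
    · rw [Fintype.sum_prod_type]
      simp only [Fintype.sum_bool, familyOfPairs]
      omega
  have hmain := sum_abs_permMean_flowWeight_le (c := c) hA hA0 hδ hδ1 hE (2 * k) S'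
    (fun f hf => by obtain ⟨p, q, hp, hq, rfl⟩ := hmem f hf; exact (hfam p q hp hq).1)
    (fun f hf => by obtain ⟨p, q, hp, hq, rfl⟩ := hmem f hf; exact (hfam p q hp hq).2.1)
    (fun f hf => by obtain ⟨p, q, hp, hq, rfl⟩ := hmem f hf; exact (hfam p q hp hq).2.2.1)
    (fun f hf => by obtain ⟨p, q, hp, hq, rfl⟩ := hmem f hf; exact (hfam p q hp hq).2.2.2)
    (hc.imp id fun h => ⟨h.1, fun f hf => by
      obtain ⟨p, q, hp, hq, rfl⟩ := hmem f hf
      have h1 := h.2 p hp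
      unfold IsCompatible at h1
      rw [not_and_or] at h1
      refine h1.imp (fun h2 => ?_) (fun h2 => ?_)
      · push Not at h2
        obtain ⟨x, hx, hx'⟩ := h2
        exact ⟨x, hx, Nat.pos_of_ne_zero hx'⟩
      · push Not at h2
        exact h2⟩) ha hX hN
  refine le_trans ?_ hmain
  rw [sum_image familyOfPairs_injective.injOn, sum_product]
  have h1 : ∀ σ : Equiv.Perm α, (∑ p ∈ S, u p * (flowWeight (A.submatrix ⇑σ id) p.1 *
        flowWeight (A.submatrix ⇑σ id) p.2)) ^ 2 =
      ∑ p ∈ S, ∑ q ∈ S, u p * u q *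
        ∏ i, flowWeight (A.submatrix ⇑σ id) (familyOfPairs (p, q) i) := by
    intro σ
    rw [sq, sum_mul_sum]
    refine sum_congr rfl fun p _ => sum_congr rfl fun q _ => ?_
    rw [hprod]
    ring
  simp only [h1, permMean_sum]
  refine sum_le_sum fun p _ => sum_le_sum fun q _ => ?_
  have h2 : permMean (fun σ : Equiv.Perm α => u p * u q *
        ∏ i, flowWeight (A.submatrix ⇑σ id) (familyOfPairs (p, q) i)) =
      u p * u q * permMean (fun σ : Equiv.Perm α =>
        ∏ i, flowWeight (A.submatrix ⇑σ id) (familyOfPairs (p, q) i)) := by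
    simp only [permMean, ← mul_sum, mul_div_assoc]
  rw [h2]
  refine (le_abs_self _).trans ?_
  rw [abs_mul]
  refine mul_le_of_le_one_left (abs_nonneg _) ?_
  rw [abs_mul]
  exact mul_le_one₀ (hu p) (abs_nonneg _) (hu q)

/-- Second moment of the sums over flows avoiding `E`. -/
theorem permMean_flowSum_sq_le [Nonempty α] {A : Matrix α α ℝ} {E : Finset α} {θ δ a : ℝ}
    (hA : EntryBounds A E θ) (hA0 : ∀ x, ∑ y, A y x = 0) (hδ : 0 < δ) (hδ1 : δ ≤ 1)
    (hE : (E.card : ℝ) ≤ (Fintype.card α : ℝ) ^ (1 - δ)) (k : ℕ) (ha : 0 < a)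
    (hX : 8 * (2 * k : ℕ) ^ 6 * θ⁻¹ ^ 8 ≤ (Fintype.card α : ℝ) ^ (δ / 3))
    (hN : 2 * (2 * k) ^ 2 ≤ Fintype.card α) :
    permMean (fun σ : Equiv.Perm α => flowSum (A.submatrix ⇑σ id) E k ^ 2) ≤
      2 * ((2 * k : ℕ) + 1) * Real.exp (a * (2 * k : ℕ) + 16 / a ^ 2) * θ ^ (2 * k) *
        (1 + (2 * k : ℕ) * ((8 * (2 * k : ℕ) ^ 6 * θ⁻¹ ^ 8) ^ 3 *
          (Fintype.card α : ℝ) ^ (-δ))) := by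
  classical
  -- Each flow is paired with the empty flow; such pairs may have no active slot, so `c = 1`.
  have h := permMean_sq_sum_pairs_le (c := 1) hA hA0 hδ hδ1 hE k
    ((avoidingFlows E k).image fun f => (((fun _ => 0, 1), f) : FlowData α × FlowData α))
    (fun p hp => by
      obtain ⟨f, hf, rfl⟩ := mem_image.1 hp
      obtain ⟨h1, h2, h3⟩ := mem_avoidingFlows.1 hf
      refine mem_flowPairs.2 ⟨⟨fun _ => rfl, fun _ _ => rfl⟩, h1, ?_, fun _ => Nat.zero_le _, h3⟩
      simp [flowDeg, ← h2]) (Or.inl rfl) ha (fun _ => 1) (fun _ => by simp) hX hN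
  refine le_trans (le_of_eq ?_) h
  congr 1
  funext σ
  rw [sum_image (fun _ _ _ _ h => (Prod.mk.injEq _ _ _ _ ▸ h).2), flowSum]
  congr 1
  refine sum_congr rfl fun f _ => ?_
  simp [flowWeight]

open Classical in
/-- Second moment of the coefficients of the product of the characteristic polynomial and the
generating function of the flows avoiding `E`. -/
theorem permMean_sum_antidiagonal_sq_le [Nonempty α] {A : Matrix α α ℝ} {E : Finset α}
    {θ δ a : ℝ} (hA : EntryBounds A E θ) (hA0 : ∀ x, ∑ y, A y x = 0) (hδ : 0 < δ) (hδ1 : δ ≤ 1)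
    (hE : (E.card : ℝ) ≤ (Fintype.card α : ℝ) ^ (1 - δ)) {k : ℕ} (hk : 0 < k) (ha : 0 < a)
    (hX : 8 * (2 * k : ℕ) ^ 6 * θ⁻¹ ^ 8 ≤ (Fintype.card α : ℝ) ^ (δ / 3))
    (hN : 2 * (2 * k) ^ 2 ≤ Fintype.card α) :
    permMean (fun σ : Equiv.Perm α => (∑ ij ∈ antidiagonal k,
        ((-1) ^ ij.1 * minorSum (A.submatrix ⇑σ id) ij.1) *
          flowSum (A.submatrix ⇑σ id) E ij.2) ^ 2) ≤
      2 * ((2 * k : ℕ) + 1) * Real.exp (a * (2 * k : ℕ) + 16 / a ^ 2) * θ ^ (2 * k) *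
        ((2 * k : ℕ) * ((8 * (2 * k : ℕ) ^ 6 * θ⁻¹ ^ 8) ^ 3 *
          (Fintype.card α : ℝ) ^ (-δ))) := by
  have h := permMean_sq_sum_pairs_le (c := 0) hA hA0 hδ hδ1 hE k
    ((flowPairs E k).filter fun p => ¬ IsCompatible E p) (filter_subset _ _)
    (Or.inr ⟨rfl, fun p hp => (mem_filter.1 hp).2⟩) ha
    (fun p => (-1) ^ flowDeg p.1 * ((Equiv.Perm.sign p.1.2 : ℤ) : ℝ)) (fun p => by
      rw [abs_mul, abs_pow, abs_neg, abs_one, one_pow, one_mul]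
      rcases Int.units_eq_one_or (Equiv.Perm.sign p.1.2) with h | h <;> simp [h]) hX hN
  rw [zero_add] at h
  refine le_trans (le_of_eq ?_) h
  congr 1
  funext σ
  rw [sum_antidiagonal_eq_sum_incompatible _ E hk]
  rfl

end

/-! ### The centred matrix and the parameter `ρ` -/

section

variable {n : ℕ}

/-- The matrix minus the projection onto constant vectors. -/
noncomputable def centred (Q : Matrix (Fin n) (Fin n) ℝ) : Matrix (Fin n) (Fin n) ℝ :=
  Q - Matrix.of fun _ _ => (n : ℝ)⁻¹

lemma centred_apply (Q : Matrix (Fin n) (Fin n) ℝ) (x y : Fin n) :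
    centred Q x y = Q x y - (n : ℝ)⁻¹ := rfl

section

variable {Q : Matrix (Fin n) (Fin n) ℝ}

lemma sum_centred_row (hn : 1 ≤ n) (hQ : Q ∈ doublyStochastic ℝ (Fin n)) (y : Fin n) :
    ∑ x, centred Q y x = 0 := by
  rw [mem_doublyStochastic_iff_sum] at hQ
  have hn0 : (n : ℝ) ≠ 0 := by exact_mod_cast (by omega : n ≠ 0)
  simp only [centred_apply, sum_sub_distrib, hQ.2.1, sum_const, card_univ, Fintype.card_fin,
    nsmul_eq_mul, mul_inv_cancel₀ hn0, sub_self]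

lemma sum_centred_col (hn : 1 ≤ n) (hQ : Q ∈ doublyStochastic ℝ (Fin n)) (x : Fin n) :
    ∑ y, centred Q y x = 0 := by
  rw [mem_doublyStochastic_iff_sum] at hQ
  have hn0 : (n : ℝ) ≠ 0 := by exact_mod_cast (by omega : n ≠ 0)
  simp only [centred_apply, sum_sub_distrib, hQ.2.2, sum_const, card_univ, Fintype.card_fin,
    nsmul_eq_mul, mul_inv_cancel₀ hn0, sub_self]

lemma sum_abs_centred_row_le (hn : 1 ≤ n) (hQ : Q ∈ doublyStochastic ℝ (Fin n)) (y : Fin n) :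
    ∑ x, |centred Q y x| ≤ 2 := by
  rw [mem_doublyStochastic_iff_sum] at hQ
  have hn0 : (n : ℝ) ≠ 0 := by exact_mod_cast (by omega : n ≠ 0)
  calc ∑ x, |centred Q y x| ≤ ∑ x, (Q y x + (n : ℝ)⁻¹) := by
        refine sum_le_sum fun x _ => ?_
        rw [centred_apply]
        refine (abs_sub _ _).trans ?_
        rw [abs_of_nonneg (hQ.1 y x), abs_of_nonneg (by positivity)]
    _ = 2 := by
        simp only [sum_add_distrib, hQ.2.1, sum_const, card_univ, Fintype.card_fin, nsmul_eq_mul,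
          mul_inv_cancel₀ hn0]
        norm_num

lemma sum_abs_centred_col_le (hn : 1 ≤ n) (hQ : Q ∈ doublyStochastic ℝ (Fin n)) (x : Fin n) :
    ∑ y, |centred Q y x| ≤ 2 := by
  rw [mem_doublyStochastic_iff_sum] at hQ
  have hn0 : (n : ℝ) ≠ 0 := by exact_mod_cast (by omega : n ≠ 0)
  calc ∑ y, |centred Q y x| ≤ ∑ y, (Q y x + (n : ℝ)⁻¹) := by
        refine sum_le_sum fun y _ => ?_
        rw [centred_apply]
        refine (abs_sub _ _).trans ?_
        rw [abs_of_nonneg (hQ.1 y x), abs_of_nonneg (by positivity)]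
    _ = 2 := by
        simp only [sum_add_distrib, hQ.2.2, sum_const, card_univ, Fintype.card_fin, nsmul_eq_mul,
          mul_inv_cancel₀ hn0]
        norm_num

lemma sq_normHS : normHS Q ^ 2 = (1 / (n : ℝ)) * ∑ x, ∑ y, Q x y ^ 2 := by
  rw [normHS, Real.sq_sqrt (by positivity)]
  simp only [sq_abs]

/-- Nonnegativity excludes cancellations: if `Q x y ≠ 0`, the support of row `x` is contained in
that of row `y` of `QᵀQ`. -/
lemma ncard_row_support_le (hQ : Q ∈ doublyStochastic ℝ (Fin n)) (x : Fin n) :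
    (univ.filter fun y => Q x y ≠ 0).card ≤ dParam Q := by
  rw [mem_doublyStochastic_iff_sum] at hQ
  rcases (univ.filter fun y => Q x y ≠ 0).eq_empty_or_nonempty with h | ⟨y, hy⟩
  · rw [h]; simp
  have hy' : Q x y ≠ 0 := (mem_filter.1 hy).2
  have h1 : {z : Fin n | (Q.transpose * Q) y z ≠ 0}.ncard ≤ dParam Q :=
    le_sup (f := fun x : Fin n => {z : Fin n | (Q.transpose * Q) x z ≠ 0}.ncard) (mem_univ y)
  refine le_trans ?_ h1
  rw [← Set.ncard_coe_finset]
  refine Set.ncard_le_ncard ?_ (Set.toFinite _)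
  intro z hz
  have hz' : Q x z ≠ 0 := by simpa using hz
  have hpos : 0 < (Q.transpose * Q) y z := by
    rw [Matrix.mul_apply]
    refine lt_of_lt_of_le (?_ : 0 < Q.transpose y x * Q x z)
      (single_le_sum (f := fun w => Q.transpose y w * Q w z)
        (fun w _ => mul_nonneg (hQ.1 w y) (hQ.1 w z)) (mem_univ x))
    exact mul_pos (lt_of_le_of_ne (hQ.1 x y) hy'.symm) (lt_of_le_of_ne (hQ.1 x z) hz'.symm)
  exact hpos.ne'

lemma dParam_le : dParam Q ≤ n := by
  unfold dParam normOneZero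
  refine Finset.sup_le fun x _ => ?_
  refine (Set.ncard_le_card _).trans ?_
  simp

/-- Cauchy–Schwarz on each row, which sums to 1 and has at most `d` nonzero entries. -/
lemma one_le_dParam_mul_sq_normHS (hn : 1 ≤ n) (hQ : Q ∈ doublyStochastic ℝ (Fin n)) :
    1 ≤ (dParam Q : ℝ) * normHS Q ^ 2 := by
  have hn0 : (0 : ℝ) < n := by exact_mod_cast hn
  have hQ' := hQ
  rw [mem_doublyStochastic_iff_sum] at hQ
  have hrow : ∀ x, 1 ≤ (dParam Q : ℝ) * ∑ y, Q x y ^ 2 := by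
    intro x
    have h1 : ∑ y ∈ univ.filter (fun y => Q x y ≠ 0), Q x y = 1 := by
      rw [sum_filter_ne_zero, hQ.2.1]
    have h2 := sq_sum_le_card_mul_sum_sq (s := univ.filter fun y => Q x y ≠ 0) (f := Q x)
    rw [h1, one_pow] at h2
    have h3 : ((univ.filter fun y => Q x y ≠ 0).card : ℝ) ≤ dParam Q := by
      exact_mod_cast ncard_row_support_le hQ' x
    refine h2.trans (mul_le_mul h3 ?_ (sum_nonneg fun _ _ => sq_nonneg _) (Nat.cast_nonneg _))
    exact sum_le_sum_of_subset_of_nonneg (filter_subset _ _) fun _ _ _ => sq_nonneg _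
  have h4 : (n : ℝ) ≤ (dParam Q : ℝ) * ∑ x, ∑ y, Q x y ^ 2 := by
    rw [mul_sum]
    calc (n : ℝ) = ∑ _x : Fin n, (1 : ℝ) := by simp
      _ ≤ _ := sum_le_sum fun x _ => hrow x
  rw [sq_normHS]
  calc (1 : ℝ) = (1 / (n : ℝ)) * n := by field_simp
    _ ≤ (1 / (n : ℝ)) * ((dParam Q : ℝ) * ∑ x, ∑ y, Q x y ^ 2) := by gcongr
    _ = _ := by ring

lemma normHS_le_rhoParam (δ : ℝ) : normHS Q ≤ rhoParam δ Q := le_max_left _ _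

lemma normHS_nonneg : 0 ≤ normHS Q := Real.sqrt_nonneg _

lemma one_le_dParam_mul_sq_rhoParam (hn : 1 ≤ n) (hQ : Q ∈ doublyStochastic ℝ (Fin n)) (δ : ℝ) :
    1 ≤ (dParam Q : ℝ) * rhoParam δ Q ^ 2 := by
  refine (one_le_dParam_mul_sq_normHS hn hQ).trans ?_
  have := normHS_nonneg (Q := Q)
  have := normHS_le_rhoParam (Q := Q) δ
  gcongr

lemma rhoParam_pos (hn : 1 ≤ n) (hQ : Q ∈ doublyStochastic ℝ (Fin n)) (δ : ℝ) :
    0 < rhoParam δ Q := by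
  have h1 := one_le_dParam_mul_sq_rhoParam hn hQ δ
  have h2 : 0 ≤ rhoParam δ Q := normHS_nonneg.trans (normHS_le_rhoParam δ)
  refine lt_of_le_of_ne h2 fun h => ?_
  rw [← h] at h1
  norm_num at h1

lemma one_le_mul_sq_rhoParam (hn : 1 ≤ n) (hQ : Q ∈ doublyStochastic ℝ (Fin n)) (δ : ℝ) :
    1 ≤ (n : ℝ) * rhoParam δ Q ^ 2 := by
  refine (one_le_dParam_mul_sq_rhoParam hn hQ δ).trans ?_
  have : (dParam Q : ℝ) ≤ n := by exact_mod_cast dParam_le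
  gcongr

lemma rhoParam_le_one (hn : 1 ≤ n) (hQ : Q ∈ doublyStochastic ℝ (Fin n)) (δ : ℝ) :
    rhoParam δ Q ≤ 1 := by
  have hn0 : (0 : ℝ) < n := by exact_mod_cast hn
  have hQ' := hQ
  rw [mem_doublyStochastic_iff_sum] at hQ
  refine max_le ?_ ?_
  · rw [← abs_of_nonneg (normHS_nonneg (Q := Q)), ← sq_le_one_iff_abs_le_one, sq_normHS]
    have : ∑ x, ∑ y, Q x y ^ 2 ≤ n := by
      calc ∑ x, ∑ y, Q x y ^ 2 ≤ ∑ x, ∑ y, Q x y := by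
            refine sum_le_sum fun x _ => sum_le_sum fun y _ => ?_
            exact pow_le_of_le_one (hQ.1 x y) (le_one_of_mem_doublyStochastic hQ') two_ne_zero
        _ = n := by simp [hQ.2.1]
    rw [one_div, inv_mul_le_iff₀ hn0, mul_one]
    exact this
  · have hE : (((∅ : Finset (Fin n)).card : ℕ) : ℝ) < (n : ℝ) ^ (1 - δ) := by
      rw [card_empty, Nat.cast_zero]; positivity
    refine (ciInf_le (Set.finite_range _).bddBelow
      (⟨∅, hE⟩ : {E : Finset (Fin n) // (E.card : ℝ) < (n : ℝ) ^ (1 - δ)})).trans ?_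
    refine Real.iSup_le (fun p => ?_) zero_le_one
    rw [abs_of_nonneg (hQ.1 _ _)]
    exact le_one_of_mem_doublyStochastic hQ'

lemma exists_exceptional (hn : 1 ≤ n) (δ : ℝ) : ∃ E : Finset (Fin n),
    (E.card : ℝ) < (n : ℝ) ^ (1 - δ) ∧ ∀ y, ∀ x ∉ E, |Q y x| ≤ rhoParam δ Q := by
  have hn0 : (0 : ℝ) < n := by exact_mod_cast hn
  have hne : Nonempty {E : Finset (Fin n) // (E.card : ℝ) < (n : ℝ) ^ (1 - δ)} :=
    ⟨⟨∅, by rw [card_empty, Nat.cast_zero]; positivity⟩⟩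
  obtain ⟨E, hE⟩ := exists_eq_ciInf_of_finite
    (f := fun E : {E : Finset (Fin n) // (E.card : ℝ) < (n : ℝ) ^ (1 - δ)} =>
      ⨆ p : {x : Fin n // x ∉ E.1} × Fin n, |Q p.2 p.1|)
  refine ⟨E.1, E.2, fun y x hx => le_trans ?_ (le_max_right _ _)⟩
  rw [normOneInfty, ← hE]
  exact le_ciSup (f := fun p : {x : Fin n // x ∉ E.1} × Fin n => |Q p.2 p.1|)
    (Set.finite_range _).bddAbove (⟨x, hx⟩, y)

/-- Entries of `Q` and `1/n` are nonnegative, so their difference is at most the larger one, and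
`1/n ≤ ρ` follows from `n ρ² ≥ 1` and `ρ ≤ 1`. Centring the rows does not increase the sum of
squares. -/
lemma entryBounds_centred (hn : 1 ≤ n) (hQ : Q ∈ doublyStochastic ℝ (Fin n)) {δ : ℝ}
    {E : Finset (Fin n)} (hE : ∀ y, ∀ x ∉ E, |Q y x| ≤ rhoParam δ Q) :
    EntryBounds (centred Q) E (rhoParam δ Q) := by
  have hn0 : (0 : ℝ) < n := by exact_mod_cast hn
  have hn1 : (1 : ℝ) ≤ n := by exact_mod_cast hn
  have hρ := rhoParam_pos hn hQ δ
  have hρ1 := rhoParam_le_one hn hQ δ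
  have hinv : (n : ℝ)⁻¹ ≤ rhoParam δ Q := by
    rw [inv_le_iff_one_le_mul₀ hn0]
    refine (one_le_mul_sq_rhoParam hn hQ δ).trans ?_
    rw [mul_comm]
    gcongr
    exact pow_le_of_le_one hρ.le hρ1 two_ne_zero
  have hQ0 : ∀ x y, 0 ≤ Q x y := (mem_doublyStochastic_iff_sum.1 hQ).1
  have habs : ∀ y x, |centred Q y x| ≤ max (Q y x) (n : ℝ)⁻¹ := by
    intro y x
    rw [centred_apply]
    have hi : 0 < (n : ℝ)⁻¹ := by positivity
    exact abs_le.2 ⟨by linarith [hQ0 y x, le_max_right (Q y x) (n : ℝ)⁻¹],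
      by linarith [le_max_left (Q y x) (n : ℝ)⁻¹]⟩
  refine ⟨hρ, hρ1, fun y x => (habs y x).trans (max_le (le_one_of_mem_doublyStochastic hQ) (hinv.trans hρ1)),
    fun y x hx => (habs y x).trans (max_le ((le_abs_self _).trans (hE y x hx)) hinv),
    sum_abs_centred_row_le hn hQ, sum_abs_centred_col_le hn hQ, ?_⟩
  rw [sum_comm]
  have h1 : ∑ y, ∑ x, centred Q y x ^ 2 ≤ ∑ y, ∑ x, Q y x ^ 2 := by
    refine sum_le_sum fun y _ => ?_
    have : ∀ x, centred Q y x ^ 2 = Q y x ^ 2 - (n : ℝ)⁻¹ * (centred Q y x + Q y x) := by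
      intro x; rw [centred_apply]; ring
    simp only [this, sum_sub_distrib, ← mul_sum, sum_add_distrib, sum_centred_row hn hQ,
      (mem_doublyStochastic_iff_sum.1 hQ).2.1]
    have : 0 < (n : ℝ)⁻¹ := by positivity
    linarith
  refine h1.trans ?_
  rw [Fintype.card_fin]
  have h2 : normHS Q ^ 2 ≤ rhoParam δ Q ^ 2 :=
    pow_le_pow_left₀ normHS_nonneg (normHS_le_rhoParam δ) 2
  rw [sq_normHS] at h2
  calc ∑ y, ∑ x, Q y x ^ 2 = n * ((1 / (n : ℝ)) * ∑ x, ∑ y, Q x y ^ 2) := by field_simp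
    _ ≤ _ := by gcongr

end

end

/-! ### Eigenvalues of the product and of its centred part -/

section

-- `(X - B)(X - J) = X² - X(B + J) + BJ = X(X - (B + J))`.
open Polynomial in
lemma charpoly_mul_charpoly_of_mul_eq_zero {α R : Type*} [Fintype α] [DecidableEq α] [CommRing R]
    {B J : Matrix α α R} (h : B * J = 0) :
    B.charpoly * J.charpoly = X ^ Fintype.card α * (B + J).charpoly := by
  have : B.charmatrix * J.charmatrix = (X : R[X]) • (B + J).charmatrix := by
    have hC : (C : R →+* R[X]).mapMatrix B * (C : R →+* R[X]).mapMatrix J = 0 := by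
      rw [← map_mul, h, map_zero]
    have hs : ∀ M : Matrix α α R[X], Matrix.scalar α (X : R[X]) * M = (X : R[X]) • M := by
      intro M
      rw [Matrix.scalar_apply, Matrix.smul_eq_diagonal_mul]
    have hs' : ∀ M : Matrix α α R[X], M * Matrix.scalar α (X : R[X]) = (X : R[X]) • M := by
      intro M
      rw [← hs]
      exact (Matrix.scalar_commute _ (fun r => Commute.all _ _) M).symm
    simp only [Matrix.charmatrix, sub_mul, mul_sub, hC, map_add, hs, hs', smul_sub, smul_add]
    abel
  rw [Matrix.charpoly, Matrix.charpoly, Matrix.charpoly, ← Matrix.det_mul, this, Matrix.det_smul]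

variable {n : ℕ}

lemma permMul_eq_submatrix (σ : Equiv.Perm (Fin n)) (Q : Matrix (Fin n) (Fin n) ℝ) :
    permMul σ Q = Q.submatrix ⇑σ id := by
  ext x y
  simp [permMul, Matrix.mul_apply]

/-- Two eigenvalues of modulus at least `θ`. -/
lemma two_le_countP_of_le_absLambdaTwo {A : Matrix (Fin n) (Fin n) ℝ} {θ : ℝ} (hθ : 0 < θ)
    (h : θ ≤ absLambdaTwo A) :
    2 ≤ (A.map (fun r : ℝ => (r : ℂ))).charpoly.roots.countP fun z => θ ≤ ‖z‖ := by
  rw [absLambdaTwo, eigenvalueModuli] at h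
  set M := (A.map (fun r : ℝ => (r : ℂ))).charpoly.roots.map (fun z : ℂ => ‖z‖) with hM
  have hs : (M.sort (· ≥ ·)).Pairwise (· ≥ ·) := M.pairwise_sort _
  have hc : M.countP (fun r => θ ≤ r) =
      (A.map (fun r : ℝ => (r : ℂ))).charpoly.roots.countP fun z => θ ≤ ‖z‖ := by
    rw [hM, Multiset.countP_map, Multiset.countP_eq_card_filter]
  rw [← hc, ← Multiset.sort_eq M (· ≥ ·), Multiset.coe_countP]
  generalize M.sort (· ≥ ·) = L at h hs
  rcases L with _ | ⟨a, _ | ⟨b, t⟩⟩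
  · simp at h; linarith
  · simp at h; linarith
  · have hb : θ ≤ b := by simpa using h
    have hab : b ≤ a := by
      have := (List.pairwise_cons.1 hs).1 b (by simp)
      exact this
    rw [List.countP_cons_of_pos (by simpa using hb.trans hab),
      List.countP_cons_of_pos (by simpa using hb)]
    omega

/-- `J` is a rank one projection, with characteristic polynomial `X^(n-1)(X - 1)`. Roots of modulus
at least `θ > 0` ignore powers of `X`; of the two that belong to `MQ`, the root 1 of `J` accounts
for at most one. -/
lemma exists_root_of_le_absLambdaTwo (hn : 1 ≤ n) {Q : Matrix (Fin n) (Fin n) ℝ}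
    (hQ : Q ∈ doublyStochastic ℝ (Fin n)) (σ : Equiv.Perm (Fin n)) {θ : ℝ} (hθ : 0 < θ)
    (h : θ ≤ absLambdaTwo (permMul σ Q)) :
    ∃ μ : ℂ, θ ≤ ‖μ‖ ∧ (((centred Q).submatrix ⇑σ id).map
      (fun r : ℝ => (r : ℂ))).charpoly.IsRoot μ := by
  have hn0 : (n : ℂ) ≠ 0 := by exact_mod_cast (by omega : n ≠ 0)
  set B := ((centred Q).submatrix ⇑σ id).map (fun r : ℝ => (r : ℂ)) with hB
  set J : Matrix (Fin n) (Fin n) ℂ := Matrix.vecMulVec (fun _ => (n : ℂ)⁻¹) fun _ => 1 with hJ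
  have hBJ : B * J = 0 := by
    ext x y
    rw [Matrix.mul_apply, Matrix.zero_apply]
    simp only [hB, hJ, Matrix.vecMulVec_apply, Matrix.map_apply, Matrix.submatrix_apply, id,
      mul_one]
    rw [← sum_mul, ← Complex.ofReal_sum, sum_centred_row hn hQ, Complex.ofReal_zero, zero_mul]
  have hsum : B + J = (permMul σ Q).map (fun r : ℝ => (r : ℂ)) := by
    ext x y
    rw [permMul_eq_submatrix]
    simp [hB, hJ, Matrix.vecMulVec_apply, centred_apply]
  have key := charpoly_mul_charpoly_of_mul_eq_zero hBJ
  have hdot : ((fun _ : Fin n => (n : ℂ)⁻¹) ⬝ᵥ fun _ => 1) = 1 := by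
    simp [dotProduct, hn0]
  rw [hsum, hJ, Matrix.charpoly_vecMulVec, hdot, one_smul, Fintype.card_fin] at key
  have hX : (Polynomial.X : Polynomial ℂ) ^ n - Polynomial.X ^ (n - 1) =
      Polynomial.X ^ (n - 1) * (Polynomial.X - Polynomial.C 1) := by
    obtain ⟨k, rfl⟩ : ∃ k, n = k + 1 := ⟨n - 1, by omega⟩
    rw [Nat.add_sub_cancel, map_one]; ring
  rw [hX] at key
  set P := (permMul σ Q).map (fun r : ℝ => (r : ℂ)) with hP
  have hB0 : B.charpoly ≠ 0 := (Matrix.charpoly_monic B).ne_zero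
  have hP0 : P.charpoly ≠ 0 := (Matrix.charpoly_monic P).ne_zero
  have hX0 : ∀ k, (Polynomial.X : Polynomial ℂ) ^ k ≠ 0 := fun k =>
    pow_ne_zero k Polynomial.X_ne_zero
  have hX1 : (Polynomial.X - Polynomial.C 1 : Polynomial ℂ) ≠ 0 := Polynomial.X_sub_C_ne_zero 1
  have hroots := congrArg Polynomial.roots key
  rw [Polynomial.roots_mul (mul_ne_zero hB0 (mul_ne_zero (hX0 _) hX1)),
    Polynomial.roots_mul (mul_ne_zero (hX0 _) hX1), Polynomial.roots_X_sub_C,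
    Polynomial.roots_mul (mul_ne_zero (hX0 _) hP0), Polynomial.roots_X_pow,
    Polynomial.roots_X_pow] at hroots
  have hcount := congrArg (Multiset.countP fun z : ℂ => θ ≤ ‖z‖) hroots
  simp only [Multiset.countP_add, Multiset.countP_nsmul] at hcount
  have h0 : Multiset.countP (fun z : ℂ => θ ≤ ‖z‖) {0} = 0 := by
    rw [Multiset.countP_eq_zero]
    intro a ha
    rw [Multiset.mem_singleton.1 ha, norm_zero]
    exact not_le.2 hθ
  have h1 : Multiset.countP (fun z : ℂ => θ ≤ ‖z‖) {1} ≤ 1 := by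
    refine (Multiset.countP_le_card _ _).trans ?_
    simp
  have h2 : 2 ≤ P.charpoly.roots.countP fun z => θ ≤ ‖z‖ := two_le_countP_of_le_absLambdaTwo hθ h
  rw [h0] at hcount
  have h3 : 0 < Multiset.countP (fun z : ℂ => θ ≤ ‖z‖) B.charpoly.roots := by
    simp only [mul_zero, zero_add, smul_zero] at hcount
    omega
  obtain ⟨μ, hμ, hμ'⟩ := Multiset.countP_pos.1 h3
  exact ⟨μ, hμ', (Polynomial.mem_roots'.1 hμ).2⟩

/-- An eigenvalue gives a zero of the reversed characteristic polynomial. -/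
lemma sum_minorSum_eq_zero_of_isRoot {α : Type*} [Fintype α] [DecidableEq α] {P : Matrix α α ℝ}
    {μ : ℂ} (hμ : μ ≠ 0) (h : (P.map (fun r : ℝ => (r : ℂ))).charpoly.IsRoot μ) :
    ∑ k ∈ range (Fintype.card α + 1), (μ⁻¹) ^ k * (((-1) ^ k * minorSum P k : ℝ) : ℂ) = 0 := by
  have h1 : (1 + (-μ⁻¹) • P.map (fun r : ℝ => (r : ℂ))).det = 0 := by
    rw [Polynomial.IsRoot.def, Matrix.eval_charpoly] at h
    have : Matrix.scalar α μ - P.map (fun r : ℝ => (r : ℂ)) =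
        μ • (1 + (-μ⁻¹) • P.map (fun r : ℝ => (r : ℂ))) := by
      rw [smul_add, smul_smul, mul_neg, mul_inv_cancel₀ hμ, neg_smul, one_smul, sub_eq_add_neg,
        Matrix.scalar_apply, Matrix.smul_one_eq_diagonal]
    rw [this, Matrix.det_smul] at h
    exact (mul_eq_zero.1 h).resolve_left (pow_ne_zero _ hμ)
  rw [det_one_add_smul_eq_sum_minorSum] at h1
  rw [← h1]
  refine sum_congr rfl fun k _ => ?_
  have : minorSum (P.map (fun r : ℝ => (r : ℂ))) k = ((minorSum P k : ℝ) : ℂ) :=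
    minorSum_map Complex.ofRealHom P k
  rw [this]
  push_cast
  rw [neg_pow]
  ring

/-- Read the eigenvalue equation at a coordinate of largest modulus of the eigenvector. -/
lemma norm_le_one_of_isRoot {P : Matrix (Fin n) (Fin n) ℝ} (h0 : ∀ x y, 0 ≤ P x y)
    (h1 : ∀ x, ∑ y, P x y = 1) {μ : ℂ}
    (h : (P.map (fun r : ℝ => (r : ℂ))).charpoly.IsRoot μ) : ‖μ‖ ≤ 1 := by
  rw [Polynomial.IsRoot.def, Matrix.eval_charpoly] at h
  obtain ⟨v, hv, hv'⟩ := Matrix.exists_mulVec_eq_zero_iff.2 h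
  obtain ⟨y₀, hy₀⟩ := Function.ne_iff.1 hv
  have : Nonempty (Fin n) := ⟨y₀⟩
  obtain ⟨x, -, hx⟩ := exists_max_image univ (fun x => ‖v x‖) ⟨y₀, mem_univ _⟩
  have hvx : 0 < ‖v x‖ := lt_of_lt_of_le (norm_pos_iff.2 hy₀) (hx y₀ (mem_univ _))
  have h2 : μ * v x = ∑ y, (P x y : ℂ) * v y := by
    have := congrFun hv' x
    rw [Matrix.sub_mulVec, Pi.sub_apply, Pi.zero_apply, sub_eq_zero] at this
    simpa [Matrix.mulVec, dotProduct, Matrix.scalar_apply, Matrix.diagonal_apply] using this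
  have h3 : ‖μ‖ * ‖v x‖ ≤ 1 * ‖v x‖ := by
    rw [← norm_mul, h2]
    calc ‖∑ y, (P x y : ℂ) * v y‖ ≤ ∑ y, P x y * ‖v x‖ := by
          refine norm_sum_le_of_le _ fun y _ => ?_
          rw [norm_mul, Complex.norm_real, Real.norm_of_nonneg (h0 x y)]
          exact mul_le_mul_of_nonneg_left (hx y (mem_univ _)) (h0 x y)
      _ = 1 * ‖v x‖ := by rw [← sum_mul, h1]
  exact le_of_mul_le_mul_right h3 hvx

lemma absLambdaTwo_permMul_le_one {Q : Matrix (Fin n) (Fin n) ℝ}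
    (hQ : Q ∈ doublyStochastic ℝ (Fin n)) (σ : Equiv.Perm (Fin n)) {θ : ℝ} (hθ : 0 < θ)
    (h : θ ≤ absLambdaTwo (permMul σ Q)) : θ ≤ 1 := by
  have h2 := two_le_countP_of_le_absLambdaTwo hθ h
  obtain ⟨μ, hμ, hμ'⟩ : ∃ μ ∈ ((permMul σ Q).map (fun r : ℝ => (r : ℂ))).charpoly.roots,
      θ ≤ ‖μ‖ := by
    by_contra hne
    push Not at hne
    rw [Multiset.countP_eq_zero.2 fun a ha => not_le.2 (hne a ha)] at h2
    omega
  have h3 : ((permMul σ Q).map (fun r : ℝ => (r : ℂ))).charpoly.IsRoot μ :=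
    (Polynomial.mem_roots'.1 hμ).2
  refine hμ'.trans (norm_le_one_of_isRoot ?_ ?_ h3)
  · intro x y
    rw [permMul_eq_submatrix]
    exact nonneg_of_mem_doublyStochastic hQ
  · intro x
    rw [permMul_eq_submatrix]
    exact sum_row_of_mem_doublyStochastic hQ (σ x)

end

/-! ### Union bound, Markov's inequality and the zero-free disc -/

section

variable {n : ℕ}

lemma unifProb_mono {E F : Set (Equiv.Perm (Fin n))} (h : E ⊆ F) : unifProb E ≤ unifProb F := by
  unfold unifProb
  gcongr
  exact Set.toFinite F

lemma unifProb_union_le (E F : Set (Equiv.Perm (Fin n))) :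
    unifProb (E ∪ F) ≤ unifProb E + unifProb F := by
  unfold unifProb
  rw [← add_div]
  gcongr
  exact_mod_cast Set.ncard_union_le E F

lemma unifProb_biUnion_le {ι : Type*} [DecidableEq ι] (s : Finset ι)
    (E : ι → Set (Equiv.Perm (Fin n))) :
    unifProb (⋃ i ∈ s, E i) ≤ ∑ i ∈ s, unifProb (E i) := by
  induction s using Finset.induction_on with
  | empty => simp [unifProb]
  | insert i s hi ih =>
    rw [Finset.set_biUnion_insert, sum_insert hi]
    exact (unifProb_union_le _ _).trans (by gcongr)

/-- Markov's inequality. -/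
lemma unifProb_le_of_permMean_le {F : Equiv.Perm (Fin n) → ℝ} (hF : ∀ σ, 0 ≤ F σ) {t m : ℝ}
    (ht : 0 < t) (h : permMean F ≤ m) : unifProb {σ | t < F σ} ≤ m / t := by
  classical
  rw [le_div_iff₀ ht]
  refine le_trans ?_ h
  unfold unifProb permMean
  rw [div_mul_eq_mul_div]
  refine div_le_div_of_nonneg_right ?_ (Nat.cast_nonneg _)
  rw [Set.ncard_eq_toFinset_card', ← nsmul_eq_mul, ← sum_const]
  refine (sum_le_sum fun σ hσ => ?_).trans
    (sum_le_sum_of_subset_of_nonneg (subset_univ _) fun σ _ _ => hF σ)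
  have : t < F σ := by simpa using hσ
  exact this.le

/-- A polynomial has no zero in a disc if its product with another polynomial is close to `1`. -/
lemma sum_ne_zero_of_product_close {N K : ℕ} (hKN : K ≤ N) {a H : ℕ → ℝ} {ρ B η q : ℝ}
    (hρ : 0 < ρ) (hB : 0 ≤ B) (hη : 0 ≤ η) (hq : 1 ≤ q) (ha0 : a 0 = 1) (hH0 : H 0 = 1)
    (ha : ∀ i ≤ N, |a i| ≤ B * ρ ^ i) (hH : ∀ l ≤ K, |H l| ≤ B * ρ ^ l)
    (hr : ∀ j, 0 < j → j ≤ K → |∑ ij ∈ antidiagonal j, a ij.1 * H ij.2| ≤ η * ρ ^ j)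
    (hsmall : K * η + (N + 1) * (K + 1) * (B ^ 2 * (q ^ K)⁻¹) < 1) {z : ℂ}
    (hz : ‖z‖ * (q * ρ) ≤ 1) : ∑ i ∈ range (N + 1), z ^ i * (a i : ℂ) ≠ 0 := by
  intro hS
  have hq0 : 0 < q := by linarith
  have hzρ : ‖z‖ * ρ ≤ q⁻¹ := by
    rw [← one_div, le_div_iff₀ hq0]
    linarith
  have hzρ0 : 0 ≤ ‖z‖ * ρ := by positivity
  have hzρ1 : ‖z‖ * ρ ≤ 1 := hzρ.trans (inv_le_one_of_one_le₀ hq)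
  let f : ℕ × ℕ → ℂ := fun p => z ^ (p.1 + p.2) * ((a p.1 * H p.2 : ℝ) : ℂ)
  have hprod : ∑ p ∈ range (N + 1) ×ˢ range (K + 1), f p = 0 := by
    have : ∑ p ∈ range (N + 1) ×ˢ range (K + 1), f p =
        (∑ i ∈ range (N + 1), z ^ i * (a i : ℂ)) * ∑ l ∈ range (K + 1), z ^ l * (H l : ℂ) := by
      rw [sum_mul_sum, sum_product]
      refine sum_congr rfl fun i _ => sum_congr rfl fun l _ => ?_
      simp only [f]
      push_cast
      ring
    rw [this, hS, zero_mul]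
  -- In degrees at most `K ≤ N` the truncations are invisible and the coefficients are those of the
  -- full product. In higher degrees only the bound `B` and the decay `q^(-K)` are used.
  rw [← sum_filter_add_sum_filter_not _ fun p : ℕ × ℕ => p.1 + p.2 ≤ K] at hprod
  have hlow : ∑ p ∈ (range (N + 1) ×ˢ range (K + 1)).filter (fun p : ℕ × ℕ => p.1 + p.2 ≤ K), f p =
      ∑ j ∈ range (K + 1), z ^ j * ((∑ ij ∈ antidiagonal j, a ij.1 * H ij.2 : ℝ) : ℂ) := by
    rw [← sum_fiberwise_of_maps_to (t := range (K + 1)) (g := fun p : ℕ × ℕ => p.1 + p.2)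
      (fun p hp => mem_range.2 (Nat.lt_succ_of_le (mem_filter.1 hp).2))]
    refine sum_congr rfl fun j hj => ?_
    have hj' := mem_range.1 hj
    have : ((range (N + 1) ×ˢ range (K + 1)).filter fun p : ℕ × ℕ => p.1 + p.2 ≤ K).filter
        (fun p => p.1 + p.2 = j) = antidiagonal j := by
      ext p
      simp only [mem_filter, mem_product, mem_range, HasAntidiagonal.mem_antidiagonal]
      omega
    rw [this, Complex.ofReal_sum, mul_sum]
    refine sum_congr rfl fun p hp => ?_
    simp only [f]
    rw [HasAntidiagonal.mem_antidiagonal.1 hp]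
  rw [hlow, sum_range_succ'] at hprod
  have hzero : z ^ 0 * ((∑ ij ∈ antidiagonal 0, a ij.1 * H ij.2 : ℝ) : ℂ) = 1 := by
    simp [ha0, hH0]
  rw [hzero] at hprod
  have h1 : ‖∑ j ∈ range K, z ^ (j + 1) *
      ((∑ ij ∈ antidiagonal (j + 1), a ij.1 * H ij.2 : ℝ) : ℂ)‖ ≤ K * η := by
    refine (norm_sum_le_of_le (f := fun j => z ^ (j + 1) *
      ((∑ ij ∈ antidiagonal (j + 1), a ij.1 * H ij.2 : ℝ) : ℂ)) _ (n := fun _ => η)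
      fun j hj => ?_).trans (le_of_eq (by simp))
    rw [norm_mul, norm_pow, Complex.norm_real, Real.norm_eq_abs]
    calc _ ≤ ‖z‖ ^ (j + 1) * (η * ρ ^ (j + 1)) := by
          gcongr
          exact hr _ (Nat.succ_pos _) (mem_range.1 hj)
      _ = η * (‖z‖ * ρ) ^ (j + 1) := by rw [mul_pow]; ring
      _ ≤ η := mul_le_of_le_one_right hη (pow_le_one₀ hzρ0 hzρ1)
  have h2 : ‖∑ p ∈ (range (N + 1) ×ˢ range (K + 1)).filter (fun p : ℕ × ℕ => ¬ p.1 + p.2 ≤ K),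
      f p‖ ≤ (N + 1) * (K + 1) * (B ^ 2 * (q ^ K)⁻¹) := by
    refine (norm_sum_le_of_le _ (n := fun _ => B ^ 2 * (q ^ K)⁻¹) fun p hp => ?_).trans ?_
    · simp only [mem_filter, mem_product, mem_range] at hp
      simp only [f]
      rw [norm_mul, norm_pow, Complex.norm_real, Real.norm_eq_abs, abs_mul]
      calc _ ≤ ‖z‖ ^ (p.1 + p.2) * ((B * ρ ^ p.1) * (B * ρ ^ p.2)) := by
            gcongr
            · exact ha _ (by omega)
            · exact hH _ (by omega)
        _ = B ^ 2 * (‖z‖ * ρ) ^ (p.1 + p.2) := by rw [mul_pow, pow_add ρ]; ring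
        _ ≤ B ^ 2 * (‖z‖ * ρ) ^ K := by
            gcongr ?_ * ?_
            exact pow_le_pow_of_le_one hzρ0 hzρ1 (by omega)
        _ ≤ B ^ 2 * (q ^ K)⁻¹ := by
            rw [← inv_pow]
            gcongr
    · rw [sum_const, nsmul_eq_mul]
      gcongr
      calc _ ≤ (((range (N + 1) ×ˢ range (K + 1)).card : ℕ) : ℝ) := by
            exact_mod_cast card_filter_le _ _
        _ = _ := by simp
  have h3 : (1 : ℂ) = -(∑ j ∈ range K, z ^ (j + 1) *
      ((∑ ij ∈ antidiagonal (j + 1), a ij.1 * H ij.2 : ℝ) : ℂ) +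
      ∑ p ∈ (range (N + 1) ×ˢ range (K + 1)).filter (fun p : ℕ × ℕ => ¬ p.1 + p.2 ≤ K), f p) := by
    linear_combination hprod
  have h4 : (1 : ℝ) ≤ K * η + (N + 1) * (K + 1) * (B ^ 2 * (q ^ K)⁻¹) := by
    calc (1 : ℝ) = ‖(1 : ℂ)‖ := by simp
      _ ≤ _ := by
        rw [h3, norm_neg]
        exact (norm_add_le _ _).trans (add_le_add h1 h2)
  linarith

lemma minorSum_zero {α : Type*} [Fintype α] [DecidableEq α] (P : Matrix α α ℝ) :
    minorSum P 0 = 1 := by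
  have : ({π : Equiv.Perm α | ∀ x, π x = x} : Finset _) = {1} := by
    ext π
    simp [Equiv.ext_iff]
  simp [minorSum, principalMinor, this]

lemma flowSum_zero {α : Type*} [Fintype α] [DecidableEq α] (P : Matrix α α ℝ) (E : Finset α) :
    flowSum P E 0 = 1 := by
  have : avoidingFlows E 0 = {((fun _ => 0), (1 : Equiv.Perm α))} := by
    ext f
    rw [mem_avoidingFlows, mem_singleton]
    constructor
    · rintro ⟨h1, h2, -⟩
      have h0 : ∀ x, f.1 x = 0 := fun x => by
        have := le_flowDeg f x
        omega
      exact Prod.ext (funext h0) (Equiv.ext fun x => h1.2 x (h0 x))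
    · rintro rfl
      exact ⟨⟨fun _ => rfl, fun _ _ => rfl⟩, by simp [flowDeg], fun _ _ => rfl⟩
  rw [flowSum, this]
  simp [flowWeight]

end

/-! ### The second moment argument with free parameters -/

section

variable {n : ℕ}

lemma unifProb_le_of_subset_unions {K : ℕ} {S : Set (Equiv.Perm (Fin n))}
    {S₁ S₂ S₃ : ℕ → Set (Equiv.Perm (Fin n))} {b₁ b₂ b₃ : ℝ}
    (hS : S ⊆ ((⋃ i ∈ range (n + 1), S₁ i) ∪ ⋃ l ∈ range (K + 1), S₂ l) ∪ ⋃ j ∈ Icc 1 K, S₃ j)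
    (h₁ : ∀ i ∈ range (n + 1), unifProb (S₁ i) ≤ b₁)
    (h₂ : ∀ i ∈ range (K + 1), unifProb (S₂ i) ≤ b₂)
    (h₃ : ∀ i ∈ Icc 1 K, unifProb (S₃ i) ≤ b₃) :
    unifProb S ≤ (n + 1) * b₁ + (K + 1) * b₂ + K * b₃ := by
  have s1 := (unifProb_biUnion_le (range (n + 1)) S₁).trans (sum_le_sum h₁)
  have s2 := (unifProb_biUnion_le (range (K + 1)) S₂).trans (sum_le_sum h₂)
  have s3 := (unifProb_biUnion_le (Icc 1 K) S₃).trans (sum_le_sum h₃)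
  rw [sum_const, card_range, nsmul_eq_mul] at s1 s2
  rw [sum_const, Nat.card_Icc, Nat.add_sub_cancel, nsmul_eq_mul] at s3
  push_cast at s1 s2
  have u1 := unifProb_mono hS
  have u2 := unifProb_union_le ((⋃ i ∈ range (n + 1), S₁ i) ∪ ⋃ l ∈ range (K + 1), S₂ l)
    (⋃ j ∈ Icc 1 K, S₃ j)
  have u3 := unifProb_union_le (⋃ i ∈ range (n + 1), S₁ i) (⋃ l ∈ range (K + 1), S₂ l)
  linarith

/-- Bounds on the coefficients of the characteristic polynomial, of the truncated generating
function of flows and of their product bound the second eigenvalue. -/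
lemma absLambdaTwo_lt_of_coefficient_bounds {Q : Matrix (Fin n) (Fin n) ℝ} (hn : 50 ≤ n)
    (hQ : Q ∈ doublyStochastic ℝ (Fin n)) (σ : Equiv.Perm (Fin n)) (E : Finset (Fin n)) {K : ℕ}
    {ρ q s : ℝ} (hρ : 0 < ρ) (hq : 1 ≤ q) (hKn : K + 1 ≤ n)
    (h5 : K * (n : ℝ) ^ (-s) ≤ 1 / 4) (h6 : (n : ℝ) ^ 10 ≤ q ^ K)
    (g1 : ∀ i ≤ n, minorSum ((centred Q).submatrix ⇑σ id) i ^ 2 ≤ (n : ℝ) ^ 6 * ρ ^ (2 * i))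
    (g2 : ∀ l ≤ K, flowSum ((centred Q).submatrix ⇑σ id) E l ^ 2 ≤ (n : ℝ) ^ 6 * ρ ^ (2 * l))
    (g3 : ∀ j, 1 ≤ j → j ≤ K → (∑ ij ∈ antidiagonal j,
      ((-1) ^ ij.1 * minorSum ((centred Q).submatrix ⇑σ id) ij.1) *
        flowSum ((centred Q).submatrix ⇑σ id) E ij.2) ^ 2 ≤
          ((n : ℝ) ^ (-s)) ^ 2 * ρ ^ (2 * j)) :
    absLambdaTwo (permMul σ Q) < q * ρ := by
  have hn1 : 1 ≤ n := by omega
  have hn0 : (0 : ℝ) < n := by exact_mod_cast hn1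
  have hn50 : (50 : ℝ) ≤ n := by exact_mod_cast hn
  by_contra hσ
  rw [not_lt] at hσ
  have hqρ : 0 < q * ρ := by positivity
  obtain ⟨μ, hμ, hroot⟩ := exists_root_of_le_absLambdaTwo hn1 hQ σ hqρ hσ
  have hμ0 : 0 < ‖μ‖ := lt_of_lt_of_le hqρ hμ
  have hzero := sum_minorSum_eq_zero_of_isRoot (norm_pos_iff.1 hμ0) hroot
  rw [Fintype.card_fin] at hzero
  refine sum_ne_zero_of_product_close (N := n) (K := K)
    (a := fun i => (-1) ^ i * minorSum ((centred Q).submatrix ⇑σ id) i)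
    (H := fun l => flowSum ((centred Q).submatrix ⇑σ id) E l) (B := (n : ℝ) ^ 3)
    (η := (n : ℝ) ^ (-s)) (q := q) (z := μ⁻¹)
    (by omega) hρ (by positivity) (by positivity) hq ?_ ?_ ?_ ?_ ?_ ?_ ?_ hzero
  · simp [minorSum_zero]
  · exact flowSum_zero _ _
  · intro i hi
    rw [abs_mul, abs_pow, abs_neg, abs_one, one_pow, one_mul]
    refine abs_le_of_sq_le_sq ((g1 i hi).trans (le_of_eq ?_)) (by positivity)
    rw [mul_pow]; ring
  · intro i hi
    refine abs_le_of_sq_le_sq ((g2 i hi).trans (le_of_eq ?_)) (by positivity)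
    rw [mul_pow]; ring
  · intro j hj hjK
    refine abs_le_of_sq_le_sq ((g3 j hj hjK).trans (le_of_eq ?_)) (by positivity)
    rw [mul_pow]; ring
  -- The tail has at most `2n²` terms, each at most `n^6 / n^10`.
  · have e1 : ((K : ℝ) + 1) ≤ n := by exact_mod_cast hKn
    have e2 : (q ^ K)⁻¹ ≤ ((n : ℝ) ^ 10)⁻¹ := by
      gcongr
    have e3 : ((n : ℝ) + 1) * (K + 1) * (((n : ℝ) ^ 3) ^ 2 * (q ^ K)⁻¹) ≤
        (2 * n) * n * (((n : ℝ) ^ 3) ^ 2 * ((n : ℝ) ^ 10)⁻¹) := by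
      gcongr
      linarith
    have e4 : (2 * (n : ℝ)) * n * (((n : ℝ) ^ 3) ^ 2 * ((n : ℝ) ^ 10)⁻¹) =
        2 / (n : ℝ) ^ 2 := by
      field_simp
    have e5 : 2 / (n : ℝ) ^ 2 ≤ 1 / 2 := by
      rw [div_le_div_iff₀ (by positivity) (by norm_num)]
      nlinarith
    rw [e4] at e3
    linarith
  · rw [norm_inv, inv_mul_le_iff₀ hμ0, mul_one]
    exact hμ

/-- The second moment argument for fixed values of the parameters: `K` is the length of the
truncation, `a` the parameter of the generating function, `q` the factor in front of `ρ`. -/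
theorem unifProb_le_of_parameters {Q : Matrix (Fin n) (Fin n) ℝ} (hn : 50 ≤ n)
    (hQ : Q ∈ doublyStochastic ℝ (Fin n)) {δ a q s c₀ : ℝ} (hδ : 0 < δ) (hδ1 : δ ≤ 1) {K : ℕ}
    (ha : 0 < a) (hq : 1 ≤ q)
    (h1 : 8 * ((2 * K : ℕ) : ℝ) ^ 6 * (dParam Q : ℝ) ^ 4 ≤ (n : ℝ) ^ (δ / 3))
    (h2 : 2 * (2 * K) ^ 2 ≤ n)
    (h3 : 2 * (((2 * K : ℕ) : ℝ) + 1) * Real.exp (a * (2 * K : ℕ) + 16 / a ^ 2) *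
      (1 + (2 * K : ℕ) * ((8 * ((2 * K : ℕ) : ℝ) ^ 6 * (dParam Q : ℝ) ^ 4) ^ 3 *
        (n : ℝ) ^ (-δ))) ≤ n)
    (h4 : K * (2 * (((2 * K : ℕ) : ℝ) + 1) * Real.exp (a * (2 * K : ℕ) + 16 / a ^ 2) *
      ((2 * K : ℕ) * ((8 * ((2 * K : ℕ) : ℝ) ^ 6 * (dParam Q : ℝ) ^ 4) ^ 3 *
        (n : ℝ) ^ (-δ)))) * ((n : ℝ) ^ s) ^ 2 ≤ 1 / 2 * (n : ℝ) ^ (-c₀))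
    (h5 : K * (n : ℝ) ^ (-s) ≤ 1 / 4) (h6 : (n : ℝ) ^ 10 ≤ q ^ K)
    (h7 : 25 / (n : ℝ) ^ 2 ≤ 1 / 2 * (n : ℝ) ^ (-c₀)) :
    unifProb {σ : Equiv.Perm (Fin n) | q * rhoParam δ Q ≤ absLambdaTwo (permMul σ Q)} ≤
      (n : ℝ) ^ (-c₀) := by
  have hn1 : 1 ≤ n := by omega
  have hn0 : (0 : ℝ) < n := by exact_mod_cast hn1
  have hn50 : (50 : ℝ) ≤ n := by exact_mod_cast hn
  have : Nonempty (Fin n) := ⟨⟨0, hn1⟩⟩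
  have hcard : (Fintype.card (Fin n) : ℝ) = n := by rw [Fintype.card_fin]
  obtain ⟨E, hE, hEρ⟩ := exists_exceptional (Q := Q) hn1 δ
  have hA := entryBounds_centred hn1 hQ hEρ
  have hA0 := sum_centred_col hn1 hQ
  have hdρ := one_le_dParam_mul_sq_rhoParam hn1 hQ δ
  set ρ := rhoParam δ Q with hρdef
  set d : ℝ := (dParam Q : ℝ) with hd
  have hρ : 0 < ρ := hA.pos
  -- `d ρ² ≥ 1` turns the powers of `1/ρ` lost at active slots into powers of `d`.
  have hinv : ρ⁻¹ ^ 8 ≤ d ^ 4 := by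
    have : ρ⁻¹ ^ 2 ≤ d := by
      rw [inv_pow, inv_le_iff_one_le_mul₀ (by positivity)]
      exact hdρ
    calc ρ⁻¹ ^ 8 = (ρ⁻¹ ^ 2) ^ 4 := by rw [← pow_mul]
      _ ≤ d ^ 4 := by gcongr
  have hE' : (E.card : ℝ) ≤ (Fintype.card (Fin n) : ℝ) ^ (1 - δ) := by
    rw [hcard]; exact hE.le
  have hKn : K + 1 ≤ n := by nlinarith
  have hl2 : ∀ l ≤ K, ((2 * l : ℕ) : ℝ) ≤ ((2 * K : ℕ) : ℝ) := fun l hl => by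
    exact_mod_cast Nat.mul_le_mul_left 2 hl
  have hX : ∀ l ≤ K, 8 * ((2 * l : ℕ) : ℝ) ^ 6 * ρ⁻¹ ^ 8 ≤
      (Fintype.card (Fin n) : ℝ) ^ (δ / 3) := by
    intro l hl
    rw [hcard]
    refine le_trans ?_ h1
    have := hl2 l hl
    gcongr
  have hN : ∀ l ≤ K, 2 * (2 * l) ^ 2 ≤ Fintype.card (Fin n) := by
    intro l hl
    rw [Fintype.card_fin]
    refine le_trans ?_ h2
    gcongr
  let D : ℕ → Equiv.Perm (Fin n) → ℝ := fun i σ => minorSum ((centred Q).submatrix ⇑σ id) i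
  let H : ℕ → Equiv.Perm (Fin n) → ℝ := fun i σ => flowSum ((centred Q).submatrix ⇑σ id) E i
  let R : ℕ → Equiv.Perm (Fin n) → ℝ := fun j σ =>
    ∑ ij ∈ antidiagonal j, ((-1) ^ ij.1 * D ij.1 σ) * H ij.2 σ
  have p1 : ∀ i ∈ range (n + 1), unifProb {σ | (n : ℝ) ^ 6 * ρ ^ (2 * i) < D i σ ^ 2} ≤
      12 / (n : ℝ) ^ 3 := by
    intro i hi
    have hm := permMean_minorSum_sq_le (centred Q) (m := ρ ^ 2) (k := i) (by positivity) (by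
      rw [sum_comm]; exact hA.sq) (by
      rw [Fintype.card_fin]; exact Nat.lt_succ_iff.1 (mem_range.1 hi))
    rw [hcard, ← pow_mul] at hm
    refine (unifProb_le_of_permMean_le (F := fun σ => D i σ ^ 2) (fun σ => sq_nonneg _)
      (by positivity) hm).trans ?_
    rw [mul_div_mul_right _ _ (by positivity), div_le_div_iff₀ (by positivity) (by positivity)]
    have e1 : ((n : ℝ) ^ 2 + 1) * (3 * (n + 1)) ≤ 12 * (n : ℝ) ^ 3 := by nlinarith
    calc _ ≤ 12 * (n : ℝ) ^ 3 * (n : ℝ) ^ 3 := by gcongr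
      _ = _ := by ring
  have p2 : ∀ l ∈ range (K + 1), unifProb {σ | (n : ℝ) ^ 6 * ρ ^ (2 * l) < H l σ ^ 2} ≤
      1 / (n : ℝ) ^ 5 := by
    intro l hl
    have hl' : l ≤ K := Nat.lt_succ_iff.1 (mem_range.1 hl)
    have hm := permMean_flowSum_sq_le (k := l) hA hA0 hδ hδ1 hE' ha (hX l hl') (hN l hl')
    rw [hcard] at hm
    have hm2 := hm.trans (b := _) (c := n * ρ ^ (2 * l)) (by
      rw [mul_right_comm]
      refine mul_le_mul_of_nonneg_right (le_trans ?_ h3) (by positivity)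
      have := hl2 l hl'
      gcongr)
    refine (unifProb_le_of_permMean_le (F := fun σ => H l σ ^ 2) (fun σ => sq_nonneg _)
      (by positivity) hm2).trans (le_of_eq ?_)
    field_simp
  have p3 : ∀ j ∈ Icc 1 K, unifProb {σ | ((n : ℝ) ^ (-s)) ^ 2 * ρ ^ (2 * j) < R j σ ^ 2} ≤
      (2 * (((2 * K : ℕ) : ℝ) + 1) * Real.exp (a * (2 * K : ℕ) + 16 / a ^ 2) *
      ((2 * K : ℕ) * ((8 * ((2 * K : ℕ) : ℝ) ^ 6 * d ^ 4) ^ 3 *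
        (n : ℝ) ^ (-δ)))) * ((n : ℝ) ^ s) ^ 2 := by
    intro j hj
    obtain ⟨hj1, hj'⟩ := mem_Icc.1 hj
    have hm := permMean_sum_antidiagonal_sq_le (k := j) hA hA0 hδ hδ1 hE' hj1 ha (hX j hj')
      (hN j hj')
    rw [hcard] at hm
    have hm2 := hm.trans (b := _) (c := (2 * (((2 * K : ℕ) : ℝ) + 1) *
      Real.exp (a * (2 * K : ℕ) + 16 / a ^ 2) *
      ((2 * K : ℕ) * ((8 * ((2 * K : ℕ) : ℝ) ^ 6 * d ^ 4) ^ 3 *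
        (n : ℝ) ^ (-δ)))) * ρ ^ (2 * j)) (by
      rw [mul_right_comm]
      refine mul_le_mul_of_nonneg_right ?_ (by positivity)
      have := hl2 j hj'
      gcongr)
    refine (unifProb_le_of_permMean_le (F := fun σ => R j σ ^ 2) (fun σ => sq_nonneg _)
      (by positivity) hm2).trans (le_of_eq ?_)
    rw [mul_div_mul_right _ _ (by positivity), Real.rpow_neg hn0.le s, inv_pow, div_inv_eq_mul]
  have hsub : {σ : Equiv.Perm (Fin n) | q * ρ ≤ absLambdaTwo (permMul σ Q)} ⊆
      ((⋃ i ∈ range (n + 1), {σ | (n : ℝ) ^ 6 * ρ ^ (2 * i) < D i σ ^ 2}) ∪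
        (⋃ l ∈ range (K + 1), {σ | (n : ℝ) ^ 6 * ρ ^ (2 * l) < H l σ ^ 2})) ∪
        ⋃ j ∈ Icc 1 K, {σ | ((n : ℝ) ^ (-s)) ^ 2 * ρ ^ (2 * j) < R j σ ^ 2} := by
    intro σ hσ
    by_contra hnot
    simp only [Set.mem_union, Set.mem_iUnion, Set.mem_ofPred_eq, not_or, not_exists, not_lt,
      mem_range, mem_Icc, Nat.lt_succ_iff, and_imp] at hnot hσ
    obtain ⟨⟨g1, g2⟩, g3⟩ := hnot
    exact absurd hσ (not_le.2
      (absLambdaTwo_lt_of_coefficient_bounds hn hQ σ E hρ hq hKn h5 h6 g1 g2 g3))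
  refine (unifProb_le_of_subset_unions hsub p1 p2 p3).trans ?_
  rw [← mul_assoc (K : ℝ)]
  have t1 : ((n : ℝ) + 1) * (12 / (n : ℝ) ^ 3) ≤ 24 / (n : ℝ) ^ 2 := by
    calc ((n : ℝ) + 1) * (12 / (n : ℝ) ^ 3) ≤ (2 * n) * (12 / (n : ℝ) ^ 3) := by
          gcongr; linarith
      _ = _ := by field_simp; norm_num
  have t2 : ((K : ℝ) + 1) * (1 / (n : ℝ) ^ 5) ≤ 1 / (n : ℝ) ^ 2 := by
    have : (K : ℝ) + 1 ≤ n := by exact_mod_cast hKn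
    calc ((K : ℝ) + 1) * (1 / (n : ℝ) ^ 5) ≤ n * (1 / (n : ℝ) ^ 5) := by gcongr
      _ = 1 / (n : ℝ) ^ 4 := by field_simp
      _ ≤ 1 / (n : ℝ) ^ 2 := by
        gcongr
        · linarith
        · norm_num
  have t3 : 24 / (n : ℝ) ^ 2 + 1 / (n : ℝ) ^ 2 = 25 / (n : ℝ) ^ 2 := by ring
  linarith

end

/-! ### Choice of the parameters -/

section

/-- A bound for all the subexponential quantities of the argument. -/
noncomputable def growth (κ S : ℝ) : ℝ := 10 ^ 10 * S ^ 100 * Real.exp (12 * κ * S)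

lemma exists_growth_le {κ η : ℝ} (hκ : 0 < κ) (hη : 0 < η) :
    ∃ S₀ : ℝ, ∀ S, S₀ ≤ S → 1 ≤ S → growth κ S ≤ Real.exp (η * S ^ 2) := by
  set C : ℝ := Real.log (10 ^ 10 * (Nat.factorial 100 : ℝ)) with hC
  have hpos : (0 : ℝ) < 10 ^ 10 * (Nat.factorial 100 : ℝ) := by
    have : (0 : ℝ) < (Nat.factorial 100 : ℝ) := by exact_mod_cast Nat.factorial_pos 100
    positivity
  refine ⟨(|C| + 1 + 12 * κ) / η, fun S hS hS1 => ?_⟩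
  have h1 : S ^ 100 ≤ (Nat.factorial 100 : ℝ) * Real.exp S := by
    have h2 := Real.pow_div_factorial_le_exp S (by linarith) 100
    rwa [div_le_iff₀ (by exact_mod_cast Nat.factorial_pos 100), mul_comm] at h2
  have h3 : |C| + 1 + 12 * κ ≤ η * S := by
    rw [div_le_iff₀ hη] at hS
    linarith
  have h4 : C ≤ |C| * S := (le_abs_self C).trans (le_mul_of_one_le_right (abs_nonneg C) hS1)
  calc growth κ S ≤ 10 ^ 10 * ((Nat.factorial 100 : ℝ) * Real.exp S) *
        Real.exp (12 * κ * S) := by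
        unfold growth
        gcongr
    _ = Real.exp C * Real.exp S * Real.exp (12 * κ * S) := by
        rw [hC, Real.exp_log hpos]; ring
    _ = Real.exp (C + S + 12 * κ * S) := by rw [Real.exp_add, Real.exp_add]
    _ ≤ Real.exp (η * S ^ 2) := by
        refine Real.exp_le_exp.2 ?_
        nlinarith

lemma le_growth {κ S c : ℝ} {j : ℕ} (hκ : 0 < κ) (hS : 1 ≤ S) (hc0 : 0 ≤ c) (hc : c ≤ 10 ^ 10)
    (hj : j ≤ 100) {t : ℝ} (ht : t ≤ 12 * κ * S) : c * S ^ j * Real.exp t ≤ growth κ S := by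
  unfold growth
  gcongr

lemma mul_pow_le_growth {κ S c : ℝ} {j : ℕ} (hκ : 0 < κ) (hS : 1 ≤ S) (hc0 : 0 ≤ c)
    (hc : c ≤ 10 ^ 10) (hj : j ≤ 100) : c * S ^ j ≤ growth κ S := by
  have := le_growth (t := 0) hκ hS hc0 hc hj (by positivity)
  rwa [Real.exp_zero, mul_one] at this

/-- The choice `a = 8/(ηS)` keeps both entropy terms of order at most `η S²` when the degree is of
order `η² S³`. -/
lemma parameter_exponent_le {η S k : ℝ} (hη : 0 < η) (hη1 : η ≤ 1 / 4) (hS1 : 1 ≤ S) (hS : 32 / η ^ 2 ≤ S)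
    (hk : k ≤ 2 * (η ^ 2 / 64 * S ^ 3 + 1)) :
    8 / η / S * k + 16 / (8 / η / S) ^ 2 ≤ η * S ^ 2 := by
  have hS0 : 0 < S := by linarith
  have e1 : 8 / η / S * k ≤ 8 / η / S * (2 * (η ^ 2 / 64 * S ^ 3 + 1)) := by gcongr
  have e2 : 8 / η / S * (2 * (η ^ 2 / 64 * S ^ 3 + 1)) = η * S ^ 2 / 4 + 16 / (η * S) := by
    field_simp
    ring
  have e3 : 16 / (η * S) ≤ η * S ^ 2 / 2 := by
    rw [div_le_div_iff₀ (by positivity) (by norm_num)]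
    rw [div_le_iff₀ (by positivity)] at hS
    calc (16 : ℝ) * 2 ≤ S * η ^ 2 * 1 := by linarith
      _ ≤ S * η ^ 2 * S ^ 2 := by gcongr; exact one_le_pow₀ hS1
      _ = η * S ^ 2 * (η * S) := by ring
  have e4 : 16 / (8 / η / S) ^ 2 = η ^ 2 * S ^ 2 / 4 := by field_simp; norm_num
  have e5 : η ^ 2 * S ^ 2 ≤ η * S ^ 2 := by
    refine mul_le_mul_of_nonneg_right ?_ (by positivity)
    exact pow_le_of_le_one hη.le (by linarith) two_ne_zero
  have e6 : 0 ≤ η * S ^ 2 := by positivity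
  rw [e4]
  linarith

/-- A truncation of order `S³` and an excess of order `1/S` multiply to `S² = log n`; the 20 absorbs
the factor lost in `log(1 + x) ≥ x/2`, valid for `x ≤ 1`. -/
lemma le_mul_log_one_add {b S K : ℝ} (hb : 0 < b) (hS : 0 < S) (hbS : 20 / b ≤ S)
    (hK : b * S ^ 3 ≤ K) : 10 * S ^ 2 ≤ K * Real.log (1 + 20 / b / S) := by
  set x : ℝ := 20 / b / S with hx
  have hx0 : 0 < x := by positivity
  have hx1 : x ≤ 1 := by rw [hx, div_le_one hS]; exact hbS
  have h1 : x / 2 ≤ Real.log (1 + x) := by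
    have h2 := Real.one_sub_inv_le_log_of_pos (by linarith : 0 < 1 + x)
    have h3 : x / 2 ≤ 1 - (1 + x)⁻¹ := by
      have : 1 - (1 + x)⁻¹ = x / (1 + x) := by field_simp; ring
      rw [this]
      gcongr
      linarith
    linarith
  have hK0 : 0 ≤ K := le_trans (by positivity) hK
  calc (10 : ℝ) * S ^ 2 = (b * S ^ 3) * (x / 2) := by rw [hx]; field_simp; norm_num
    _ ≤ K * Real.log (1 + x) := by gcongr

set_option maxHeartbeats 1000000 in
/-- The choice of the parameters in the second moment argument. -/
theorem exists_constants {c₀ δ κ : ℝ} (hc₀ : 0 < c₀) (hc₀δ : c₀ < δ) (hδ : δ ≤ 1) (hκ : 0 < κ) :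
    ∃ c₂ S₀ : ℝ, 0 < c₂ ∧ 1 ≤ S₀ ∧ ∀ (n : ℕ) (Q : Matrix (Fin n) (Fin n) ℝ), 1 ≤ n →
      Q ∈ doublyStochastic ℝ (Fin n) → S₀ ≤ Real.sqrt (Real.log n) →
      (dParam Q : ℝ) ≤ Real.exp (κ * Real.sqrt (Real.log n)) →
      unifProb {σ : Equiv.Perm (Fin n) | (1 + c₂ / Real.sqrt (Real.log n)) * rhoParam δ Q ≤
        absLambdaTwo (permMul σ Q)} ≤ (n : ℝ) ^ (-c₀) := by
  -- A quarter of the gap, because four losses of `n^η` are incurred below.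
  set η : ℝ := (δ - c₀) / 4 with hηdef
  have hη : 0 < η := by rw [hηdef]; linarith
  have hη1 : η ≤ 1 / 4 := by rw [hηdef]; linarith
  have hηδ : 4 * η = δ - c₀ := by rw [hηdef]; ring
  obtain ⟨S₁, hS₁⟩ := exists_growth_le hκ hη
  set b : ℝ := η ^ 2 / 64 with hb
  have hb0 : 0 < b := by positivity
  have hb1 : b ≤ 1 := by rw [hb]; nlinarith
  refine ⟨20 / b, max (max S₁ 2) (max (32 / η ^ 2) (20 / b)), by positivity, ?_, ?_⟩
  · exact le_trans (by norm_num) ((le_max_right S₁ 2).trans (le_max_left _ _))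
  intro n Q hn hQ hS hd
  set S := Real.sqrt (Real.log n) with hSdef
  have hS1' : S₁ ≤ S := (le_max_left _ _).trans ((le_max_left _ _).trans hS)
  have hS2 : 2 ≤ S := (le_max_right _ _).trans ((le_max_left _ _).trans hS)
  have hS3 : 32 / η ^ 2 ≤ S := (le_max_left _ _).trans ((le_max_right _ _).trans hS)
  have hS4 : 20 / b ≤ S := (le_max_right _ _).trans ((le_max_right _ _).trans hS)
  have hS1 : 1 ≤ S := by linarith
  have hS0 : 0 < S := by linarith
  have hG := hS₁ S hS1' hS1
  have hn0 : (0 : ℝ) < n := by exact_mod_cast hn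
  have hlog : Real.log n = S ^ 2 := by
    rw [hSdef, Real.sq_sqrt]
    exact Real.log_nonneg (by exact_mod_cast hn)
  have hpow : ∀ x : ℝ, (n : ℝ) ^ x = Real.exp (x * S ^ 2) := fun x => by
    rw [Real.rpow_def_of_pos hn0, hlog, mul_comm]
  have hnexp : (n : ℝ) = Real.exp (S ^ 2) := by rw [← hlog, Real.exp_log hn0]
  have hGn : growth κ S ≤ n := by
    rw [hnexp]
    refine hG.trans (Real.exp_le_exp.2 ?_)
    nlinarith
  have hn50 : (50 : ℝ) ≤ n := by
    refine le_trans ?_ hGn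
    have := mul_pow_le_growth (c := 50) (j := 0) hκ hS1 (by norm_num) (by norm_num) (by norm_num)
    simpa using this
  set K : ℕ := ⌈b * S ^ 3⌉₊ with hK
  have hKlow : b * S ^ 3 ≤ K := Nat.le_ceil _
  have hKup : (K : ℝ) ≤ b * S ^ 3 + 1 := (Nat.ceil_lt_add_one (by positivity)).le
  have hKS : (K : ℝ) ≤ S ^ 4 := by
    have h1 : b * S ^ 3 ≤ 1 * S ^ 3 := by gcongr
    have h2 : 2 * S ^ 3 ≤ S ^ 4 := by
      calc 2 * S ^ 3 ≤ S * S ^ 3 := by gcongr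
        _ = S ^ 4 := by ring
    have h3 : 1 ≤ S ^ 3 := one_le_pow₀ hS1
    linarith
  set d : ℝ := (dParam Q : ℝ) with hddef
  have hd0 : 0 ≤ d := Nat.cast_nonneg _
  have hd4 : d ^ 4 ≤ Real.exp (4 * κ * S) := by
    calc d ^ 4 ≤ Real.exp (κ * S) ^ 4 := by gcongr
      _ = _ := by rw [← Real.exp_nat_mul]; congr 1; push_cast; ring
  have hK2 : ((2 * K : ℕ) : ℝ) ≤ 2 * S ^ 4 := by push_cast; linarith
  set k : ℝ := ((2 * K : ℕ) : ℝ) with hk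
  have hk0 : 0 ≤ k := Nat.cast_nonneg _
  have hX : 8 * k ^ 6 * d ^ 4 ≤ 512 * S ^ 24 * Real.exp (4 * κ * S) := by
    calc 8 * k ^ 6 * d ^ 4 ≤ 8 * (2 * S ^ 4) ^ 6 * Real.exp (4 * κ * S) := by gcongr
      _ = _ := by ring
  have hX0 : 0 ≤ 8 * k ^ 6 * d ^ 4 := by positivity
  have hX3 : (8 * k ^ 6 * d ^ 4) ^ 3 ≤ 512 ^ 3 * S ^ 72 * Real.exp (12 * κ * S) := by
    calc (8 * k ^ 6 * d ^ 4) ^ 3 ≤ (512 * S ^ 24 * Real.exp (4 * κ * S)) ^ 3 := by gcongr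
      _ = 512 ^ 3 * S ^ 72 * Real.exp (4 * κ * S) ^ 3 := by ring
      _ = _ := by rw [← Real.exp_nat_mul]; congr 2; push_cast; ring
  have hV : Real.exp (8 / η / S * k + 16 / (8 / η / S) ^ 2) ≤ Real.exp (η * S ^ 2) := by
    refine Real.exp_le_exp.2 ?_
    refine parameter_exponent_le hη hη1 hS1 hS3 ?_
    rw [hk, ← hb]
    push_cast
    linarith
  have hS4' : 1 ≤ S ^ 4 := one_le_pow₀ hS1
  have hpre : 2 * (k + 1) ≤ 6 * S ^ 4 := by linarith
  have hδpos : 0 < δ := by linarith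
  refine unifProb_le_of_parameters (K := K) (a := 8 / η / S) (s := η) (by exact_mod_cast hn50) hQ
    hδpos hδ (by positivity) ?_ ?_ ?_ ?_ ?_ ?_ ?_ ?_
  · have : 0 ≤ 20 / b / S := by positivity
    linarith
  · rw [hpow]
    refine hX.trans ((le_growth hκ hS1 (by norm_num) (by norm_num) (by norm_num) ?_).trans
      (hG.trans (Real.exp_le_exp.2 ?_)))
    · gcongr; norm_num
    · gcongr; linarith
  · have h1 : 8 * (K : ℝ) ^ 2 ≤ n := by
      calc 8 * (K : ℝ) ^ 2 ≤ 8 * (S ^ 4) ^ 2 := by gcongr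
        _ = 8 * S ^ 8 := by ring
        _ ≤ growth κ S := mul_pow_le_growth hκ hS1 (by norm_num) (by norm_num) (by norm_num)
        _ ≤ n := hGn
    have h2 : 2 * (2 * (K : ℝ)) ^ 2 ≤ n := by linarith
    exact_mod_cast h2
  · have h1 : k * ((8 * k ^ 6 * d ^ 4) ^ 3 * (n : ℝ) ^ (-δ)) ≤ 1 := by
      rw [hpow]
      calc k * ((8 * k ^ 6 * d ^ 4) ^ 3 * Real.exp (-δ * S ^ 2))
          ≤ (2 * S ^ 4) * ((512 ^ 3 * S ^ 72 * Real.exp (12 * κ * S)) *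
            Real.exp (-δ * S ^ 2)) := by gcongr
        _ = (2 * 512 ^ 3 * S ^ 76 * Real.exp (12 * κ * S)) * Real.exp (-δ * S ^ 2) := by ring
        _ ≤ Real.exp (η * S ^ 2) * Real.exp (-δ * S ^ 2) := by
            gcongr
            exact (le_growth hκ hS1 (by norm_num) (by norm_num) (by norm_num) le_rfl).trans hG
        _ ≤ 1 := by
            rw [← Real.exp_add, Real.exp_le_one_iff]
            nlinarith
    calc _ ≤ 6 * S ^ 4 * Real.exp (η * S ^ 2) * (1 + 1) := by gcongr
      _ = 12 * S ^ 4 * Real.exp (η * S ^ 2) := by ring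
      _ ≤ Real.exp (η * S ^ 2) * Real.exp (η * S ^ 2) := by
          gcongr
          exact (mul_pow_le_growth hκ hS1 (by norm_num) (by norm_num) (by norm_num)).trans hG
      _ ≤ n := by
          rw [← Real.exp_add, hnexp]
          refine Real.exp_le_exp.2 ?_
          nlinarith
  -- The gain `n^(-δ)` pays one `n^η` for the entropy, two for the threshold `(n^s)^2` and one for
  -- the subexponential factors, which leaves `n^(-c₀)`.
  · rw [hpow, hpow, hpow]
    calc _ ≤ S ^ 4 * (6 * S ^ 4 * Real.exp (η * S ^ 2) * ((2 * S ^ 4) *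
          ((512 ^ 3 * S ^ 72 * Real.exp (12 * κ * S)) * Real.exp (-δ * S ^ 2)))) *
          Real.exp (η * S ^ 2) ^ 2 := by gcongr
      _ = (12 * 512 ^ 3 * S ^ 84 * Real.exp (12 * κ * S)) *
          (Real.exp (-δ * S ^ 2) * Real.exp (η * S ^ 2) ^ 3) := by ring
      _ ≤ (1 / 2 * Real.exp (η * S ^ 2)) *
          (Real.exp (-δ * S ^ 2) * Real.exp (η * S ^ 2) ^ 3) := by
          refine mul_le_mul_of_nonneg_right ?_ (by positivity)
          have := (le_growth (c := 24 * 512 ^ 3) (j := 84) hκ hS1 (by norm_num) (by norm_num)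
            (by norm_num) le_rfl).trans hG
          linarith
      _ = 1 / 2 * (Real.exp (-δ * S ^ 2) * Real.exp (η * S ^ 2) ^ 4) := by ring
      _ = 1 / 2 * Real.exp (-c₀ * S ^ 2) := by
          rw [← Real.exp_nat_mul, ← Real.exp_add]
          congr 2
          push_cast
          linear_combination S ^ 2 * hηδ
  · rw [hpow]
    have h1 : 4 * S ^ 4 ≤ Real.exp (η * S ^ 2) :=
      (mul_pow_le_growth hκ hS1 (by norm_num) (by norm_num) (by norm_num)).trans hG
    calc (K : ℝ) * Real.exp (-η * S ^ 2)
        ≤ (1 / 4 * Real.exp (η * S ^ 2)) * Real.exp (-η * S ^ 2) := by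
          gcongr; linarith
      _ = 1 / 4 * (Real.exp (η * S ^ 2) * Real.exp (-η * S ^ 2)) := by ring
      _ = 1 / 4 := by rw [← Real.exp_add]; simp
      _ ≤ 1 / 4 := le_rfl
  · set x : ℝ := 20 / b / S with hx
    have hx0 : 0 < x := by positivity
    have h4 : (10 : ℝ) * S ^ 2 ≤ K * Real.log (1 + x) := le_mul_log_one_add hb0 hS0 hS4 hKlow
    calc (n : ℝ) ^ 10 = Real.exp (10 * S ^ 2) := by
          rw [hnexp, ← Real.exp_nat_mul]; norm_num
      _ ≤ Real.exp (K * Real.log (1 + x)) := Real.exp_le_exp.2 h4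
      _ = (1 + x) ^ K := by
          rw [Real.exp_nat_mul, Real.exp_log (by linarith)]
  · have h1 : (n : ℝ) ^ (-1 : ℝ) ≤ (n : ℝ) ^ (-c₀) :=
      Real.rpow_le_rpow_of_exponent_le (by linarith) (by linarith)
    refine le_trans ?_ (mul_le_mul_of_nonneg_left h1 (by norm_num))
    rw [Real.rpow_neg_one, div_le_iff₀ (by positivity)]
    field_simp
    linarith

end

end RandomBistochastic

theorem theorem1 (c₀ δ K : ℝ) (hc₀ : 0 < c₀) (hc₀δ : c₀ < δ) (hδ : δ ≤ 1) (hK : 0 < K) :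
    ∃ c₁ : ℝ, 0 < c₁ ∧
      ∀ (n : ℕ) (Q : Matrix (Fin n) (Fin n) ℝ), 1 ≤ n → Q ∈ doublyStochastic ℝ (Fin n) →
        2 ≤ RandomBistochastic.dParam Q →
        (RandomBistochastic.dParam Q : ℝ) ≤ Real.exp (K * Real.sqrt (Real.log (n : ℝ))) →
        RandomBistochastic.unifProb
            {σ : Equiv.Perm (Fin n) |
              (1 + c₁ * Real.log (RandomBistochastic.dParam Q : ℝ) /
                    Real.sqrt (Real.log (n : ℝ))) * RandomBistochastic.rhoParam δ Q ≤
                RandomBistochastic.absLambdaTwo (RandomBistochastic.permMul σ Q)}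
          ≤ (n : ℝ) ^ (-c₀) := by
  obtain ⟨c₂, S₀, hc₂, hS₀, h⟩ := RandomBistochastic.exists_constants hc₀ hc₀δ hδ hK
  have hlog2 : 0 < Real.log 2 := Real.log_pos (by norm_num)
  have hS₀0 : 0 < S₀ := by linarith
  -- Since `d ≥ 2`, dividing by `log 2` makes `c₁ log d` at least `c₂`, as needed for large `n`, and
  -- at least `S₀ exp(S₀²)`, which makes the event empty for small `n`.
  refine ⟨(c₂ + S₀ * Real.exp (S₀ ^ 2)) / Real.log 2, by positivity, ?_⟩
  intro n Q hn hQ hd2 hd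
  set c₁ := (c₂ + S₀ * Real.exp (S₀ ^ 2)) / Real.log 2 with hc₁
  have hdn : (2 : ℝ) ≤ RandomBistochastic.dParam Q := by exact_mod_cast hd2
  have hn2 : 2 ≤ n := hd2.trans RandomBistochastic.dParam_le
  have hn0 : (0 : ℝ) < n := by exact_mod_cast hn
  have hlogn : 0 < Real.log n := Real.log_pos (by exact_mod_cast hn2)
  have hlogd : Real.log 2 ≤ Real.log (RandomBistochastic.dParam Q) := Real.log_le_log (by norm_num) hdn
  have hρ := RandomBistochastic.rhoParam_pos hn hQ δ
  have hc : c₂ + S₀ * Real.exp (S₀ ^ 2) ≤ c₁ * Real.log (RandomBistochastic.dParam Q) := by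
    calc c₂ + S₀ * Real.exp (S₀ ^ 2) = c₁ * Real.log 2 := by rw [hc₁]; field_simp
      _ ≤ c₁ * Real.log (RandomBistochastic.dParam Q) := by gcongr
  set S := Real.sqrt (Real.log n) with hS
  have hS0 : 0 < S := Real.sqrt_pos.2 hlogn
  rcases le_or_gt S₀ S with hle | hlt
  · refine (RandomBistochastic.unifProb_mono ?_).trans (h n Q hn hQ hle hd)
    intro σ hσ
    rw [Set.mem_ofPred_eq] at hσ ⊢
    refine le_trans ?_ hσ
    have : c₂ ≤ c₁ * Real.log (RandomBistochastic.dParam Q) := by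
      have : 0 < S₀ * Real.exp (S₀ ^ 2) := by positivity
      linarith
    gcongr
  -- Here `n ≤ exp(S₀²) ≤ ε`, so `(1 + ε)ρ > nρ ≥ nρ² ≥ 1`, whereas eigenvalues of a stochastic
  -- matrix have modulus at most 1.
  · have hempty : {σ : Equiv.Perm (Fin n) | (1 + c₁ * Real.log (RandomBistochastic.dParam Q) / S) * RandomBistochastic.rhoParam δ Q ≤
        RandomBistochastic.absLambdaTwo (RandomBistochastic.permMul σ Q)} = ∅ := by
      rw [Set.eq_empty_iff_forall_notMem]
      intro σ hσ
      have h1 : Real.exp (S₀ ^ 2) ≤ c₁ * Real.log (RandomBistochastic.dParam Q) / S := by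
        rw [le_div_iff₀ hS0]
        have : Real.exp (S₀ ^ 2) * S ≤ S₀ * Real.exp (S₀ ^ 2) := by
          rw [mul_comm]; gcongr
        linarith
      have h2 : (n : ℝ) ≤ Real.exp (S₀ ^ 2) := by
        rw [← Real.exp_log hn0]
        refine Real.exp_le_exp.2 ?_
        rw [← Real.sq_sqrt hlogn.le]
        gcongr
      have h3 := RandomBistochastic.one_le_mul_sq_rhoParam hn hQ δ
      have h4 := RandomBistochastic.rhoParam_le_one hn hQ δ
      have h5 : 1 < (1 + c₁ * Real.log (RandomBistochastic.dParam Q) / S) * RandomBistochastic.rhoParam δ Q := by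
        have h6 : (n : ℝ) * RandomBistochastic.rhoParam δ Q ≤ c₁ * Real.log (RandomBistochastic.dParam Q) / S * RandomBistochastic.rhoParam δ Q := by
          gcongr
          linarith
        have h7 : (n : ℝ) * RandomBistochastic.rhoParam δ Q ^ 2 ≤ n * RandomBistochastic.rhoParam δ Q := by
          gcongr
          exact pow_le_of_le_one hρ.le h4 two_ne_zero
        linarith
      exact absurd (RandomBistochastic.absLambdaTwo_permMul_le_one hQ σ (by linarith) hσ) (not_le.2 h5)
    rw [hempty]
    have : RandomBistochastic.unifProb (∅ : Set (Equiv.Perm (Fin n))) = 0 := by simp [RandomBistochastic.unifProb]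
    rw [this]
    positivity
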